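/- **Setting.** Fix integers $J\ge 0$ and $N\ge 1$. Index coordinates of $\mathbb R^{J+1}$ by $0$ (the policy variable) and $1,\dots,J$ (the outcome variables). Let $\Phi\in\mathbb R^{(J+1)\times(J+1)}$ have all its complex eigenvalues of modulus $<1$, and let $\mu_1,\dots,\mu_N\in\mathbb R^{J+1}$, $\beta\in\mathbb R^J$, $\mu_Z\in\mathbb R$, $\sigma_Z^2>0$; put $b=(1,\beta_1,\dots,\beta_J)'$. For each sample size $T$ let $\mathcal P_T$ be a probability law under which $$x_{i,t}=(I-\Phi)\mu_i+\Phi x_{i,t-1}+\tilde x_{i,t},\qquad \tilde x_{i,t}=(\widetilde W_{i,t},\widetilde Y_{1,i,t},\dots,\widetilde Y_{J,i,t})',\qquad i=1,\dots,N,\ t\ge 1,$$ and instruments $Z_{i,t}$ are such that: * the vectors $(Z_{i,t},\tilde x_{i,t})_{i\le N}$, $t=1,2,\dots$, are independent and identically distributed over $t$ and jointly Gaussian (the units may be dependent), with $E\tilde x_{i,t}=0$, $EZ_{i,t}=\mu_Z$, $\operatorname{var}Z_{i,t}=\sigma_Z^2$; the presample values $(x_{i,0})_{i\le N}$ are independent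 of them and have second moments bounded uniformly in $T$; * (exclusion moment condition) $E[Z_{i,t}(\widetilde Y_{j,i',t}-\beta_j\widetilde W_{i',t})]=0$ for all $j$ and all units $i,i'$ (for $i\neq i'$ this follows from $i=i'$ if the units are independent or the instrument is common to all units); * $\operatorname{cov}(Z_{i,t},\widetilde W_{i,t})=\delta_T$ for all $i,t$, and $\delta_T\to\delta\in\mathbb R$; the case $\delta=0$, and also $\delta_T=0$, is allowed; * the covariance matrix $\Sigma_T$ of the stacked vector $(\tilde x_{1,t}',\dots,\tilde x_{N,t}')'$ converges to a positive definite matrix $\Sigma$. The impulse response of variable $s$ at horizon $k\ge 0$ is $\lambda_{k,s}=e_s'\Phi^k b$, which equals $e_s'\Phi^k\Gamma_T/e_0'\Gamma_T$ with $\Gamma_T=\delta_T b=\operatorname{cov}(Z_{i,t},\tilde x_{i,t})$ whenever $\delta_T\ne 0$. **The Anderson–Rubin set.** From the sample of periods $1,\dots,T$ (with the presample values as first lags), let $\dot x_{i,t}$, $\dot x^-_{i,t}$ and $\dot Z_{i,t}$ be the deviations of $x_{i,t}$, $x_{i,t-1}$ and $Z_{i,t}$ from their means over $t=1,\dots,T$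 for unit $i$. Let $$S_T=\sum_{i,t}\dot x^-_{i,t}\dot x^{-\prime}_{i,t},\quad \hat\Phi_T=\Big(\sum_{i,t}\dot x_{i,t}\dot x^{-\prime}_{i,t}\Big)S_T^{-1},\quad \hat u_{i,t}=\dot x_{i,t}-\hat\Phi_T\dot x^-_{i,t},\quad \hat\Gamma_T=\frac1{NT}\sum_{i,t}\dot Z_{i,t}\hat u_{i,t}.$$ For $l\in\mathbb R$ let $g_l(F,\Gamma)=e_s'F^k\Gamma-l\,e_0'\Gamma$, whose derivative at $(F,\Gamma)$ in direction $(H,h)$ is $$Dg_l(F,\Gamma)[H,h]=e_s'\sum_{r=0}^{k-1}F^rHF^{k-1-r}\Gamma+e_s'F^kh-l\,e_0'h .$$ Put $G_T(l)=\sqrt T\,g_l(\hat\Phi_T,\hat\Gamma_T)$ and let $\hat\sigma_T^2(l)=\frac1T\sum_{t=1}^T\hat\psi_t(l)^2$ be the delta-method estimator of its asymptotic variance clustered by period, where $$\hat\psi_t(l)=Dg_l(\hat\Phi_T,\hat\Gamma_T)\Big[\sum_i\hat u_{i,t}\dot x^{-\prime}_{i,t}\,(S_T/T)^{-1},\ \tfrac1N\sum_i\dot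 Z_{i,t}\hat u_{i,t}-\hat\Gamma_T\Big].$$ With $z_p$ the $p$-quantile of $\mathcal N(0,1)$ and $\alpha\in(0,1)$, let $$\mathrm{CS}^{AR}_T(1-\alpha)=\{l\in\mathbb R: G_T(l)^2\le z_{1-\alpha/2}^2\,\hat\sigma_T^2(l)\}.$$ **Proposition.** Assume that the derivative $Dg_{\lambda_{k,s}}(\Phi,\delta b)$ is not the zero map. Then, with $N$ fixed, $$\lim_{T\to\infty}\mathcal P_T\big(\lambda_{k,s}\in\mathrm{CS}^{AR}_T(1-\alpha)\big)=1-\alpha .$$ No instrument relevance ($\delta\neq0$) is assumed. -/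

import Mathlib

open MeasureTheory ProbabilityTheory Filter Topology

namespace PSVARIV

noncomputable section

/-- The vector `(1, β₁, …, β_J)` of unit-normalised impact responses; the policy variable has
index `0` and the outcome variables have the indices `1, …, J`. -/
def impact {J : ℕ} (β : Fin J → ℝ) : Fin (J + 1) → ℝ := Fin.cons 1 β

/-- The impulse response `λ_{k,s} = e_s' Φ^k (1, β')'` of variable `s` at horizon `k`.  If the
covariance `δ` of the instrument with the policy disturbance is not `0`, then this is the ratio
`e_s' Φ^k Γ / e_0' Γ`, where `Γ = δ (1, β')'`. -/
def irf {J : ℕ} (Φ : Matrix (Fin (J + 1)) (Fin (J + 1)) ℝ) (β : Fin J → ℝ) (k : ℕ)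
    (s : Fin (J + 1)) : ℝ :=
  ((Φ ^ k).mulVec (impact β)) s

/-- The panel model with data `x`, `Z` and disturbances `u` under the probability law `P`.
Units are `i : Fin N`, time `0` is the presample period and the sample periods are `1, 2, …`.
`S` is the covariance matrix of the stacked disturbances of all units. -/
structure IsModel {J N : ℕ} {Ω : Type*} [MeasurableSpace Ω] (P : Measure Ω)
    (Φ : Matrix (Fin (J + 1)) (Fin (J + 1)) ℝ) (μ : Fin N → Fin (J + 1) → ℝ)
    (β : Fin J → ℝ) (μZ varZ δ : ℝ)
    (S : Matrix (Fin N × Fin (J + 1)) (Fin N × Fin (J + 1)) ℝ)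
    (x u : Fin N → ℕ → Ω → Fin (J + 1) → ℝ) (Z : Fin N → ℕ → Ω → ℝ) : Prop where
  /-- the panel vector autoregression with unit-specific effects -/
  pvar : ∀ i t ω, x i (t + 1) ω = (1 - Φ).mulVec (μ i) + Φ.mulVec (x i t ω) + u i (t + 1) ω
  /-- instruments and disturbances of one period are jointly Gaussian (over all units) -/
  gaussian : ∀ t, HasGaussianLaw (fun ω (i : Fin N) => (Z i (t + 1) ω, u i (t + 1) ω)) P
  /-- stationarity -/
  stationary : ∀ t, IdentDistrib (fun ω (i : Fin N) => (Z i (t + 1) ω, u i (t + 1) ω))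
    (fun ω (i : Fin N) => (Z i 1 ω, u i 1 ω)) P P
  /-- serial independence -/
  indep : iIndepFun (fun (t : ℕ) ω (i : Fin N) => (Z i (t + 1) ω, u i (t + 1) ω)) P
  /-- the presample values are random variables, independent of all later shocks -/
  measurable_init : ∀ i, AEMeasurable (x i 0) P
  indep_init : IndepFun (fun ω (i : Fin N) => x i 0 ω)
    (fun ω (t : ℕ) (i : Fin N) => (Z i (t + 1) ω, u i (t + 1) ω)) P
  mean_u : ∀ i t a, ∫ ω, u i (t + 1) ω a ∂P = 0
  cov_u : ∀ i i' t a a',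
    cov[fun ω => u i (t + 1) ω a, fun ω => u i' (t + 1) ω a'; P] = S (i, a) (i', a')
  mean_Z : ∀ i t, ∫ ω, Z i (t + 1) ω ∂P = μZ
  var_Z : ∀ i t, Var[Z i (t + 1); P] = varZ
  /-- `δ` is the covariance of the instrument and the policy disturbance; it may be `0` -/
  cov_policy : ∀ i t, cov[Z i (t + 1), fun ω => u i (t + 1) ω 0; P] = δ
  /-- exclusion: the instruments are orthogonal to the second-stage errors `Y_j - β_j W` -/
  exclusion : ∀ i i' t (j : Fin J),
    ∫ ω, Z i (t + 1) ω * (u i' (t + 1) ω j.succ - β j * u i' (t + 1) ω 0) ∂P = 0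

/-- Deviation of the `t`-th term from the mean of the terms `0, …, T - 1`. -/
def demean {V : Type*} [AddCommGroup V] [Module ℝ V] (T : ℕ) (f : ℕ → V) (t : ℕ) : V :=
  f t - (T : ℝ)⁻¹ • ∑ r ∈ Finset.range T, f r

section Sample

variable {J N : ℕ} (T : ℕ) (x : Fin N → ℕ → Fin (J + 1) → ℝ) (Z : Fin N → ℕ → ℝ)

/-- Within-unit deviation of the regressand of period `t + 1`. -/
def regressand (i : Fin N) (t : ℕ) : Fin (J + 1) → ℝ := demean T (fun r => x i (r + 1)) t

/-- Within-unit deviation of the regressor (the first lag) of period `t + 1`. -/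
def regressor (i : Fin N) (t : ℕ) : Fin (J + 1) → ℝ := demean T (x i) t

/-- Within-unit deviation of the instrument of period `t + 1`. -/
def instrument (i : Fin N) (t : ℕ) : ℝ := demean T (fun r => Z i (r + 1)) t

/-- Gram matrix of the regressors. -/
def gram : Matrix (Fin (J + 1)) (Fin (J + 1)) ℝ :=
  ∑ i, ∑ t ∈ Finset.range T, Matrix.vecMulVec (regressor T x i t) (regressor T x i t)

/-- The least-squares estimator of `Φ` with unit fixed effects (within estimator). -/
def phiHat : Matrix (Fin (J + 1)) (Fin (J + 1)) ℝ :=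
  (∑ i, ∑ t ∈ Finset.range T, Matrix.vecMulVec (regressand T x i t) (regressor T x i t))
    * (gram T x)⁻¹

/-- The least-squares residual of unit `i` in period `t + 1`. -/
def residual (i : Fin N) (t : ℕ) : Fin (J + 1) → ℝ :=
  regressand T x i t - (phiHat T x).mulVec (regressor T x i t)

/-- The pooled sample covariance of the instrument and the residuals. -/
def gammaHat : Fin (J + 1) → ℝ :=
  ((N : ℝ) * (T : ℝ))⁻¹ •
    ∑ i, ∑ t ∈ Finset.range T, instrument T Z i t • residual T x i t

end Sample

/-- `e_s' Φ^k Γ - l e_0' Γ`, which vanishes if `l` is the impulse response. -/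
def gap {J : ℕ} (k : ℕ) (s : Fin (J + 1)) (l : ℝ)
    (Φ : Matrix (Fin (J + 1)) (Fin (J + 1)) ℝ) (Γ : Fin (J + 1) → ℝ) : ℝ :=
  ((Φ ^ k).mulVec Γ) s - l * Γ 0

/-- The derivative of `gap k s l` at `(Φ, Γ)` in the direction `(H, h)`. -/
def gapDeriv {J : ℕ} (k : ℕ) (s : Fin (J + 1)) (l : ℝ)
    (Φ : Matrix (Fin (J + 1)) (Fin (J + 1)) ℝ) (Γ : Fin (J + 1) → ℝ)
    (H : Matrix (Fin (J + 1)) (Fin (J + 1)) ℝ) (h : Fin (J + 1) → ℝ) : ℝ :=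
  ((∑ j ∈ Finset.range k, Φ ^ j * H * Φ ^ (k - 1 - j)).mulVec Γ) s + gap k s l Φ h

section Sample

variable {J N : ℕ} (T : ℕ) (x : Fin N → ℕ → Fin (J + 1) → ℝ) (Z : Fin N → ℕ → ℝ)
  (k : ℕ) (s : Fin (J + 1)) (l : ℝ)

/-- The statistic `G_T(l) = √T (e_s' Φ̂^k Γ̂ - l e_0' Γ̂)`. -/
def G : ℝ := Real.sqrt T * gap k s l (phiHat T x) (gammaHat T x Z)

/-- The estimated contribution of period `t + 1` to `G_T(l)` in the linearisation of the latter
(the delta method): the directions are the contributions of that period to the estimation errors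
of `Φ̂` and `Γ̂`, summed over the units. -/
def score (t : ℕ) : ℝ :=
  gapDeriv k s l (phiHat T x) (gammaHat T x Z)
    ((∑ i, Matrix.vecMulVec (residual T x i t) (regressor T x i t))
      * ((T : ℝ)⁻¹ • gram T x)⁻¹)
    ((N : ℝ)⁻¹ • (∑ i, instrument T Z i t • residual T x i t) - gammaHat T x Z)

/-- The delta-method estimator, clustered by period, of the asymptotic variance of `G_T(l)`. -/
def varHat : ℝ := (T : ℝ)⁻¹ * ∑ t ∈ Finset.range T, score T x Z k s l t ^ 2

/-- The `p`-quantile of the standard normal distribution. -/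
def normalQuantile (p : ℝ) : ℝ := sInf {y : ℝ | p ≤ cdf (gaussianReal 0 1) y}

/-- The Anderson–Rubin confidence set of nominal level `1 - α` for the response of variable `s`
at horizon `k`. -/
def arSet (α : ℝ) : Set ℝ :=
  {l : ℝ | G T x Z k s l ^ 2 ≤ normalQuantile (1 - α / 2) ^ 2 * varHat T x Z k s l}

end Sample

end

end PSVARIV

/-! At the true response, the gradient d of the gap in Γ (`dvec`) satisfies d'b = 0, whatever the
value of δ (`sum_dvec_irf_mul_impact`). So d'u is a combination of the second-stage errors,
exclusion makes it orthogonal to the instruments, and the statistic is centred without any division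
by δ. This is why weak or irrelevant instruments do no harm.

The difference F^k - G^k telescopes exactly, so G_T equals √T times the Frobenius pairing of a
difference quotient (`sens`) with Φ̂ - Φ, plus √T d'Γ̂. The quotient converges, √T(Φ̂ - Φ) is
bounded in probability, and replacing residuals by disturbances in Γ̂ costs o_p(1) even after
multiplication by √T. Hence G_T is, up to o_p(1), √T times the average of ∑ C_k u_k + ζ. Here the
C_k are linear in the lagged process and ζ = N⁻¹ ∑_i z_i d'u_i (`IsSample.tendsto_statistic_sub`).
The summands are martingale differences.

Their averaged conditional variances are asymptotically V_T = `slopeVar` + E ζ². The covariances of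
the instruments of different units need not converge, so V_T need not either. The central limit
theorem is therefore normalised by V_T, and all that is needed is that V_T stays away from 0
(`IsSecondMoment.exists_le_variance`). If the slope gradient is nonzero, positive definiteness of Σ
bounds `slopeVar` from below. If d ≠ 0, joint Gaussianity turns orthogonality into independence of
the z_i from the d'u_i, and E ζ² is bounded below by a multiple of var Z · |d|². A nonzero
derivative means that one of the two cases holds.

The estimated scores are close to the summands in mean square, so the clustered variance estimator
minus V_T tends to 0 (`IsSample.approx_score`, `LinStat.tendsto_avg_sq`). Studentisation and
Slutsky's lemma then give the coverage 1 - α. Since the law changes with T, all limit theorems are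
for triangular arrays: a martingale central limit theorem proved by characteristic functions
(`tendsto_integral_cexp_sum`), and laws of large numbers that rest on the orthogonality of
martingale differences (`op_sum_past_mul`). -/

namespace PSVARIV

/-! ### Convergence and boundedness in probability along a sequence of probability spaces -/

section InProbability

variable {Ω : ℕ → Type*} [∀ T, MeasurableSpace (Ω T)]

/-- The filter of sequences of events whose probability tends to `1`.  Convergence in probability
along a sequence of probability spaces is convergence along this filter. -/
def inProb (P : ∀ T, Measure (Ω T)) : Filter (Σ T, Ω T) where
  sets := {A | Tendsto (fun T => P T {ω | (⟨T, ω⟩ : Σ T, Ω T) ∉ A}) atTop (𝓝 0)}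
  univ_sets := by simp
  sets_of_superset := by
    intro A B hA hAB
    refine tendsto_of_tendsto_of_tendsto_of_le_of_le tendsto_const_nhds hA (fun _ => zero_le)
      (fun T => measure_mono fun ω hω h => hω (hAB h))
  inter_sets := by
    intro A B hA hB
    have h := Tendsto.add hA hB
    rw [add_zero] at h
    refine tendsto_of_tendsto_of_tendsto_of_le_of_le tendsto_const_nhds h (fun _ => zero_le)
      (fun T => ?_)
    refine (measure_mono ?_).trans (measure_union_le _ _)
    intro ω hω
    by_cases h : (⟨T, ω⟩ : Σ T, Ω T) ∈ A
    · exact Or.inr fun h' => hω ⟨h, h'⟩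
    · exact Or.inl h

variable {P : ∀ T, Measure (Ω T)}

lemma eventually_inProb {p : (Σ T, Ω T) → Prop} :
    (∀ᶠ q in inProb P, p q) ↔ Tendsto (fun T => P T {ω | ¬ p ⟨T, ω⟩}) atTop (𝓝 0) := Iff.rfl

lemma tendsto_fst_inProb : Tendsto Sigma.fst (inProb P) atTop := by
  refine tendsto_atTop.2 fun n => ?_
  rw [eventually_inProb]
  refine tendsto_const_nhds.congr' ?_
  filter_upwards [eventually_ge_atTop n] with T hT
  simp [hT]

lemma eventually_inProb_of_ae {p : (Σ T, Ω T) → Prop} (h : ∀ T, ∀ᵐ ω ∂(P T), p ⟨T, ω⟩) :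
    ∀ᶠ q in inProb P, p q := by
  rw [eventually_inProb]
  refine tendsto_const_nhds.congr fun T => ?_
  exact (ae_iff.1 (h T)).symm

/-- Because the filter is nontrivial, weak inequalities pass to limits in probability. This is how
positivity of sample moments is inherited by the limiting moment matrices. -/
instance [∀ T, IsProbabilityMeasure (P T)] : (inProb P).NeBot := by
  refine ⟨fun h => ?_⟩
  have h0 : ∀ᶠ q in inProb P, False := by rw [h]; exact eventually_bot
  rw [eventually_inProb] at h0
  simp only [not_false_eq_true, Set.ofPred_true, measure_univ] at h0
  exact one_ne_zero (tendsto_nhds_unique tendsto_const_nhds h0)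

lemma tendsto_inProb_zero {X : (Σ T, Ω T) → ℝ} :
    Tendsto X (inProb P) (𝓝 0) ↔
      ∀ ε > 0, Tendsto (fun T => P T {ω | ε ≤ |X ⟨T, ω⟩|}) atTop (𝓝 0) := by
  rw [Metric.tendsto_nhds]
  refine forall₂_congr fun ε _ => ?_
  rw [eventually_inProb]
  simp

/-- Boundedness in probability (uniform tightness up to finitely many indices). -/
def OP (P : ∀ T, Measure (Ω T)) (X : (Σ T, Ω T) → ℝ) : Prop :=
  ∀ ε : ENNReal, 0 < ε → ∃ M : ℝ, ∀ᶠ T in atTop, P T {ω | M < |X ⟨T, ω⟩|} ≤ ε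

lemma OP.mono_of_eventually {X Y : (Σ T, Ω T) → ℝ} (hY : OP P Y)
    (h : ∀ᶠ q in inProb P, |X q| ≤ |Y q|) : OP P X := by
  intro ε hε
  obtain ⟨M, hM⟩ := hY (ε / 2) (ENNReal.half_pos hε.ne')
  refine ⟨M, ?_⟩
  rw [eventually_inProb] at h
  filter_upwards [hM, h.eventually_le_const (ENNReal.half_pos hε.ne')] with T h1 h2
  rw [← ENNReal.add_halves ε]
  refine le_trans (measure_mono ?_) ((measure_union_le _ _).trans (add_le_add h1 h2))
  intro ω hω
  by_cases hc : |X ⟨T, ω⟩| ≤ |Y ⟨T, ω⟩|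
  · exact Or.inl (lt_of_lt_of_le hω hc)
  · exact Or.inr hc

lemma OP.mono {X Y : (Σ T, Ω T) → ℝ} (hY : OP P Y) (h : ∀ q, |X q| ≤ |Y q|) : OP P X :=
  hY.mono_of_eventually (Eventually.of_forall h)

lemma OP.of_tendsto {X : (Σ T, Ω T) → ℝ} {c : ℝ} (h : Tendsto X (inProb P) (𝓝 c)) :
    OP P X := by
  intro ε hε
  refine ⟨|c| + 1, ?_⟩
  have h1 := h.abs.eventually_le_const (lt_add_one |c|)
  rw [eventually_inProb] at h1
  simpa using h1.eventually_le_const hε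

lemma OP.const (c : ℝ) : OP P (fun _ => c) := OP.of_tendsto tendsto_const_nhds

lemma OP.add {X Y : (Σ T, Ω T) → ℝ} (hX : OP P X) (hY : OP P Y) :
    OP P (fun q => X q + Y q) := by
  intro ε hε
  obtain ⟨M, hM⟩ := hX (ε / 2) (ENNReal.half_pos hε.ne')
  obtain ⟨K, hK⟩ := hY (ε / 2) (ENNReal.half_pos hε.ne')
  refine ⟨M + K, ?_⟩
  filter_upwards [hM, hK] with T h1 h2
  rw [← ENNReal.add_halves ε]
  refine le_trans (measure_mono ?_) ((measure_union_le _ _).trans (add_le_add h1 h2))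
  intro ω hω
  by_contra hc
  simp only [Set.mem_union, Set.mem_ofPred_eq, not_or, not_lt] at hc hω
  have := abs_add_le (X ⟨T, ω⟩) (Y ⟨T, ω⟩)
  linarith

lemma OP.mul {X Y : (Σ T, Ω T) → ℝ} (hX : OP P X) (hY : OP P Y) :
    OP P (fun q => X q * Y q) := by
  intro ε hε
  obtain ⟨M, hM⟩ := hX (ε / 2) (ENNReal.half_pos hε.ne')
  obtain ⟨K, hK⟩ := hY (ε / 2) (ENNReal.half_pos hε.ne')
  refine ⟨M * K, ?_⟩
  filter_upwards [hM, hK] with T h1 h2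
  rw [← ENNReal.add_halves ε]
  refine le_trans (measure_mono ?_) ((measure_union_le _ _).trans (add_le_add h1 h2))
  intro ω hω
  by_contra hc
  simp only [Set.mem_union, Set.mem_ofPred_eq, not_or, not_lt] at hc hω
  rw [abs_mul] at hω
  have := mul_le_mul hc.1 hc.2 (abs_nonneg _) ((abs_nonneg _).trans hc.1)
  linarith

lemma OP.sum {ι : Type*} (s : Finset ι) {X : ι → (Σ T, Ω T) → ℝ} (h : ∀ i ∈ s, OP P (X i)) :
    OP P (fun q => ∑ i ∈ s, X i q) := by
  classical
  induction s using Finset.induction_on with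
  | empty => simpa using OP.const 0
  | insert i s hi ih =>
    simp only [Finset.sum_insert hi]
    exact (h i (by simp)).add (ih fun j hj => h j (by simp [hj]))

lemma OP.const_mul {X : (Σ T, Ω T) → ℝ} (hX : OP P X) (c : ℝ) : OP P (fun q => c * X q) :=
  (OP.const c).mul hX

lemma OP.pow {X : (Σ T, Ω T) → ℝ} (hX : OP P X) (n : ℕ) : OP P (fun q => X q ^ n) := by
  induction n with
  | zero => simpa using OP.const 1
  | succ n ih => simpa [pow_succ] using ih.mul hX

lemma OP.mul_tendsto {X Y : (Σ T, Ω T) → ℝ} (hX : OP P X) (hY : Tendsto Y (inProb P) (𝓝 0)) :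
    Tendsto (fun q => X q * Y q) (inProb P) (𝓝 0) := by
  rw [tendsto_inProb_zero]
  intro η hη
  rw [ENNReal.tendsto_nhds_zero]
  intro ε hε
  obtain ⟨M, hM⟩ := hX (ε / 2) (ENNReal.half_pos hε.ne')
  have hpos : 0 < η / (|M| + 1) := by positivity
  have h2 := (ENNReal.tendsto_nhds_zero.1 (tendsto_inProb_zero.1 hY _ hpos)) (ε / 2)
    (ENNReal.half_pos hε.ne')
  filter_upwards [hM, h2] with T h1 h2
  rw [← ENNReal.add_halves ε]
  refine le_trans (measure_mono ?_) ((measure_union_le _ _).trans (add_le_add h1 h2))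
  intro ω hω
  by_contra hc
  simp only [Set.mem_union, Set.mem_ofPred_eq, not_or, not_lt, not_le] at hc hω
  rw [abs_mul] at hω
  have h3 : |X ⟨T, ω⟩| * |Y ⟨T, ω⟩| ≤ |M| * |Y ⟨T, ω⟩| :=
    mul_le_mul_of_nonneg_right (hc.1.trans (le_abs_self M)) (abs_nonneg _)
  have h4 : |M| * |Y ⟨T, ω⟩| ≤ |M| * (η / (|M| + 1)) :=
    mul_le_mul_of_nonneg_left hc.2.le (abs_nonneg _)
  have h5 : |M| * (η / (|M| + 1)) < η := by
    rw [mul_div_assoc', div_lt_iff₀ (by positivity)]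
    nlinarith
  linarith

/-- Markov's inequality. -/
lemma measure_le_of_integral_abs [∀ T, IsProbabilityMeasure (P T)] {T : ℕ} {X : Ω T → ℝ} {c M : ℝ}
    (hX : Integrable X (P T)) (hc : ∫ ω, |X ω| ∂(P T) ≤ c) (hM : 0 < M) :
    P T {ω | M ≤ |X ω|} ≤ ENNReal.ofReal (c / M) := by
  have h := mul_meas_ge_le_integral_of_nonneg (μ := P T) (f := fun ω => |X ω|)
    (Eventually.of_forall fun ω => abs_nonneg _) hX.abs M
  rw [← ENNReal.ofReal_toReal (measure_ne_top (P T) {ω | M ≤ |X ω|})]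
  refine ENNReal.ofReal_le_ofReal ?_
  rw [le_div_iff₀ hM, mul_comm]
  exact h.trans hc

lemma OP.of_integral [∀ T, IsProbabilityMeasure (P T)] {X : (Σ T, Ω T) → ℝ} (c : ℝ)
    (hX : ∀ T, Integrable (fun ω => X ⟨T, ω⟩) (P T))
    (hc : ∀ᶠ T in atTop, ∫ ω, |X ⟨T, ω⟩| ∂(P T) ≤ c) : OP P X := by
  intro ε hε
  have hlim : Tendsto (fun M : ℝ => ENNReal.ofReal (c / M)) atTop (𝓝 0) := by
    rw [← ENNReal.ofReal_zero]
    exact ENNReal.tendsto_ofReal (tendsto_const_nhds.div_atTop tendsto_id)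
  obtain ⟨M, hM, hM0⟩ := ((hlim.eventually_le_const hε).and (eventually_gt_atTop 0)).exists
  refine ⟨M, ?_⟩
  filter_upwards [hc] with T hT
  refine le_trans (measure_mono fun ω hω => ?_)
    ((measure_le_of_integral_abs (hX T) hT hM0).trans hM)
  exact (show M < |X ⟨T, ω⟩| from hω).le

lemma tendsto_zero_of_integral [∀ T, IsProbabilityMeasure (P T)] {X : (Σ T, Ω T) → ℝ} {c : ℕ → ℝ}
    (hX : ∀ T, Integrable (fun ω => X ⟨T, ω⟩) (P T))
    (hc : ∀ᶠ T in atTop, ∫ ω, |X ⟨T, ω⟩| ∂(P T) ≤ c T) (h0 : Tendsto c atTop (𝓝 0)) :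
    Tendsto X (inProb P) (𝓝 0) := by
  rw [tendsto_inProb_zero]
  intro ε hε
  have hlim : Tendsto (fun T => ENNReal.ofReal (c T / ε)) atTop (𝓝 0) := by
    rw [← ENNReal.ofReal_zero]
    exact ENNReal.tendsto_ofReal (by simpa using h0.div_const ε)
  refine tendsto_of_tendsto_of_tendsto_of_le_of_le' tendsto_const_nhds hlim
    (Eventually.of_forall fun _ => zero_le) ?_
  filter_upwards [hc] with T hT
  exact measure_le_of_integral_abs (hX T) hT hε

/-- Expectations of bounded variables that converge to `0` in probability converge to `0`. -/
lemma tendsto_integral_of_bounded [∀ T, IsProbabilityMeasure (P T)] {X : (Σ T, Ω T) → ℝ} (C : ℝ)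
    (hX : ∀ T, AEStronglyMeasurable (fun ω => X ⟨T, ω⟩) (P T)) (hC : ∀ q, |X q| ≤ C)
    (h : Tendsto X (inProb P) (𝓝 0)) :
    Tendsto (fun T => ∫ ω, |X ⟨T, ω⟩| ∂(P T)) atTop (𝓝 0) := by
  rw [tendsto_inProb_zero] at h
  rw [Metric.tendsto_atTop']
  intro ε hε
  have hC0 : 0 < |C| + 1 := by positivity
  have h1 := (ENNReal.tendsto_toReal ENNReal.zero_ne_top).comp (h (ε / 2) (by positivity))
  simp only [ENNReal.toReal_zero] at h1
  have h2 := h1.eventually_lt_const (u := ε / 2 / (|C| + 1)) (by positivity)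
  obtain ⟨n, hn⟩ := eventually_atTop.1 h2
  refine ⟨n, fun T hT => ?_⟩
  have hn := hn T hT.le
  simp only [Function.comp] at hn
  have hXi : Integrable (fun ω => X ⟨T, ω⟩) (P T) :=
    Integrable.of_bound (hX T) C (Eventually.of_forall fun ω => hC _)
  set A : Set (Ω T) := {ω | ε / 2 ≤ |X ⟨T, ω⟩|} with hA
  have hAm : NullMeasurableSet A (P T) :=
    nullMeasurableSet_le aemeasurable_const (hX T).aemeasurable.abs
  rw [Real.dist_eq, sub_zero, abs_of_nonneg (integral_nonneg fun ω => abs_nonneg _)]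
  have hb : ∫ ω, |X ⟨T, ω⟩| ∂(P T) ≤ ∫ ω, (ε / 2 + A.indicator (fun _ => |C| + 1) ω) ∂(P T) := by
    refine integral_mono hXi.abs ?_ fun ω => ?_
    · exact (integrable_const _).add ((integrable_const _).indicator₀ hAm)
    · by_cases hω : ω ∈ A
      · have := (hC ⟨T, ω⟩).trans (le_abs_self C)
        simp only [Set.indicator_of_mem hω]
        linarith
      · simp only [Set.indicator_of_notMem hω, add_zero]
        exact (not_le.1 hω).le
  refine hb.trans_lt ?_
  rw [integral_add (integrable_const _)
    ((integrable_const _).indicator₀ hAm),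
    integral_indicator₀ hAm, setIntegral_const]
  simp only [integral_const, probReal_univ, smul_eq_mul, one_mul]
  have : (P T).real A * (|C| + 1) < ε / 2 := by
    rw [← lt_div_iff₀ hC0]; exact hn
  linarith

end InProbability


/-! ### Taylor bounds and the compensated characteristic function -/

section CentralLimit

/-- Valid for all real x, so that third absolute moments control the remainder with no Lindeberg
truncation; the constant 4 is chosen for convenience. -/
lemma norm_cexp_sub_quadratic_le (x : ℝ) :
    ‖Complex.exp (x * Complex.I) - 1 - x * Complex.I + (x : ℂ) ^ 2 / 2‖ ≤ 4 * |x| ^ 3 := by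
  rcases le_or_gt |x| 1 with hx | hx
  · have h := Complex.exp_bound (x := x * Complex.I) (by simpa using hx) (n := 3) (by norm_num)
    have hs : ∑ m ∈ Finset.range 3, ((x : ℂ) * Complex.I) ^ m / (m.factorial : ℂ)
        = 1 + x * Complex.I - (x : ℂ) ^ 2 / 2 := by
      simp [Finset.sum_range_succ, mul_pow, Nat.factorial]
      ring
    rw [hs] at h
    have h3 : Complex.exp (x * Complex.I) - 1 - x * Complex.I + (x : ℂ) ^ 2 / 2
        = Complex.exp (x * Complex.I) - (1 + x * Complex.I - (x : ℂ) ^ 2 / 2) := by ring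
    rw [h3]
    refine h.trans ?_
    simp only [norm_mul, Complex.norm_real, Complex.norm_I, mul_one, Real.norm_eq_abs]
    norm_num [Nat.factorial]
    nlinarith [pow_nonneg (abs_nonneg x) 3]
  -- For |x| > 1 every term is at most |x|³, so the triangle inequality suffices.
  · have h1 : ‖Complex.exp (x * Complex.I)‖ = 1 := Complex.norm_exp_ofReal_mul_I x
    have h2 : ‖(x : ℂ) * Complex.I‖ = |x| := by simp
    have h3 : ‖(x : ℂ) ^ 2 / 2‖ = |x| ^ 2 / 2 := by simp
    have h4 := norm_add_le (Complex.exp (x * Complex.I) - 1 - x * Complex.I) ((x : ℂ) ^ 2 / 2)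
    have h5 := norm_sub_le (Complex.exp (x * Complex.I) - 1) (x * Complex.I)
    have h6 := norm_sub_le (Complex.exp (x * Complex.I)) 1
    rw [norm_one] at h6
    have h7 : |x| ≤ |x| ^ 2 := by nlinarith
    have h8 : |x| ^ 2 ≤ |x| ^ 3 := by nlinarith [sq_nonneg |x|]
    linarith

lemma abs_exp_neg_sub_linear_le {y : ℝ} (hy : 0 ≤ y) : |Real.exp (-y) - 1 + y| ≤ y ^ 2 := by
  rcases le_or_gt y 1 with h | h
  · have := Real.abs_exp_sub_one_sub_id_le (x := -y) (by rwa [abs_neg, abs_of_nonneg hy])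
    rw [neg_sq, sub_neg_eq_add] at this
    exact this
  · have h1 := Real.exp_pos (-y)
    have h2 : Real.exp (-y) ≤ 1 := Real.exp_le_one_iff.2 (by linarith)
    rw [abs_of_nonneg (by linarith)]
    nlinarith

/-- One increment against its Gaussian compensator. The subtracted main part is linear in x and x² -
v, the two quantities whose conditional means vanish when x is a martingale difference with
conditional variance v. -/
lemma norm_cexp_sub_exp_sub_le (θ x : ℝ) {v : ℝ} (hv : 0 ≤ v) :
    ‖Complex.exp ((θ * x : ℝ) * Complex.I) - Complex.exp ((-(θ ^ 2 / 2 * v) : ℝ))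
      - (Complex.I * θ * x - (θ : ℂ) ^ 2 / 2 * (x ^ 2 - v))‖
      ≤ 4 * |θ| ^ 3 * |x| ^ 3 + θ ^ 4 * v ^ 2 := by
  have h1 := norm_cexp_sub_quadratic_le (θ * x)
  have h2 := abs_exp_neg_sub_linear_le (y := θ ^ 2 / 2 * v) (by positivity)
  have h3 : ‖((Real.exp (-(θ ^ 2 / 2 * v)) - 1 + θ ^ 2 / 2 * v : ℝ) : ℂ)‖
      ≤ (θ ^ 2 / 2 * v) ^ 2 := by rwa [Complex.norm_real]
  have h4 := norm_sub_le_of_le h1 h3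
  refine le_trans (le_of_eq ?_) (h4.trans ?_)
  · congr 1
    push_cast
    ring
  · rw [abs_mul, mul_pow]
    nlinarith [mul_nonneg (pow_nonneg (sq_nonneg θ) 2) (sq_nonneg v)]

variable {Ω : Type*} {m : MeasurableSpace Ω} {P : Measure Ω} [IsProbabilityMeasure P]

/-- The compensated characteristic function of a martingale with bounded predictable variance. -/
lemma norm_integral_cexp_sub_one_le (ℱ : Filtration ℕ m) {X v : ℕ → Ω → ℝ} (n : ℕ) (θ : ℝ)
    (hX : ∀ t, Measurable[ℱ (t + 1)] (X t)) (hv : ∀ t, Measurable[ℱ t] (v t))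
    (hv0 : ∀ t ω, 0 ≤ v t ω) (hv2 : ∀ t ω, ∑ s ∈ Finset.range t, v s ω ≤ 2)
    (hXi : ∀ t, Integrable (fun ω => |X t ω| ^ 3) P)
    (h1 : ∀ t (A : Ω → ℂ), Measurable[ℱ t] A → (∃ C, ∀ ω, ‖A ω‖ ≤ C) →
      ∫ ω, A ω * X t ω ∂P = 0)
    (h2 : ∀ t (A : Ω → ℂ), Measurable[ℱ t] A → (∃ C, ∀ ω, ‖A ω‖ ≤ C) →
      ∫ ω, A ω * ((X t ω : ℂ) ^ 2 - v t ω) ∂P = 0) :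
    ‖∫ ω, Complex.exp ((θ * ∑ s ∈ Finset.range n, X s ω : ℝ) * Complex.I
        + (θ ^ 2 / 2 * ∑ s ∈ Finset.range n, v s ω : ℝ)) ∂P - 1‖
      ≤ Real.exp (θ ^ 2) * ∑ t ∈ Finset.range n,
        (4 * |θ| ^ 3 * ∫ ω, |X t ω| ^ 3 ∂P + θ ^ 4 * ∫ ω, v t ω ^ 2 ∂P) := by
  have hXm : ∀ t, Measurable (X t) := fun t => (hX t).mono (ℱ.le _) le_rfl
  have hvm : ∀ t, Measurable (v t) := fun t => (hv t).mono (ℱ.le _) le_rfl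
  have hvb : ∀ t ω, v t ω ≤ 2 := fun t ω => by
    have := hv2 (t + 1) ω
    rw [Finset.sum_range_succ] at this
    linarith [Finset.sum_nonneg fun s (_ : s ∈ Finset.range t) => hv0 s ω]
  have hvi : ∀ t, Integrable (v t) P := fun t =>
    Integrable.of_bound (hvm t).aestronglyMeasurable 2
      (Eventually.of_forall fun ω => by rw [Real.norm_of_nonneg (hv0 t ω)]; exact hvb t ω)
  have hvi2 : ∀ t, Integrable (fun ω => v t ω ^ 2) P := fun t =>
    Integrable.of_bound ((hvm t).pow_const 2).aestronglyMeasurable 4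
      (Eventually.of_forall fun ω => by
        rw [Real.norm_of_nonneg (by positivity)]; nlinarith [hv0 t ω, hvb t ω])
  have hX1 : ∀ t, Integrable (X t) P := fun t => by
    refine ((hXi t).add (integrable_const (1 : ℝ))).mono' (hXm t).aestronglyMeasurable
      (Eventually.of_forall fun ω => ?_)
    simp only [Real.norm_eq_abs, Pi.add_apply]
    rcases le_or_gt |X t ω| 1 with h | h
    · linarith [pow_nonneg (abs_nonneg (X t ω)) 3]
    · nlinarith [mul_nonneg (abs_nonneg (X t ω)) (abs_nonneg (X t ω))]
  have hX2 : ∀ t, Integrable (fun ω => X t ω ^ 2) P := fun t => by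
    refine ((hXi t).add (integrable_const (1 : ℝ))).mono'
      ((hXm t).pow_const 2).aestronglyMeasurable (Eventually.of_forall fun ω => ?_)
    simp only [Real.norm_eq_abs, Pi.add_apply, abs_pow]
    rcases le_or_gt |X t ω| 1 with h | h
    · nlinarith [pow_nonneg (abs_nonneg (X t ω)) 3, abs_nonneg (X t ω)]
    · nlinarith [mul_nonneg (abs_nonneg (X t ω)) (abs_nonneg (X t ω))]
  set E : ℕ → Ω → ℂ := fun n ω =>
    Complex.exp ((θ * ∑ s ∈ Finset.range n, X s ω : ℝ) * Complex.I
        + (θ ^ 2 / 2 * ∑ s ∈ Finset.range n, v s ω : ℝ)) with hE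
  -- The compensator runs one index further than the sum of the increments. As v is predictable, `A
  -- n` is still measurable with respect to the past, and both `E n` and `E (n + 1)` are multiples
  -- of it.
  set A : ℕ → Ω → ℂ := fun n ω =>
    Complex.exp ((θ * ∑ s ∈ Finset.range n, X s ω : ℝ) * Complex.I
        + (θ ^ 2 / 2 * ∑ s ∈ Finset.range (n + 1), v s ω : ℝ)) with hA
  have hnorm : ∀ a b : ℝ, ‖Complex.exp ((a : ℂ) * Complex.I + (b : ℂ))‖ = Real.exp b := by
    intro a b
    rw [Complex.norm_exp]
    simp
  have hEb : ∀ n ω, ‖E n ω‖ ≤ Real.exp (θ ^ 2) := fun n ω => by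
    simp only [hE, hnorm]
    exact Real.exp_le_exp.2 (by nlinarith [hv2 n ω, sq_nonneg θ])
  have hAb : ∀ n ω, ‖A n ω‖ ≤ Real.exp (θ ^ 2) := fun n ω => by
    simp only [hA, hnorm]
    exact Real.exp_le_exp.2 (by nlinarith [hv2 (n + 1) ω, sq_nonneg θ])
  have hEm : ∀ n, Measurable (E n) := fun n => by
    simp only [hE]; fun_prop
  have hAm : ∀ n, Measurable[ℱ n] (A n) := fun n => by
    have a1 : Measurable[ℱ n] (fun ω => ∑ s ∈ Finset.range n, X s ω) :=
      Finset.measurable_sum _ fun s hs =>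
        (hX s).mono (ℱ.mono (by simpa using hs)) le_rfl
    have a2 : Measurable[ℱ n] (fun ω => ∑ s ∈ Finset.range (n + 1), v s ω) :=
      Finset.measurable_sum _ fun s hs =>
        (hv s).mono (ℱ.mono (by simpa [Nat.lt_succ_iff] using hs)) le_rfl
    have a3 : Measurable (fun p : ℝ × ℝ => Complex.exp (((θ * p.1 : ℝ) : ℂ) * Complex.I
        + ((θ ^ 2 / 2 * p.2 : ℝ) : ℂ))) := by fun_prop
    exact a3.comp (a1.prodMk a2)
  have hEi : ∀ n, Integrable (E n) P := fun n =>
    Integrable.of_bound (hEm n).aestronglyMeasurable _ (Eventually.of_forall (hEb n))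
  have hAi : ∀ n {f : Ω → ℂ}, Integrable f P → Integrable (fun ω => A n ω * f ω) P := by
    intro n f hf
    exact hf.bdd_mul ((hAm n).mono (ℱ.le n) le_rfl).aestronglyMeasurable
      (Eventually.of_forall (hAb n))
  have hstep : ∀ n, ‖∫ ω, E (n + 1) ω ∂P - ∫ ω, E n ω ∂P‖ ≤ Real.exp (θ ^ 2) *
      (4 * |θ| ^ 3 * ∫ ω, |X n ω| ^ 3 ∂P + θ ^ 4 * ∫ ω, v n ω ^ 2 ∂P) := by
    intro n
    set L : Ω → ℂ := fun ω => Complex.I * θ * X n ω - (θ : ℂ) ^ 2 / 2 * ((X n ω : ℂ) ^ 2 - v n ω)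
      with hL
    have hLi : Integrable L P := by
      refine ((hX1 n).ofReal.const_mul _).sub (Integrable.const_mul ?_ _)
      have := ((hX2 n).ofReal (𝕜 := ℂ)).sub ((hvi n).ofReal (𝕜 := ℂ))
      exact this.congr (Eventually.of_forall fun ω => by simp)
    -- The first and second conditional moments remove the main part, leaving only the Taylor
    -- remainder in the difference of consecutive expectations.
    have hL0 : ∫ ω, A n ω * L ω ∂P = 0 := by
      have e1 : ∀ ω, A n ω * L ω = (Complex.I * θ) * (A n ω * X n ω)
          - ((θ : ℂ) ^ 2 / 2) * (A n ω * ((X n ω : ℂ) ^ 2 - v n ω)) := fun ω => by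
        simp only [hL]; ring
      simp_rw [e1]
      rw [integral_sub, integral_const_mul, integral_const_mul, h1 n (A n) (hAm n) ⟨_, hAb n⟩,
        h2 n (A n) (hAm n) ⟨_, hAb n⟩]
      · simp
      · exact (hAi n (hX1 n).ofReal).const_mul _
      · refine (hAi n ?_).const_mul _
        have := ((hX2 n).ofReal (𝕜 := ℂ)).sub ((hvi n).ofReal (𝕜 := ℂ))
        exact this.congr (Eventually.of_forall fun ω => by simp)
    have hdiff : ∀ ω, E (n + 1) ω - E n ω - A n ω * L ω = A n ω *
        (Complex.exp ((θ * X n ω : ℝ) * Complex.I)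
          - Complex.exp ((-(θ ^ 2 / 2 * v n ω) : ℝ)) - L ω) := by
      intro ω
      have e1 : E (n + 1) ω = A n ω * Complex.exp ((θ * X n ω : ℝ) * Complex.I) := by
        simp only [hE, hA]
        rw [← Complex.exp_add, Finset.sum_range_succ (fun s => X s ω)]
        congr 1
        push_cast
        ring
      have e2 : E n ω = A n ω * Complex.exp ((-(θ ^ 2 / 2 * v n ω) : ℝ)) := by
        simp only [hE, hA]
        rw [← Complex.exp_add, Finset.sum_range_succ (fun s => v s ω)]
        congr 1
        push_cast
        ring
      rw [e1, e2]
      ring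
    have e3 : ∫ ω, E (n + 1) ω ∂P - ∫ ω, E n ω ∂P
        = ∫ ω, (E (n + 1) ω - E n ω - A n ω * L ω) ∂P := by
      have e4 : Integrable (fun ω => E (n + 1) ω - E n ω) P := (hEi _).sub (hEi _)
      rw [integral_sub e4 (hAi n hLi), hL0, sub_zero,
        integral_sub (hEi _) (hEi _)]
    rw [e3]
    have hbi : Integrable (fun ω => 4 * |θ| ^ 3 * |X n ω| ^ 3 + θ ^ 4 * v n ω ^ 2) P :=
      ((hXi n).const_mul _).add ((hvi2 n).const_mul _)
    refine (norm_integral_le_of_norm_le (hbi.const_mul (Real.exp (θ ^ 2)))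
      (Eventually.of_forall fun ω => ?_)).trans (le_of_eq ?_)
    · rw [hdiff, norm_mul]
      exact mul_le_mul (hAb n ω) (norm_cexp_sub_exp_sub_le θ _ (hv0 n ω)) (norm_nonneg _)
        (Real.exp_pos _).le
    · rw [integral_const_mul, integral_add ((hXi n).const_mul _) ((hvi2 n).const_mul _),
        integral_const_mul, integral_const_mul]
  rw [Finset.mul_sum]
  have hE0 : ∫ ω, E 0 ω ∂P = 1 := by simp [hE]
  change ‖∫ ω, E n ω ∂P - 1‖ ≤ _
  induction n with
  | zero => rw [hE0]; simp
  | succ k ih =>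
    rw [Finset.sum_range_succ]
    have : ∫ ω, E (k + 1) ω ∂P - 1
        = (∫ ω, E k ω ∂P - 1) + (∫ ω, E (k + 1) ω ∂P - ∫ ω, E k ω ∂P) := by ring
    rw [this]
    exact norm_add_le_of_le ih (hstep k)

end CentralLimit


/-! ### Martingale central limit theorem for arrays -/

section CentralLimit

variable {Ω : ℕ → Type*} {mΩ : ∀ T, MeasurableSpace (Ω T)} {P : ∀ T, Measure (Ω T)}
  [∀ T, IsProbabilityMeasure (P T)]

/-- The compensated characteristic function stays close to 1 as long as the accumulated conditional
variance is bounded. The array is stopped before this variance exceeds 2, which with probability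
tending to 1 changes nothing since the total converges to 1. Conditional moments are expressed by
pairing with bounded predictable test functions. -/
lemma tendsto_integral_cexp_sum (ℱ : ∀ T, Filtration ℕ (mΩ T)) {X v : ∀ T, ℕ → Ω T → ℝ} (θ : ℝ)
    (hX : ∀ T t, Measurable[ℱ T (t + 1)] (X T t)) (hv : ∀ T t, Measurable[ℱ T t] (v T t))
    (hv0 : ∀ T t ω, 0 ≤ v T t ω)
    (hXi : ∀ T t, Integrable (fun ω => |X T t ω| ^ 3) (P T))
    (hvi : ∀ T t, Integrable (fun ω => v T t ω ^ 2) (P T))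
    (h1 : ∀ T t (A : Ω T → ℂ), Measurable[ℱ T t] A → (∃ C, ∀ ω, ‖A ω‖ ≤ C) →
      ∫ ω, A ω * X T t ω ∂(P T) = 0)
    (h2 : ∀ T t (A : Ω T → ℂ), Measurable[ℱ T t] A → (∃ C, ∀ ω, ‖A ω‖ ≤ C) →
      ∫ ω, A ω * ((X T t ω : ℂ) ^ 2 - v T t ω) ∂(P T) = 0)
    (hXl : Tendsto (fun T => ∑ t ∈ Finset.range T, ∫ ω, |X T t ω| ^ 3 ∂(P T)) atTop (𝓝 0))
    (hvl : Tendsto (fun T => ∑ t ∈ Finset.range T, ∫ ω, v T t ω ^ 2 ∂(P T)) atTop (𝓝 0))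
    (hV : Tendsto (fun q : Σ T, Ω T => ∑ t ∈ Finset.range q.1, v q.1 t q.2) (inProb P) (𝓝 1)) :
    Tendsto (fun T => ∫ ω, Complex.exp ((θ * ∑ t ∈ Finset.range T, X T t ω : ℝ) * Complex.I) ∂(P T))
      atTop (𝓝 (Real.exp (-(θ ^ 2 / 2)) : ℂ)) := by
  have hXm : ∀ T t, Measurable (X T t) := fun T t => (hX T t).mono ((ℱ T).le _) le_rfl
  have hvm : ∀ T t, Measurable (v T t) := fun T t => (hv T t).mono ((ℱ T).le _) le_rfl
  -- The sum includes the term of index t, which is known at t, so these events are predictable;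
  -- since v is nonnegative they decrease in t. Any bound above 1 would do in place of 2.
  set D : ∀ T, ℕ → Set (Ω T) := fun T t => {ω | ∑ s ∈ Finset.range (t + 1), v T s ω ≤ 2} with hD
  have hDm : ∀ T t, MeasurableSet[ℱ T t] (D T t) := fun T t => by
    have : Measurable[ℱ T t] (fun ω => ∑ s ∈ Finset.range (t + 1), v T s ω) :=
      Finset.measurable_sum _ fun s hs =>
        (hv T s).mono ((ℱ T).mono (by simpa [Nat.lt_succ_iff] using hs)) le_rfl
    exact this measurableSet_Iic
  set X' : ∀ T, ℕ → Ω T → ℝ := fun T t => (D T t).indicator (X T t) with hX'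
  set v' : ∀ T, ℕ → Ω T → ℝ := fun T t => (D T t).indicator (v T t) with hv'
  have hX'm : ∀ T t, Measurable[ℱ T (t + 1)] (X' T t) := fun T t =>
    (hX T t).indicator ((ℱ T).mono (Nat.le_succ t) _ (hDm T t))
  have hv'm : ∀ T t, Measurable[ℱ T t] (v' T t) := fun T t => (hv T t).indicator (hDm T t)
  have hv'0 : ∀ T t ω, 0 ≤ v' T t ω := fun T t ω => Set.indicator_nonneg (fun ω _ => hv0 T t ω) ω
  have hv'le : ∀ T t ω, v' T t ω ≤ v T t ω := fun T t ω =>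
    Set.indicator_le_self' (fun ω _ => hv0 T t ω) ω
  have hX'le : ∀ T t ω, |X' T t ω| ≤ |X T t ω| := fun T t ω => by
    by_cases h : ω ∈ D T t <;> simp [hX', h]
  have hv'2 : ∀ T t ω, ∑ s ∈ Finset.range t, v' T s ω ≤ 2 := fun T t ω => by
    induction t with
    | zero => simp
    | succ t ih =>
      by_cases h : ω ∈ D T t
      · exact (Finset.sum_le_sum fun s _ => hv'le T s ω).trans h
      · rw [Finset.sum_range_succ]
        simpa [hv', h] using ih
  have hX'i : ∀ T t, Integrable (fun ω => |X' T t ω| ^ 3) (P T) := fun T t => by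
    refine (hXi T t).mono'
      (((hX'm T t).mono ((ℱ T).le _) le_rfl).abs.pow_const 3).aestronglyMeasurable
      (Eventually.of_forall fun ω => ?_)
    rw [Real.norm_of_nonneg (by positivity)]
    exact pow_le_pow_left₀ (abs_nonneg _) (hX'le T t ω) 3
  have hA : ∀ T t (A : Ω T → ℂ), Measurable[ℱ T t] A → (∃ C, ∀ ω, ‖A ω‖ ≤ C) →
      Measurable[ℱ T t] ((D T t).indicator A) ∧ ∃ C, ∀ ω, ‖(D T t).indicator A ω‖ ≤ C := by
    rintro T t A hA ⟨C, hC⟩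
    refine ⟨hA.indicator (hDm T t), C, fun ω => ?_⟩
    exact (norm_indicator_le_norm_self _ _).trans (hC ω)
  have h1' : ∀ T t (A : Ω T → ℂ), Measurable[ℱ T t] A → (∃ C, ∀ ω, ‖A ω‖ ≤ C) →
      ∫ ω, A ω * X' T t ω ∂(P T) = 0 := fun T t A hAm hAb => by
    rw [← h1 T t _ (hA T t A hAm hAb).1 (hA T t A hAm hAb).2]
    refine integral_congr_ae (Eventually.of_forall fun ω => ?_)
    by_cases h : ω ∈ D T t <;> simp [hX', h]
  have h2' : ∀ T t (A : Ω T → ℂ), Measurable[ℱ T t] A → (∃ C, ∀ ω, ‖A ω‖ ≤ C) →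
      ∫ ω, A ω * ((X' T t ω : ℂ) ^ 2 - v' T t ω) ∂(P T) = 0 := fun T t A hAm hAb => by
    rw [← h2 T t _ (hA T t A hAm hAb).1 (hA T t A hAm hAb).2]
    refine integral_congr_ae (Eventually.of_forall fun ω => ?_)
    by_cases h : ω ∈ D T t <;> simp [hX', hv', h]
  have hE := fun T => norm_integral_cexp_sub_one_le (P := P T) (ℱ T) T θ (hX'm T) (hv'm T) (hv'0 T)
    (hv'2 T) (hX'i T) (h1' T) (h2' T)
  set S : (Σ T, Ω T) → ℝ := fun q => ∑ t ∈ Finset.range q.1, X q.1 t q.2 with hS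
  set S' : (Σ T, Ω T) → ℝ := fun q => ∑ t ∈ Finset.range q.1, X' q.1 t q.2 with hS'
  set W : (Σ T, Ω T) → ℝ := fun q => ∑ t ∈ Finset.range q.1, v q.1 t q.2 with hW
  set W' : (Σ T, Ω T) → ℝ := fun q => ∑ t ∈ Finset.range q.1, v' q.1 t q.2 with hW'
  have hSm : ∀ T, Measurable fun ω => S ⟨T, ω⟩ := fun T =>
    Finset.measurable_sum (Finset.range T) fun t _ => hXm T t
  have hS'm : ∀ T, Measurable fun ω => S' ⟨T, ω⟩ := fun T =>
    Finset.measurable_sum (Finset.range T) fun t _ => (hX'm T t).mono ((ℱ T).le _) le_rfl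
  have hWm : ∀ T, Measurable fun ω => W ⟨T, ω⟩ := fun T =>
    Finset.measurable_sum (Finset.range T) fun t _ => hvm T t
  have hW'm : ∀ T, Measurable fun ω => W' ⟨T, ω⟩ := fun T =>
    Finset.measurable_sum (Finset.range T) fun t _ => (hv'm T t).mono ((ℱ T).le _) le_rfl
  have hmem : ∀ q, W q ≤ 2 → ∀ t ∈ Finset.range q.1, q.2 ∈ D q.1 t := by
    intro q hq t ht
    refine le_trans (Finset.sum_le_sum_of_subset_of_nonneg ?_ fun s _ _ => hv0 q.1 s q.2) hq
    exact Finset.range_subset_range.2 (Finset.mem_range.1 ht)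
  have hWW : ∀ q, W q ≤ 2 → W' q = W q := fun q hq =>
    Finset.sum_congr rfl fun t ht => Set.indicator_of_mem (hmem q hq t ht) _
  have hSS : ∀ q, W q ≤ 2 → S' q = S q := fun q hq =>
    Finset.sum_congr rfl fun t ht => Set.indicator_of_mem (hmem q hq t ht) _
  have hev : ∀ᶠ q in inProb P, W q ≤ 2 := hV.eventually_le_const (by norm_num)
  have hW'l : Tendsto W' (inProb P) (𝓝 1) :=
    hV.congr' (hev.mono fun q hq => (hWW q hq).symm)
  -- the truncation is asymptotically irrelevant
  have hY1 := tendsto_integral_of_bounded (P := P)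
    (X := fun q => {q | W q ≤ 2}ᶜ.indicator (fun _ => (2 : ℝ)) q) 2
    (fun T => by
      have : MeasurableSet {ω | W ⟨T, ω⟩ ≤ 2}ᶜ := (measurableSet_le (hWm T) measurable_const).compl
      exact (Measurable.indicator (measurable_const (a := (2 : ℝ))) this).aestronglyMeasurable)
    (fun q => by
      by_cases h : W q ≤ 2 <;> simp [Set.indicator, h])
    (tendsto_const_nhds.congr' (hev.mono fun q hq => by simp [Set.indicator, hq]))
  -- The random compensator may be replaced by its limit exp(θ²/2), because the stopped total
  -- variance is bounded and tends to 1 in probability.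
  have hY2 := tendsto_integral_of_bounded (P := P)
    (X := fun q => 1 - Real.exp (θ ^ 2 / 2 * (W' q - 1))) (1 + Real.exp (θ ^ 2 / 2))
    (fun T => by
      have hm : Measurable fun w : ℝ => 1 - Real.exp (θ ^ 2 / 2 * (w - 1)) := by fun_prop
      exact (hm.comp (hW'm T)).aestronglyMeasurable)
    (fun q => by
      have a1 : Real.exp (θ ^ 2 / 2 * (W' q - 1)) ≤ Real.exp (θ ^ 2 / 2) :=
        Real.exp_le_exp.2 (by nlinarith [hv'2 q.1 q.1 q.2, sq_nonneg θ])
      have a2 := Real.exp_pos (θ ^ 2 / 2 * (W' q - 1))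
      rw [abs_le]
      constructor <;> linarith)
    (by
      have : Tendsto (fun q => 1 - Real.exp (θ ^ 2 / 2 * (W' q - 1))) (inProb P)
          (𝓝 (1 - Real.exp (θ ^ 2 / 2 * (1 - 1)))) :=
        ((((hW'l.sub_const 1).const_mul _).rexp).const_sub 1)
      simpa using this)
  set c : ℝ := Real.exp (-(θ ^ 2 / 2)) with hc
  set EE : (Σ T, Ω T) → ℂ := fun q =>
    Complex.exp ((θ * S' q : ℝ) * Complex.I + (θ ^ 2 / 2 * W' q : ℝ)) with hEE
  have hE' : Tendsto (fun T => Real.exp (θ ^ 2) * ∑ t ∈ Finset.range T,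
        (4 * |θ| ^ 3 * ∫ ω, |X T t ω| ^ 3 ∂(P T) + θ ^ 4 * ∫ ω, v T t ω ^ 2 ∂(P T)))
      atTop (𝓝 0) := by
    have := (((hXl.const_mul (4 * |θ| ^ 3)).add (hvl.const_mul (θ ^ 4))).const_mul
      (Real.exp (θ ^ 2)))
    simp only [mul_zero, add_zero] at this
    refine this.congr fun T => ?_
    rw [Finset.sum_add_distrib, ← Finset.mul_sum, ← Finset.mul_sum]
  have hlim := (hY1.add hY2).add (hE'.const_mul c)
  simp only [mul_zero, add_zero] at hlim
  rw [tendsto_iff_norm_sub_tendsto_zero]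
  refine squeeze_zero (fun T => norm_nonneg _) (fun T => ?_) hlim
  have hexp : Measurable fun x : ℝ => Complex.exp ((θ * x : ℝ) * Complex.I) := by fun_prop
  have hi1 : Integrable (fun ω => Complex.exp ((θ * S ⟨T, ω⟩ : ℝ) * Complex.I)) (P T) := by
    refine Integrable.of_bound (hexp.comp (hSm T)).aestronglyMeasurable 1
      (Eventually.of_forall fun ω => (Complex.norm_exp_ofReal_mul_I _).le)
  have hi2 : Integrable (fun ω => Complex.exp ((θ * S' ⟨T, ω⟩ : ℝ) * Complex.I)) (P T) := by
    refine Integrable.of_bound (hexp.comp (hS'm T)).aestronglyMeasurable 1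
      (Eventually.of_forall fun ω => (Complex.norm_exp_ofReal_mul_I _).le)
  have hi3 : Integrable (fun ω => EE ⟨T, ω⟩) (P T) := by
    have hm : Measurable fun p : ℝ × ℝ =>
      Complex.exp ((θ * p.1 : ℝ) * Complex.I + (θ ^ 2 / 2 * p.2 : ℝ)) := by fun_prop
    refine Integrable.of_bound
      (hm.comp ((hS'm T).prodMk (hW'm T))).aestronglyMeasurable (Real.exp (θ ^ 2))
      (Eventually.of_forall fun ω => ?_)
    simp only [hEE, Complex.norm_exp]
    refine Real.exp_le_exp.2 ?_
    have hW2 : W' ⟨T, ω⟩ ≤ 2 := hv'2 T T ω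
    rw [Complex.add_re, Complex.re_ofReal_mul, Complex.I_re, mul_zero, zero_add, Complex.ofReal_re]
    nlinarith [sq_nonneg θ, hW2]
  -- Three errors: stopping, randomness of the compensator, and deviation of the compensated
  -- characteristic function from 1.
  have hsplit : ∫ ω, Complex.exp ((θ * S ⟨T, ω⟩ : ℝ) * Complex.I) ∂(P T) - (c : ℂ)
      = (∫ ω, (Complex.exp ((θ * S ⟨T, ω⟩ : ℝ) * Complex.I)
          - Complex.exp ((θ * S' ⟨T, ω⟩ : ℝ) * Complex.I)) ∂(P T)
        + ∫ ω, (Complex.exp ((θ * S' ⟨T, ω⟩ : ℝ) * Complex.I) - c * EE ⟨T, ω⟩) ∂(P T))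
        + c * (∫ ω, EE ⟨T, ω⟩ ∂(P T) - 1) := by
    rw [integral_sub hi1 hi2, integral_sub hi2 (hi3.const_mul _), integral_const_mul]
    ring
  change ‖∫ ω, Complex.exp ((θ * S ⟨T, ω⟩ : ℝ) * Complex.I) ∂(P T) - (c : ℂ)‖ ≤ _
  rw [hsplit]
  refine norm_add_le_of_le (norm_add_le_of_le ?_ ?_) ?_
  · refine (norm_integral_le_integral_norm _).trans (integral_mono (hi1.sub hi2).norm ?_ fun ω => ?_)
    · have : MeasurableSet {ω | W ⟨T, ω⟩ ≤ 2}ᶜ :=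
        (measurableSet_le (hWm T) measurable_const).compl
      exact ((integrable_const (2 : ℝ)).indicator this).abs
    · by_cases h : W ⟨T, ω⟩ ≤ 2
      · simp [Set.indicator, h, hSS ⟨T, ω⟩ h]
      · have := norm_sub_le (Complex.exp ((θ * S ⟨T, ω⟩ : ℝ) * Complex.I))
          (Complex.exp ((θ * S' ⟨T, ω⟩ : ℝ) * Complex.I))
        rw [Complex.norm_exp_ofReal_mul_I, Complex.norm_exp_ofReal_mul_I] at this
        simp only [Set.indicator, Set.mem_compl_iff, Set.mem_ofPred_eq, h, not_false_eq_true, if_true]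
        norm_num at this ⊢
        exact this
  · refine (norm_integral_le_integral_norm _).trans (le_of_eq (integral_congr_ae
      (Eventually.of_forall fun ω => ?_)))
    have : Complex.exp ((θ * S' ⟨T, ω⟩ : ℝ) * Complex.I) - c * EE ⟨T, ω⟩
        = Complex.exp ((θ * S' ⟨T, ω⟩ : ℝ) * Complex.I)
          * ((1 - Real.exp (θ ^ 2 / 2 * (W' ⟨T, ω⟩ - 1)) : ℝ) : ℂ) := by
      simp only [hEE, hc, Complex.ofReal_sub, Complex.ofReal_one, Complex.ofReal_exp]
      rw [mul_sub, mul_one, ← Complex.exp_add, ← Complex.exp_add]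
      congr 2
      push_cast
      ring
    simp only [this, norm_mul, Complex.norm_exp_ofReal_mul_I, one_mul, Complex.norm_real,
      Real.norm_eq_abs]
  · rw [norm_mul, Complex.norm_real, Real.norm_of_nonneg (Real.exp_pos _).le]
    refine mul_le_mul_of_nonneg_left ((hE T).trans ?_) (Real.exp_pos _).le
    refine mul_le_mul_of_nonneg_left (Finset.sum_le_sum fun t _ => ?_) (Real.exp_pos _).le
    refine add_le_add (mul_le_mul_of_nonneg_left ?_ (by positivity))
      (mul_le_mul_of_nonneg_left ?_ (by positivity))
    · exact integral_mono (hX'i T t) (hXi T t) fun ω =>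
        pow_le_pow_left₀ (abs_nonneg _) (hX'le T t ω) 3
    · refine integral_mono_of_nonneg (Eventually.of_forall fun ω => sq_nonneg _) (hvi T t)
        (Eventually.of_forall fun ω => pow_le_pow_left₀ (hv'0 T t ω) (hv'le T t ω) 2)

/-- Weak convergence to the standard normal law, in terms of symmetric intervals. -/
lemma tendsto_measure_abs_le_of_charFun {S : ∀ T, Ω T → ℝ} (hS : ∀ T, AEMeasurable (S T) (P T))
    (h : ∀ θ : ℝ, Tendsto (fun T => ∫ ω, Complex.exp ((θ * S T ω : ℝ) * Complex.I) ∂(P T)) atTop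
      (𝓝 (Real.exp (-(θ ^ 2 / 2)) : ℂ))) (c : ℝ) :
    Tendsto (fun T => (P T).real {ω | |S T ω| ≤ c}) atTop
      (𝓝 ((gaussianReal 0 1).real (Set.Icc (-c) c))) := by
  have hprob : ∀ T, IsProbabilityMeasure ((P T).map (S T)) := fun T =>
    Measure.isProbabilityMeasure_map (hS T)
  let ν : ProbabilityMeasure ℝ := ⟨gaussianReal 0 1, inferInstance⟩
  let μS : ℕ → ProbabilityMeasure ℝ := fun T => ⟨(P T).map (S T), hprob T⟩
  have hw : Tendsto μS atTop (𝓝 ν) := by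
    refine ProbabilityMeasure.tendsto_of_tendsto_charFun fun θ => ?_
    have e : charFun (ν : Measure ℝ) θ = (Real.exp (-(θ ^ 2 / 2)) : ℂ) := by
      change charFun (gaussianReal 0 1) θ = _
      rw [charFun_gaussianReal, Complex.ofReal_exp]
      congr 1
      push_cast
      simp
    rw [e]
    refine (h θ).congr fun T => ?_
    change _ = charFun ((P T).map (S T)) θ
    rw [charFun_apply_real, integral_map (hS T)
      (Measurable.aestronglyMeasurable (by fun_prop))]
    simp
  have hν : NullSingletonClass (ν : Measure ℝ) :=
    nullSingletonClass_gaussianReal (μ := 0) (v := 1) one_ne_zero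
  have hb := ProbabilityMeasure.tendsto_measure_of_null_frontier_of_tendsto' hw
    (E := Set.Icc (-c) c) (by
      refine measure_mono_null ?_ (Set.Finite.measure_zero (Set.toFinite ({-c, c} : Set ℝ)) _)
      rw [isClosed_Icc.frontier_eq, interior_Icc]
      rintro x ⟨⟨h1, h2⟩, h3⟩
      rcases h1.eq_or_lt with h1 | h1
      · exact Or.inl h1.symm
      · rcases h2.eq_or_lt with h2 | h2
        · exact Or.inr h2
        · exact absurd ⟨h1, h2⟩ h3)
  have hfin : (ν : Measure ℝ) (Set.Icc (-c) c) ≠ ⊤ := measure_ne_top _ _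
  have hb' := (ENNReal.tendsto_toReal hfin).comp hb
  refine hb'.congr fun T => ?_
  change ((P T).map (S T) (Set.Icc (-c) c)).toReal = ((P T) {ω | |S T ω| ≤ c}).toReal
  rw [Measure.map_apply_of_aemeasurable (hS T) measurableSet_Icc]
  congr 2
  ext ω
  simp [abs_le]

end CentralLimit


/-! ### Quantiles of the standard normal law -/

section Quantile

lemma continuous_cdf_gaussianReal : Continuous (cdf (gaussianReal 0 1)) := by
  have hna : NullSingletonClass (gaussianReal 0 1) := nullSingletonClass_gaussianReal one_ne_zero
  rw [continuous_iff_continuousAt]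
  intro x
  rw [(monotone_cdf _).continuousAt_iff_leftLim_eq_rightLim]
  have h1 : (cdf (gaussianReal 0 1)).measure {x} = 0 := by rw [measure_cdf]; exact measure_singleton x
  rw [StieltjesFunction.measure_singleton, ENNReal.ofReal_eq_zero] at h1
  rw [StieltjesFunction.rightLim_eq]
  refine le_antisymm ((monotone_cdf _).leftLim_le le_rfl) (by linarith)

lemma cdf_gaussianReal_neg (x : ℝ) :
    cdf (gaussianReal 0 1) (-x) = 1 - cdf (gaussianReal 0 1) x := by
  have hna : NullSingletonClass (gaussianReal 0 1) := nullSingletonClass_gaussianReal one_ne_zero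
  rw [cdf_eq_real, cdf_eq_real, ← probReal_compl_eq_one_sub measurableSet_Iic, Set.compl_Iic]
  have h : (gaussianReal 0 1).map (fun y => -y) = gaussianReal 0 1 := by
    simpa using gaussianReal_map_neg (μ := 0) (v := 1)
  have h2 : (gaussianReal 0 1) (Set.Iic (-x)) = (gaussianReal 0 1) (Set.Ici x) := by
    conv_lhs => rw [← h]
    rw [Measure.map_apply measurable_neg measurableSet_Iic]
    congr 1
    ext y
    simp
  rw [Measure.real, Measure.real, h2, measure_congr Ioi_ae_eq_Ici]

lemma gaussianReal_real_Icc {c : ℝ} (hc : 0 ≤ c) : (gaussianReal 0 1).real (Set.Icc (-c) c)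
    = 2 * cdf (gaussianReal 0 1) c - 1 := by
  have hna : NullSingletonClass (gaussianReal 0 1) := nullSingletonClass_gaussianReal one_ne_zero
  have h1 : (gaussianReal 0 1) (Set.Icc (-c) c) = (gaussianReal 0 1) (Set.Ioc (-c) c) :=
    measure_congr Ioc_ae_eq_Icc.symm
  have h2 : (gaussianReal 0 1) (Set.Ioc (-c) c)
      = ENNReal.ofReal (cdf (gaussianReal 0 1) c - cdf (gaussianReal 0 1) (-c)) := by
    rw [← StieltjesFunction.measure_Ioc, measure_cdf]
  rw [Measure.real, h1, h2, ENNReal.toReal_ofReal, cdf_gaussianReal_neg]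
  · ring
  · exact sub_nonneg.2 (monotone_cdf _ (by linarith))

/-- The superlevel set of the continuous distribution function is closed, so its infimum is
attained. To the left of the infimum the distribution function is below p, and continuity gives
equality. -/
lemma cdf_normalQuantile {p : ℝ} (h0 : 0 < p) (h1 : p < 1) :
    cdf (gaussianReal 0 1) (normalQuantile p) = p := by
  set F := cdf (gaussianReal 0 1) with hF
  obtain ⟨a, ha⟩ := ((tendsto_cdf_atBot (gaussianReal 0 1)).eventually_lt_const h0).exists
  obtain ⟨b, hb⟩ := ((tendsto_cdf_atTop (gaussianReal 0 1)).eventually_const_lt h1).exists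
  have hbdd : BddBelow {y : ℝ | p ≤ F y} := by
    refine ⟨a, fun y hy => ?_⟩
    by_contra hlt
    exact absurd (hy.trans (monotone_cdf _ (not_le.1 hlt).le)) (not_le.2 ha)
  have hcl : IsClosed {y : ℝ | p ≤ F y} := isClosed_le continuous_const continuous_cdf_gaussianReal
  have hmem : p ≤ F (normalQuantile p) := hcl.csInf_mem ⟨b, hb.le⟩ hbdd
  refine le_antisymm ?_ hmem
  have hlim : Tendsto F (𝓝[<] (normalQuantile p)) (𝓝 (F (normalQuantile p))) :=
    (continuous_cdf_gaussianReal.tendsto _).mono_left nhdsWithin_le_nhds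
  refine le_of_tendsto hlim ?_
  filter_upwards [self_mem_nhdsWithin] with y hy
  by_contra hlt
  exact absurd (csInf_le hbdd (not_le.1 hlt).le) (not_le.2 hy)

/-- The sign is needed because the confidence set is defined by comparing squares. -/
lemma normalQuantile_pos {p : ℝ} (h0 : 1 / 2 < p) (h1 : p < 1) : 0 < normalQuantile p := by
  by_contra h
  have h2 := monotone_cdf (gaussianReal 0 1) (not_lt.1 h)
  rw [cdf_normalQuantile (by linarith) h1] at h2
  have h3 := cdf_gaussianReal_neg 0
  rw [neg_zero] at h3
  linarith

end Quantile

/-! ### Slutsky's lemma -/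

section Slutsky

variable {Ω : ℕ → Type*} {mΩ : ∀ T, MeasurableSpace (Ω T)} {P : ∀ T, Measure (Ω T)}
  [∀ T, IsProbabilityMeasure (P T)]

/-- Slutsky's lemma for distribution functions. -/
lemma tendsto_measureReal_of_add {S R : (Σ T, Ω T) → ℝ} {A : Set (Σ T, Ω T)} {F : ℝ → ℝ} {z : ℝ}
    (hF : ContinuousAt F z)
    (h : ∀ c, Tendsto (fun T => (P T).real {ω | S ⟨T, ω⟩ ≤ c}) atTop (𝓝 (F c)))
    (hR : Tendsto R (inProb P) (𝓝 0)) (hA : ∀ᶠ q in inProb P, q ∈ A ↔ S q + R q ≤ z) :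
    Tendsto (fun T => (P T).real {ω | (⟨T, ω⟩ : Σ T, Ω T) ∈ A}) atTop (𝓝 (F z)) := by
  rw [Metric.tendsto_nhds]
  intro ε hε
  obtain ⟨η, hη, hη'⟩ := Metric.continuousAt_iff.1 hF (ε / 3) (by positivity)
  -- On this good event, A lies between the sublevel sets of S at z - η/2 and z + η/2. Only
  -- monotonicity and subadditivity of the measure are used, so A may be any set.
  set B : (Σ T, Ω T) → Prop := fun q => (q ∈ A ↔ S q + R q ≤ z) ∧ |R q| < η / 2 with hB
  have hBe : ∀ᶠ q in inProb P, B q := by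
    refine hA.and ?_
    have := (Metric.tendsto_nhds.1 hR) (η / 2) (by positivity)
    simpa using this
  rw [eventually_inProb] at hBe
  have hBr : Tendsto (fun T => (P T).real {ω | ¬ B ⟨T, ω⟩}) atTop (𝓝 0) := by
    have := (ENNReal.tendsto_toReal ENNReal.zero_ne_top).comp hBe
    simpa [Measure.real, Function.comp_def] using this
  have hd : ∀ s : ℝ, |s| < η → |F (z + s) - F z| < ε / 3 := fun s hs => by
    have := hη' (x := z + s) (by simpa using hs)
    simpa [Real.dist_eq] using this
  have h1 := hd (η / 2) (by rw [abs_of_pos (by positivity)]; linarith)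
  have h2 := hd (-(η / 2)) (by rw [abs_neg, abs_of_pos (by positivity)]; linarith)
  filter_upwards [hBr.eventually_lt_const (show (0 : ℝ) < ε / 3 by positivity),
    (Metric.tendsto_nhds.1 (h (z + η / 2))) (ε / 3) (by positivity),
    (Metric.tendsto_nhds.1 (h (z + -(η / 2)))) (ε / 3) (by positivity)] with T hT1 hT2 hT3
  rw [Real.dist_eq] at hT2 hT3 ⊢
  have hu : (P T).real {ω | (⟨T, ω⟩ : Σ T, Ω T) ∈ A}
      ≤ (P T).real {ω | S ⟨T, ω⟩ ≤ z + η / 2} + (P T).real {ω | ¬ B ⟨T, ω⟩} := by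
    refine (measureReal_mono ?_).trans (measureReal_union_le _ _)
    intro ω hω
    by_cases hb : B ⟨T, ω⟩
    · left
      have h3 := hb.1.1 hω
      have h4 := abs_lt.1 hb.2
      change S ⟨T, ω⟩ ≤ z + η / 2
      linarith
    · exact Or.inr hb
  have hl : (P T).real {ω | S ⟨T, ω⟩ ≤ z + -(η / 2)}
      ≤ (P T).real {ω | (⟨T, ω⟩ : Σ T, Ω T) ∈ A} + (P T).real {ω | ¬ B ⟨T, ω⟩} := by
    refine (measureReal_mono ?_).trans (measureReal_union_le _ _)
    intro ω hω
    by_cases hb : B ⟨T, ω⟩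
    · left
      have h4 := abs_lt.1 hb.2
      have h5 : S ⟨T, ω⟩ ≤ z + -(η / 2) := hω
      exact hb.1.2 (by linarith)
    · exact Or.inr hb
  rw [abs_lt] at *
  constructor <;> linarith [h1.1, h1.2, h2.1, h2.2]

end Slutsky


/-! ### Geometric decay of powers of a stable matrix -/

section SpectralRadius

attribute [local instance] Matrix.linftyOpNormedRing Matrix.linftyOpNormedAlgebra

/-- Powers of a matrix whose complex eigenvalues lie in the open unit disc decay geometrically. -/
lemma exists_abs_pow_apply_le {n : Type*} [Fintype n] [DecidableEq n] [Nonempty n]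
    {Φ : Matrix n n ℝ}
    (hΦ : ∀ z ∈ spectrum ℂ (Φ.map (algebraMap ℝ ℂ)), ‖z‖ < 1) :
    ∃ K ρ : ℝ, 0 < K ∧ 0 < ρ ∧ ρ < 1 ∧ ∀ (k : ℕ) a b, |(Φ ^ k) a b| ≤ K * ρ ^ k := by
  set M : Matrix n n ℂ := Φ.map (algebraMap ℝ ℂ) with hM
  have hsr : spectralRadius ℂ M < (1 : NNReal) :=
    spectrum.spectralRadius_lt_of_forall_lt M fun z hz => by
      have := hΦ z hz
      rw [← NNReal.coe_lt_coe]
      simpa using this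
  -- With r strictly between the spectral radius and 1, Gelfand's formula bounds the k-th power by
  -- r^k for all large k; a constant absorbs the finitely many remaining powers.
  obtain ⟨r, hr1, hr2⟩ := ENNReal.lt_iff_exists_nnreal_btwn.1 hsr
  have hr0 : 0 < r := by
    rw [← ENNReal.coe_pos]
    exact lt_of_le_of_lt zero_le hr1
  have hr1' : (r : ℝ) < 1 := by exact_mod_cast hr2
  have hev := (spectrum.pow_nnnorm_pow_one_div_tendsto_nhds_spectralRadius M).eventually_le_const hr1
  have hO : (fun k : ℕ => M ^ k) =O[atTop] (fun k : ℕ => (r : ℝ) ^ k) := by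
    refine Asymptotics.IsBigO.of_bound 1 ?_
    filter_upwards [hev, eventually_gt_atTop 0] with k hk hk0
    have h1 : ((‖M ^ k‖₊ : ENNReal)) ≤ (r : ENNReal) ^ k := by
      have h2 := ENNReal.rpow_le_rpow hk (z := (k : ℝ)) (by positivity)
      rw [← ENNReal.rpow_mul, one_div, inv_mul_cancel₀ (by positivity), ENNReal.rpow_one,
        ENNReal.rpow_natCast] at h2
      exact h2
    have h3 : ‖M ^ k‖₊ ≤ r ^ k := by exact_mod_cast h1
    have h4 : ‖M ^ k‖ ≤ (r : ℝ) ^ k := by exact_mod_cast h3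
    rw [one_mul, Real.norm_of_nonneg (by positivity)]
    exact h4
  obtain ⟨C, hC, hb⟩ := Asymptotics.bound_of_isBigO_nat_atTop hO
  refine ⟨C, r, hC, by exact_mod_cast hr0, hr1', fun k a b => ?_⟩
  have h1 := hb (x := k) (by positivity)
  rw [Real.norm_of_nonneg (by positivity)] at h1
  refine le_trans ?_ h1
  have h2 : M ^ k = (Φ ^ k).map (algebraMap ℝ ℂ) := by
    rw [hM, ← Matrix.map_pow]
  have h3 : |(Φ ^ k) a b| = ‖(M ^ k) a b‖ := by
    rw [h2, Matrix.map_apply]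
    simp
  rw [h3]
  have h4 : ‖(M ^ k) a b‖₊ ≤ ‖M ^ k‖₊ := by
    rw [Matrix.linfty_opNNNorm_def]
    refine le_trans ?_ (Finset.le_sup (f := fun i => ∑ j, ‖(M ^ k) i j‖₊) (Finset.mem_univ a))
    exact Finset.single_le_sum (f := fun j => ‖(M ^ k) a j‖₊) (fun j _ => zero_le)
      (Finset.mem_univ b)
  exact h4

end SpectralRadius

/-! ### Uniform bounds on moments of all orders -/

section Moments

variable {Ω : ℕ → Type*} {mΩ : ∀ T, MeasurableSpace (Ω T)} {P : ∀ T, Measure (Ω T)}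
  {ι : Type*}

/-- Families of random variables all of whose moments are bounded uniformly. -/
structure AllMoments (P : ∀ T, Measure (Ω T)) (X : ∀ T, ι → Ω T → ℝ) : Prop where
  aesm : ∀ T t, AEStronglyMeasurable (X T t) (P T)
  bdd : ∀ p : ℕ, ∃ C : NNReal, ∀ T t, eLpNorm (X T t) p (P T) ≤ C

namespace AllMoments

lemma memLp {X : ∀ T, ι → Ω T → ℝ} (h : AllMoments P X) (p : ℕ) (T : ℕ) (t : ι) :
    MemLp (X T t) p (P T) := by
  obtain ⟨C, hC⟩ := h.bdd p
  exact ⟨h.aesm T t, (hC T t).trans_lt ENNReal.coe_lt_top⟩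

/-- Hölder's inequality from twice the exponent. Bounding all moments at once makes the class closed
under products, and no exponents have to be tracked later. -/
lemma mul {X Y : ∀ T, ι → Ω T → ℝ} (hX : AllMoments P X) (hY : AllMoments P Y) :
    AllMoments P (fun T t ω => X T t ω * Y T t ω) := by
  refine ⟨fun T t => (hX.aesm T t).mul (hY.aesm T t), fun p => ?_⟩
  obtain ⟨C, hC⟩ := hX.bdd (2 * p)
  obtain ⟨D, hD⟩ := hY.bdd (2 * p)
  refine ⟨C * D, fun T t => ?_⟩
  have hh : ENNReal.HolderTriple ((2 * p : ℕ) : ENNReal) ((2 * p : ℕ) : ENNReal) (p : ENNReal) := by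
    constructor
    push_cast
    rw [ENNReal.mul_inv (by simp) (by simp), ← add_mul, ENNReal.inv_two_add_inv_two, one_mul]
  rw [ENNReal.coe_mul]
  exact (eLpNorm_smul_le_mul_eLpNorm (hY.aesm T t) (hX.aesm T t)).trans
    (mul_le_mul' (hC T t) (hD T t))

lemma const_of_bdd [∀ T, IsProbabilityMeasure (P T)] {c : ℕ → ι → ℝ} (C : ℝ)
    (h : ∀ T t, |c T t| ≤ C) : AllMoments P (fun T t _ => c T t) := by
  refine ⟨fun T t => aestronglyMeasurable_const, fun p => ⟨Real.toNNReal C, fun T t => ?_⟩⟩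
  refine (eLpNorm_le_of_ae_bound (C := C) (Eventually.of_forall fun ω => by simpa using h T t)).trans ?_
  simp [ENNReal.ofReal]

lemma add [∀ T, IsProbabilityMeasure (P T)] {X Y : ∀ T, ι → Ω T → ℝ} (hX : AllMoments P X)
    (hY : AllMoments P Y) : AllMoments P (fun T t ω => X T t ω + Y T t ω) := by
  refine ⟨fun T t => (hX.aesm T t).add (hY.aesm T t), fun p => ?_⟩
  -- The triangle inequality needs an exponent of at least 1, while p may be 0.
  obtain ⟨C, hC⟩ := hX.bdd (p + 1)
  obtain ⟨D, hD⟩ := hY.bdd (p + 1)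
  refine ⟨C + D, fun T t => ?_⟩
  refine (eLpNorm_le_eLpNorm_of_exponent_le (p := p) (q := (p + 1 : ℕ)) (by exact_mod_cast Nat.le_succ p)
    ((hX.aesm T t).add (hY.aesm T t))).trans ?_
  refine (eLpNorm_add_le (hX.aesm T t) (hY.aesm T t) (by simp)).trans ?_
  rw [ENNReal.coe_add]
  exact add_le_add (hC T t) (hD T t)

lemma const [∀ T, IsProbabilityMeasure (P T)] (c : ℝ) :
    AllMoments P (fun T (_ : ι) (_ : Ω T) => c) :=
  const_of_bdd |c| fun _ _ => le_rfl

lemma const_mul [∀ T, IsProbabilityMeasure (P T)] {X : ∀ T, ι → Ω T → ℝ} (hX : AllMoments P X)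
    (c : ℝ) : AllMoments P (fun T t ω => c * X T t ω) := (const c).mul hX

lemma sum [∀ T, IsProbabilityMeasure (P T)] {κ : Type*} (s : Finset κ) {X : κ → ∀ T, ι → Ω T → ℝ}
    (h : ∀ i ∈ s, AllMoments P (X i)) : AllMoments P (fun T t ω => ∑ i ∈ s, X i T t ω) := by
  classical
  induction s using Finset.induction_on with
  | empty => simpa using const (P := P) (ι := ι) 0
  | insert i s hi ih =>
    simp only [Finset.sum_insert hi]
    exact (h i (by simp)).add (ih fun j hj => h j (by simp [hj]))

lemma pow [∀ T, IsProbabilityMeasure (P T)] {X : ∀ T, ι → Ω T → ℝ} (hX : AllMoments P X) (n : ℕ) :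
    AllMoments P (fun T t ω => X T t ω ^ n) := by
  induction n with
  | zero => simpa using const (P := P) (ι := ι) 1
  | succ n ih => simpa [pow_succ] using ih.mul hX

lemma abs {X : ∀ T, ι → Ω T → ℝ} (hX : AllMoments P X) :
    AllMoments P (fun T t ω => |X T t ω|) := by
  refine ⟨fun T t => (hX.aesm T t).norm, fun p => ?_⟩
  obtain ⟨C, hC⟩ := hX.bdd p
  refine ⟨C, fun T t => ?_⟩
  have := eLpNorm_norm (p := p) (μ := P T) (X T t)
  simp only [Real.norm_eq_abs] at this
  rw [this]
  exact hC T t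

lemma integrable {X : ∀ T, ι → Ω T → ℝ} (hX : AllMoments P X) (T : ℕ) (t : ι) :
    Integrable (X T t) (P T) := memLp_one_iff_integrable.1 (by simpa using hX.memLp 1 T t)

lemma exists_integral_abs_le {X : ∀ T, ι → Ω T → ℝ} (hX : AllMoments P X) :
    ∃ C : ℝ, 0 ≤ C ∧ ∀ T t, ∫ ω, |X T t ω| ∂(P T) ≤ C := by
  obtain ⟨C, hC⟩ := hX.bdd 1
  refine ⟨C, C.2, fun T t => ?_⟩
  have h1 := hC T t
  rw [Nat.cast_one, eLpNorm_one_eq_lintegral_enorm] at h1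
  have h2 := integral_norm_eq_lintegral_enorm (hX.aesm T t)
  simp only [Real.norm_eq_abs] at h2
  rw [h2]
  exact ENNReal.toReal_le_of_le_ofReal C.2 (by simpa using h1)

lemma exists_integral_le {X : ∀ T, ι → Ω T → ℝ} (hX : AllMoments P X) :
    ∃ C : ℝ, 0 ≤ C ∧ ∀ T t, |∫ ω, X T t ω ∂(P T)| ≤ C := by
  obtain ⟨C, hC0, hC⟩ := hX.exists_integral_abs_le
  exact ⟨C, hC0, fun T t => abs_integral_le_integral_abs.trans (hC T t)⟩

/-- Averages of variables with bounded moments are bounded in probability. -/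
lemma op_average [∀ T, IsProbabilityMeasure (P T)] {X : ∀ T, ℕ → Ω T → ℝ} (hX : AllMoments P X) :
    OP P (fun q => (q.1 : ℝ)⁻¹ * ∑ t ∈ Finset.range q.1, X q.1 t q.2) := by
  obtain ⟨C, hC0, hC⟩ := hX.exists_integral_abs_le
  refine OP.of_integral C (fun T => ?_) (Eventually.of_forall fun T => ?_)
  · exact (integrable_finsetSum (Finset.range T) fun t _ => hX.integrable T t).const_mul (T : ℝ)⁻¹
  · have hi : Integrable (fun ω => (T : ℝ)⁻¹ * ∑ t ∈ Finset.range T, |X T t ω|) (P T) :=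
      (integrable_finsetSum _ fun t _ => (hX.integrable T t).abs).const_mul _
    refine (integral_mono_of_nonneg (Eventually.of_forall fun ω => abs_nonneg _) hi
      (Eventually.of_forall fun ω => ?_)).trans ?_
    · simp only [abs_mul, abs_inv, Nat.abs_cast]
      exact mul_le_mul_of_nonneg_left (Finset.abs_sum_le_sum_abs _ _) (by positivity)
    · rw [integral_const_mul, integral_finsetSum _ fun t _ => (hX.integrable T t).abs]
      rcases Nat.eq_zero_or_pos T with rfl | hT
      · simpa using hC0
      · rw [inv_mul_le_iff₀ (by positivity)]
        calc _ ≤ ∑ t ∈ Finset.range T, C := Finset.sum_le_sum fun t _ => hC T t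
          _ = T * C := by simp

end AllMoments

end Moments


/-! ### The filtration of past shocks -/

section Past

variable {Ω E : Type*} {m : MeasurableSpace Ω} [mE : MeasurableSpace E]

/-- The filtration generated by the shocks strictly before a given date. -/
def past (e : ℕ → Ω → E) (he : ∀ t, Measurable (e t)) : Filtration ℕ m where
  seq t := ⨆ s ∈ Set.Iio t, mE.comap (e s)
  mono' := fun _ _ hst => biSup_mono fun _ hr => lt_of_lt_of_le hr hst
  le' := fun _ => iSup₂_le fun s _ => (he s).comap_le

lemma measurable_past {e : ℕ → Ω → E} (he : ∀ t, Measurable (e t)) {s t : ℕ} (hst : s < t) :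
    Measurable[past e he t] (e s) := by
  rw [measurable_iff_comap_le]
  exact le_iSup₂_of_le (f := fun s (_ : s ∈ Set.Iio t) => mE.comap (e s)) s hst le_rfl

variable {P : Measure Ω}

/-- The past at t involves only indices below t, which are disjoint from {t}. -/
lemma indepFun_past {e : ℕ → Ω → E} (he : ∀ t, Measurable (e t)) (hind : iIndepFun e P)
    {F F' : Type*} [MeasurableSpace F] [MeasurableSpace F'] {t : ℕ} {A : Ω → F} {g : E → F'}
    (hA : Measurable[past e he t] A) (hg : Measurable g) :
    IndepFun A (fun ω => g (e t ω)) P := by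
  rw [IndepFun_iff_Indep]
  have h := indep_iSup_of_disjoint (m := fun s => mE.comap (e s)) (fun s => (he s).comap_le)
    ((iIndepFun_iff_iIndep _ _ _).1 hind) (S := Set.Iio t) (T := {t}) (by simp)
  refine indep_of_indep_of_le_left (indep_of_indep_of_le_right h ?_) hA.comap_le
  rw [iSup_singleton, ← measurable_iff_comap_le]
  exact hg.comp (comap_measurable (e t))

/-- This factorisation plays the role of conditioning on the past. For independent factors it holds
without integrability assumptions. -/
lemma integral_past_mul {e : ℕ → Ω → E} (he : ∀ t, Measurable (e t)) (hind : iIndepFun e P)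
    {𝕜 : Type*} [RCLike 𝕜] {t : ℕ} {A : Ω → 𝕜} {g : E → 𝕜}
    (hA : Measurable[past e he t] A) (hg : Measurable g) :
    ∫ ω, A ω * g (e t ω) ∂P = (∫ ω, A ω ∂P) * ∫ ω, g (e t ω) ∂P :=
  (indepFun_past he hind hA hg).integral_fun_mul_eq_mul_integral
    (hA.mono ((past e he).le t) le_rfl).aestronglyMeasurable
    (hg.comp (he t)).aestronglyMeasurable

end Past

/-! ### Weak laws from orthogonality of martingale differences -/

section LawOfLargeNumbers

variable {Ω : ℕ → Type*} {mΩ : ∀ T, MeasurableSpace (Ω T)} {P : ∀ T, Measure (Ω T)}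

lemma OP.of_sq {X : (Σ T, Ω T) → ℝ} (h : OP P fun q => X q ^ 2) : OP P X := by
  refine ((OP.const 1).add h).mono fun q => ?_
  rw [abs_of_nonneg (show (0 : ℝ) ≤ 1 + X q ^ 2 by positivity)]
  nlinarith [sq_nonneg (|X q| - 1), sq_abs (X q)]

lemma tendsto_inv_sqrt_inProb :
    Tendsto (fun q : Σ T, Ω T => (Real.sqrt q.1)⁻¹) (inProb P) (𝓝 0) :=
  (tendsto_inv_atTop_zero.comp (Real.tendsto_sqrt_atTop.comp tendsto_natCast_atTop_atTop)).comp
    tendsto_fst_inProb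

variable [∀ T, IsProbabilityMeasure (P T)] {E : Type*} [MeasurableSpace E]

/-- Normalised sums of products of a predictable factor and a centred function of the
contemporaneous shock. -/
lemma op_sum_past_mul {e : ∀ T, ℕ → Ω T → E} (he : ∀ T t, Measurable (e T t))
    (hind : ∀ T, iIndepFun (e T) (P T)) {c : ∀ T, ℕ → Ω T → ℝ} {g : ℕ → E → ℝ}
    (hc : ∀ T t, Measurable[past (e T) (he T) t] (c T t)) (hcm : AllMoments P c)
    (hg : ∀ T, Measurable (g T)) (hgm : AllMoments P fun T t ω => g T (e T t ω))
    (hg0 : ∀ T t, ∫ ω, g T (e T t ω) ∂(P T) = 0) :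
    OP P fun q => (Real.sqrt q.1)⁻¹ * ∑ t ∈ Finset.range q.1, c q.1 t q.2 * g q.1 (e q.1 t q.2) := by
  have hX := hcm.mul hgm
  obtain ⟨C, hC0, hC⟩ := (hX.pow 2).exists_integral_abs_le
  have hS : ∀ T n, MemLp (fun ω => ∑ t ∈ Finset.range n, c T t ω * g T (e T t ω)) 2 (P T) :=
    fun T n => memLp_finsetSum _ fun t _ => by simpa using hX.memLp 2 T t
  have hSm : ∀ T n, Measurable[past (e T) (he T) n]
      (fun ω => ∑ t ∈ Finset.range n, c T t ω * g T (e T t ω)) := fun T n =>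
    Finset.measurable_sum _ fun t ht => by
      have ht := Finset.mem_range.1 ht
      exact ((hc T t).mono ((past (e T) (he T)).mono ht.le) le_rfl).mul
        ((hg T).comp (measurable_past (he T) ht))
  -- Each new term is orthogonal to the partial sum before it, so the second moment grows at most
  -- linearly.
  have key : ∀ T n, ∫ ω, (∑ t ∈ Finset.range n, c T t ω * g T (e T t ω)) ^ 2 ∂(P T) ≤ n * C := by
    intro T n
    induction n with
    | zero => simp
    | succ n ih =>
      set S : Ω T → ℝ := fun ω => ∑ t ∈ Finset.range n, c T t ω * g T (e T t ω) with hSdef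
      have hXn : MemLp (fun ω => c T n ω * g T (e T n ω)) 2 (P T) := by simpa using hX.memLp 2 T n
      have e1 : ∀ ω, (∑ t ∈ Finset.range (n + 1), c T t ω * g T (e T t ω)) ^ 2
          = (S ω ^ 2 + 2 * ((S ω * c T n ω) * g T (e T n ω))) + (c T n ω * g T (e T n ω)) ^ 2 := by
        intro ω
        rw [Finset.sum_range_succ]
        ring
      have hcross : Integrable (fun ω => (S ω * c T n ω) * g T (e T n ω)) (P T) :=
        ((hS T n).integrable_mul hXn).congr (Eventually.of_forall fun ω => by
          simp only [Pi.mul_apply]; ring)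
      have h0 : ∫ ω, (S ω * c T n ω) * g T (e T n ω) ∂(P T) = 0 := by
        have := integral_past_mul (P := P T) (he T) (hind T) (t := n) (A := fun ω => S ω * c T n ω)
          (g := g T) ((hSm T n).mul (hc T n)) (hg T)
        rw [this, hg0, mul_zero]
      simp_rw [e1]
      have hi : Integrable (fun ω => S ω ^ 2 + 2 * ((S ω * c T n ω) * g T (e T n ω))) (P T) :=
        (hS T n).integrable_sq.add (hcross.const_mul 2)
      rw [integral_add hi hXn.integrable_sq,
        integral_add (hS T n).integrable_sq (hcross.const_mul 2), integral_const_mul, h0]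
      have h2 := (le_abs_self _).trans (abs_integral_le_integral_abs.trans (hC T n))
      push_cast
      linarith
  refine OP.of_sq (OP.of_integral C (fun T => ?_) (Eventually.of_forall fun T => ?_))
  · have : Integrable (fun ω => ((Real.sqrt T)⁻¹) ^ 2 *
        (∑ t ∈ Finset.range T, c T t ω * g T (e T t ω)) ^ 2) (P T) :=
      (hS T T).integrable_sq.const_mul _
    exact this.congr (Eventually.of_forall fun ω => by simp only [mul_pow])
  · have habs : ∀ x : ℝ, |((Real.sqrt T)⁻¹ * x) ^ 2| = (T : ℝ)⁻¹ * x ^ 2 := fun x => by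
      rw [abs_pow, sq_abs, mul_pow, inv_pow, Real.sq_sqrt (Nat.cast_nonneg T)]
    simp only [habs]
    rw [integral_const_mul]
    rcases Nat.eq_zero_or_pos T with rfl | hT
    · simpa using hC0
    · rw [inv_mul_le_iff₀ (by positivity)]
      exact key T T

end LawOfLargeNumbers


/-! ### Algebra of time averages -/

section Average

/-- The average of the terms `0, …, T - 1`. -/
noncomputable def avg (T : ℕ) (f : ℕ → ℝ) : ℝ := (T : ℝ)⁻¹ * ∑ t ∈ Finset.range T, f t

lemma avg_add (T : ℕ) (f g : ℕ → ℝ) : avg T (fun t => f t + g t) = avg T f + avg T g := by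
  simp only [avg, Finset.sum_add_distrib, mul_add]

lemma avg_sub (T : ℕ) (f g : ℕ → ℝ) : avg T (fun t => f t - g t) = avg T f - avg T g := by
  simp only [avg, Finset.sum_sub_distrib, mul_sub]

lemma avg_const_mul (T : ℕ) (c : ℝ) (f : ℕ → ℝ) : avg T (fun t => c * f t) = c * avg T f := by
  simp only [avg, ← Finset.mul_sum]
  ring

lemma avg_mul_const (T : ℕ) (c : ℝ) (f : ℕ → ℝ) : avg T (fun t => f t * c) = avg T f * c := by
  simp only [avg, ← Finset.sum_mul]
  ring

lemma avg_sum {κ : Type*} (T : ℕ) (s : Finset κ) (f : κ → ℕ → ℝ) :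
    avg T (fun t => ∑ i ∈ s, f i t) = ∑ i ∈ s, avg T (f i) := by
  simp only [avg]
  rw [Finset.sum_comm, Finset.mul_sum]

lemma avg_const {T : ℕ} (hT : T ≠ 0) (c : ℝ) : avg T (fun _ => c) = c := by
  have : (T : ℝ) ≠ 0 := Nat.cast_ne_zero.2 hT
  simp [avg, this]

lemma avg_mono {T : ℕ} {f g : ℕ → ℝ} (h : ∀ t, f t ≤ g t) : avg T f ≤ avg T g :=
  mul_le_mul_of_nonneg_left (Finset.sum_le_sum fun t _ => h t) (by positivity)

lemma avg_nonneg {T : ℕ} {f : ℕ → ℝ} (h : ∀ t, 0 ≤ f t) : 0 ≤ avg T f :=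
  mul_nonneg (by positivity) (Finset.sum_nonneg fun t _ => h t)

lemma avg_mul_sq_le (T : ℕ) (f g : ℕ → ℝ) :
    avg T (fun t => f t * g t) ^ 2 ≤ avg T (fun t => f t ^ 2) * avg T (fun t => g t ^ 2) := by
  have h := Finset.sum_mul_sq_le_sq_mul_sq (Finset.range T) f g
  simp only [avg, mul_pow]
  have h2 : (0 : ℝ) ≤ ((T : ℝ)⁻¹) ^ 2 := by positivity
  calc _ ≤ ((T : ℝ)⁻¹) ^ 2 * _ := mul_le_mul_of_nonneg_left h h2
    _ = _ := by ring

end Average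

/-! ### Linear equations with a stable matrix -/

section Stable

variable {n : Type*} [Fintype n] [DecidableEq n] [Nonempty n] {Φ : Matrix n n ℝ}

lemma tendsto_pow_matrix (hΦ : ∀ z ∈ spectrum ℂ (Φ.map (algebraMap ℝ ℂ)), ‖z‖ < 1) :
    Tendsto (fun k : ℕ => Φ ^ k) atTop (𝓝 0) := by
  obtain ⟨K, ρ, -, h0, h1, h⟩ := exists_abs_pow_apply_le hΦ
  refine tendsto_pi_nhds.2 fun a => tendsto_pi_nhds.2 fun b => ?_
  have hl : Tendsto (fun k : ℕ => K * ρ ^ k) atTop (𝓝 0) := by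
    simpa using (tendsto_pow_atTop_nhds_zero_of_lt_one h0.le h1).const_mul K
  exact squeeze_zero_norm (fun k => h k a b) hl

/-- A vector fixed by Φ is fixed by all its powers, which tend to 0. -/
lemma isUnit_one_sub (hΦ : ∀ z ∈ spectrum ℂ (Φ.map (algebraMap ℝ ℂ)), ‖z‖ < 1) :
    IsUnit (1 - Φ).det := by
  rw [isUnit_iff_ne_zero]
  intro h
  obtain ⟨v, hv0, hv⟩ := Matrix.exists_mulVec_eq_zero_iff.2 h
  rw [Matrix.sub_mulVec, Matrix.one_mulVec, sub_eq_zero] at hv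
  have hk : ∀ k : ℕ, (Φ ^ k).mulVec v = v := fun k => by
    induction k with
    | zero => simp
    | succ k ih => rw [pow_succ, ← Matrix.mulVec_mulVec, ← hv, ih]
  have h1 : Tendsto (fun k : ℕ => (Φ ^ k).mulVec v) atTop (𝓝 ((0 : Matrix n n ℝ).mulVec v)) :=
    (Continuous.matrix_mulVec continuous_id continuous_const).continuousAt.tendsto.comp
      (tendsto_pow_matrix hΦ)
  simp only [hk, Matrix.zero_mulVec] at h1
  exact hv0 (tendsto_nhds_unique tendsto_const_nhds h1)

/-- The Stein operator `M ↦ M - Φ M Φ'`. -/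
def stein (Φ : Matrix n n ℝ) : Matrix n n ℝ →ₗ[ℝ] Matrix n n ℝ where
  toFun M := M - Φ * M * Φ.transpose
  map_add' M N := by simp only [mul_add, add_mul]; abel
  map_smul' c M := by simp [smul_sub]

/-- A solution of M = ΦMΦ' satisfies M = Φ^k M (Φ^k)' for every k, and the right side tends to 0. -/
lemma stein_injective (hΦ : ∀ z ∈ spectrum ℂ (Φ.map (algebraMap ℝ ℂ)), ‖z‖ < 1) :
    Function.Injective (stein Φ) := by
  rw [← LinearMap.ker_eq_bot, LinearMap.ker_eq_bot']
  intro M hM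
  have hM : M = Φ * M * Φ.transpose := sub_eq_zero.1 hM
  have hk : ∀ k : ℕ, Φ ^ k * M * (Φ ^ k).transpose = M := fun k => by
    induction k with
    | zero => simp
    | succ k ih =>
      conv_rhs => rw [← ih, hM]
      rw [pow_succ, Matrix.transpose_mul]
      simp only [mul_assoc]
  have hT := tendsto_pow_matrix hΦ
  have h1 : Tendsto (fun k : ℕ => Φ ^ k * M * (Φ ^ k).transpose) atTop
      (𝓝 (0 * M * (0 : Matrix n n ℝ).transpose)) :=
    (hT.mul tendsto_const_nhds).mul ((Continuous.matrix_transpose continuous_id).tendsto _ |>.comp hT)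
  simp only [hk, zero_mul] at h1
  exact tendsto_nhds_unique tendsto_const_nhds h1

/-- In finite dimensions the injective Stein operator has a continuous inverse. Limits of sample
second moments can thus be read off from the limit of M - ΦMΦ', with no infinite series for the
stationary covariance. -/
lemma exists_stein_solution (hΦ : ∀ z ∈ spectrum ℂ (Φ.map (algebraMap ℝ ℂ)), ‖z‖ < 1)
    (S : Matrix n n ℝ) : ∃ Q, Q = Φ * Q * Φ.transpose + S ∧
      ∀ {ι : Type*} {l : Filter ι} {M : ι → Matrix n n ℝ},
        Tendsto (fun i => M i - Φ * M i * Φ.transpose) l (𝓝 S) → Tendsto M l (𝓝 Q) := by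
  set L := LinearEquiv.ofInjectiveEndo (stein Φ) (stein_injective hΦ) with hL
  refine ⟨L.symm S, ?_, fun {ι l M} h => ?_⟩
  · have : L (L.symm S) = S := L.apply_symm_apply S
    have h2 : L.symm S - Φ * L.symm S * Φ.transpose = S := this
    rw [← sub_eq_iff_eq_add', h2]
  · have hc : Continuous L.symm := L.symm.toLinearMap.continuous_of_finiteDimensional
    have h2 := (hc.tendsto S).comp h
    refine h2.congr fun i => ?_
    exact L.symm_apply_apply (M i)

end Stable

/-! ### The autoregression started at zero -/

section LinearProcess

variable {N J : ℕ}

/-- Instruments and disturbances of all units in one period. -/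
abbrev Shock (N J : ℕ) : Type := Fin N → ℝ × (Fin (J + 1) → ℝ)

/-- The autoregressive process started at `0`. -/
def linProc (Φ : Matrix (Fin (J + 1)) (Fin (J + 1)) ℝ) (e : ℕ → Shock N J) :
    ℕ → Fin N → Fin (J + 1) → ℝ
  | 0 => 0
  | t + 1 => fun i => Φ.mulVec (linProc Φ e t i) + (e t i).2

lemma linProc_eq_sum (Φ : Matrix (Fin (J + 1)) (Fin (J + 1)) ℝ) (e : ℕ → Shock N J) (t : ℕ)
    (i : Fin N) (a : Fin (J + 1)) : linProc Φ e t i a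
      = ∑ b, ∑ j ∈ Finset.range t, (Φ ^ (t - 1 - j)) a b * (e j i).2 b := by
  have h : linProc Φ e t i = ∑ j ∈ Finset.range t, (Φ ^ (t - 1 - j)).mulVec (e j i).2 := by
    induction t with
    | zero => simp [linProc]
    | succ t ih =>
      rw [Finset.sum_range_succ, linProc]
      beta_reduce
      rw [ih, Matrix.mulVec_sum]
      congr 1
      · refine Finset.sum_congr rfl fun j hj => ?_
        have hj := Finset.mem_range.1 hj
        rw [Matrix.mulVec_mulVec, ← pow_succ']
        congr 2
        omega
      · simp
  rw [h, Finset.sum_apply, Finset.sum_comm]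
  rfl

variable {Ω : ℕ → Type*} {mΩ : ∀ T, MeasurableSpace (Ω T)} {P : ∀ T, Measure (Ω T)}

/-- Filters with geometrically decaying coefficients preserve uniform moment bounds. -/
lemma AllMoments.convolution [∀ T, IsProbabilityMeasure (P T)] {X : ∀ T, ℕ → Ω T → ℝ}
    (hX : AllMoments P X) {c : ℕ → ℝ} {K ρ : ℝ} (h0 : 0 < ρ) (h1 : ρ < 1)
    (hc : ∀ k, |c k| ≤ K * ρ ^ k) :
    AllMoments P (fun T t ω => ∑ j ∈ Finset.range t, c (t - 1 - j) * X T j ω) := by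
  have hae : ∀ T j k, AEStronglyMeasurable (fun ω => c k * X T j ω) (P T) := fun T j k =>
    (hX.aesm T j).const_mul _
  have hsum : ∀ T t, AEStronglyMeasurable
      (fun ω => ∑ j ∈ Finset.range t, c (t - 1 - j) * X T j ω) (P T) := fun T t =>
    Finset.aestronglyMeasurable_fun_sum _ fun j _ => hae T j _
  have hK : 0 ≤ K := by
    have := (abs_nonneg _).trans (hc 0)
    simpa using this
  refine ⟨hsum, fun p => ?_⟩
  obtain ⟨C, hC⟩ := hX.bdd (p + 1)
  refine ⟨Real.toNNReal (K * (1 - ρ)⁻¹) * C, fun T t => ?_⟩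
  refine (eLpNorm_le_eLpNorm_of_exponent_le (p := p) (q := (p + 1 : ℕ))
    (by exact_mod_cast Nat.le_succ p) (hsum T t)).trans ?_
  have h2 : (fun ω => ∑ j ∈ Finset.range t, c (t - 1 - j) * X T j ω)
      = ∑ j ∈ Finset.range t, fun ω => c (t - 1 - j) * X T j ω := by
    ext ω; simp
  rw [h2]
  refine (eLpNorm_sum_le (fun j _ => hae T j _) (by simp)).trans ?_
  have h3 : ∀ j ∈ Finset.range t, eLpNorm (fun ω => c (t - 1 - j) * X T j ω) ((p + 1 : ℕ) : ENNReal)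
      (P T) ≤ ENNReal.ofReal (K * ρ ^ (t - 1 - j)) * C := fun j _ => by
    have h4 := eLpNorm_const_smul_le (c := c (t - 1 - j)) (f := X T j) (p := ((p + 1 : ℕ) : ENNReal))
      (μ := P T)
    refine h4.trans (mul_le_mul' ?_ (hC T j))
    rw [← ofReal_norm]
    exact ENNReal.ofReal_le_ofReal (hc _)
  refine (Finset.sum_le_sum h3).trans ?_
  rw [← Finset.sum_mul, ENNReal.coe_mul]
  refine mul_le_mul' ?_ le_rfl
  rw [← ENNReal.ofReal_sum_of_nonneg (fun j _ => by positivity)]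
  refine ENNReal.ofReal_le_ofReal ?_
  rw [Finset.sum_range_reflect (fun j => K * ρ ^ j), ← Finset.mul_sum]
  refine mul_le_mul_of_nonneg_left ?_ hK
  rw [← tsum_geometric_of_lt_one h0.le h1]
  exact (summable_geometric_of_lt_one h0.le h1).sum_le_tsum _ fun j _ => by positivity

/-- Shock t is that of period t + 1, so the process at t is exactly the lag that enters the
regression alongside shock t. Starting at 0 keeps the presample values out of the filtration; their
contribution is the separate `transient`. -/
lemma measurable_linProc {Ω : Type*} {m : MeasurableSpace Ω} (Φ : Matrix (Fin (J + 1)) (Fin (J + 1)) ℝ)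
    {e : ℕ → Ω → Shock N J} (he : ∀ t, Measurable (e t)) (t : ℕ) (i : Fin N) (a : Fin (J + 1)) :
    Measurable[past e he t] (fun ω => linProc Φ (fun s => e s ω) t i a) := by
  simp only [linProc_eq_sum]
  refine Finset.measurable_sum _ fun b _ => Finset.measurable_sum _ fun j hj => ?_
  have hm : Measurable fun x : Shock N J => (Φ ^ (t - 1 - j)) a b * (x i).2 b := by fun_prop
  exact hm.comp (measurable_past he (Finset.mem_range.1 hj))

lemma allMoments_linProc [∀ T, IsProbabilityMeasure (P T)]
    {Φ : Matrix (Fin (J + 1)) (Fin (J + 1)) ℝ}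
    (hΦ : ∀ z ∈ spectrum ℂ (Φ.map (algebraMap ℝ ℂ)), ‖z‖ < 1) {e : ∀ T, ℕ → Ω T → Shock N J}
    (hu : ∀ i a, AllMoments P fun T t ω => (e T t ω i).2 a) (i : Fin N) (a : Fin (J + 1)) :
    AllMoments P fun T t ω => linProc Φ (fun s => e T s ω) t i a := by
  obtain ⟨K, ρ, -, h0, h1, h⟩ := exists_abs_pow_apply_le hΦ
  simp only [linProc_eq_sum]
  exact AllMoments.sum _ fun b _ =>
    (hu i b).convolution h0 h1 (c := fun k => (Φ ^ k) a b) fun k => h k a b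

end LinearProcess


/-! ### Statistics affine in the current shock with predictable coefficients -/

section LinearStatistic

variable {Ω : ℕ → Type*} {mΩ : ∀ T, MeasurableSpace (Ω T)} {P : ∀ T, Measure (Ω T)}

lemma sqrt_mul_avg (T : ℕ) (f : ℕ → ℝ) :
    Real.sqrt T * avg T f = (Real.sqrt T)⁻¹ * ∑ t ∈ Finset.range T, f t := by
  rw [avg, ← mul_assoc, ← div_eq_mul_inv, Real.sqrt_div_self', one_div]

lemma OP.tendsto_of_sqrt_mul {X : (Σ T, Ω T) → ℝ} (h : OP P fun q => Real.sqrt q.1 * X q) :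
    Tendsto X (inProb P) (𝓝 0) := by
  have h1 := h.mul_tendsto tendsto_inv_sqrt_inProb
  refine h1.congr' ?_
  filter_upwards [tendsto_fst_inProb.eventually (eventually_gt_atTop 0)] with q hq
  have : Real.sqrt q.1 ≠ 0 := (Real.sqrt_pos.2 (Nat.cast_pos.2 hq)).ne'
  field_simp

variable [∀ T, IsProbabilityMeasure (P T)] {E : Type*} [MeasurableSpace E]

lemma op_sqrt_avg_past_mul {e : ∀ T, ℕ → Ω T → E} (he : ∀ T t, Measurable (e T t))
    (hind : ∀ T, iIndepFun (e T) (P T)) {c : ∀ T, ℕ → Ω T → ℝ} {g : ℕ → E → ℝ}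
    (hc : ∀ T t, Measurable[past (e T) (he T) t] (c T t)) (hcm : AllMoments P c)
    (hg : ∀ T, Measurable (g T)) (hgm : AllMoments P fun T t ω => g T (e T t ω))
    (hg0 : ∀ T t, ∫ ω, g T (e T t ω) ∂(P T) = 0) :
    OP P fun q => Real.sqrt q.1 * avg q.1 fun t => c q.1 t q.2 * g q.1 (e q.1 t q.2) := by
  simp only [sqrt_mul_avg]
  exact op_sum_past_mul he hind hc hcm hg hgm hg0

lemma integral_bdd_mul_past_mul {e : ∀ T, ℕ → Ω T → E} (he : ∀ T t, Measurable (e T t))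
    (hind : ∀ T, iIndepFun (e T) (P T)) {c : ∀ T, ℕ → Ω T → ℝ} {g : ℕ → E → ℝ}
    (hc : ∀ T t, Measurable[past (e T) (he T) t] (c T t)) (hcm : AllMoments P c)
    (hg : ∀ T, Measurable (g T)) (hgm : AllMoments P fun T t ω => g T (e T t ω))
    (hg0 : ∀ T t, ∫ ω, g T (e T t ω) ∂(P T) = 0) (T t : ℕ) {A : Ω T → ℂ}
    (hA : Measurable[past (e T) (he T) t] A) (hAb : ∃ C, ∀ ω, ‖A ω‖ ≤ C) :
    Integrable (fun ω => A ω * ((c T t ω * g T (e T t ω) : ℝ) : ℂ)) (P T) ∧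
      ∫ ω, A ω * ((c T t ω * g T (e T t ω) : ℝ) : ℂ) ∂(P T) = 0 := by
  obtain ⟨C, hC⟩ := hAb
  constructor
  · exact ((hcm.mul hgm).integrable T t).ofReal.bdd_mul
      (hA.mono ((past (e T) (he T)).le t) le_rfl).aestronglyMeasurable (Eventually.of_forall hC)
  · have h := integral_past_mul (P := P T) (he T) (hind T) (t := t)
      (A := fun ω => A ω * (c T t ω : ℂ)) (g := fun x => ((g T x : ℝ) : ℂ))
      (hA.mul (Complex.measurable_ofReal.comp (hc T t))) (Complex.measurable_ofReal.comp (hg T))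
    have h0 : ∫ ω, ((g T (e T t ω) : ℝ) : ℂ) ∂(P T) = 0 := by
      rw [integral_complex_ofReal, hg0, Complex.ofReal_zero]
    rw [h0, mul_zero] at h
    rw [← h]
    refine integral_congr_ae (Eventually.of_forall fun ω => ?_)
    simp only
    push_cast
    ring

/-- A statistic that is affine in functions of the contemporaneous shock, with predictable
coefficients. -/
structure LinStat (P : ∀ T, Measure (Ω T)) (e : ∀ T, ℕ → Ω T → E) {κ : Type*}
    (U : κ → E → ℝ) (ζ : E → ℝ) (C : κ → ∀ T, ℕ → Ω T → ℝ) : Prop where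
  meas : ∀ T t, Measurable (e T t)
  indep : ∀ T, iIndepFun (e T) (P T)
  ident : ∀ T t, IdentDistrib (e T t) (e T 0) (P T) (P T)
  measU : ∀ k, Measurable (U k)
  measζ : Measurable ζ
  momU : ∀ k, AllMoments P fun T t ω => U k (e T t ω)
  momζ : AllMoments P fun T t ω => ζ (e T t ω)
  meanU : ∀ k T t, ∫ ω, U k (e T t ω) ∂(P T) = 0
  meanζ : ∀ T t, ∫ ω, ζ (e T t ω) ∂(P T) = 0
  pastC : ∀ k T t, Measurable[past (e T) (meas T) t] (C k T t)
  momC : ∀ k, AllMoments P (C k)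

namespace LinStat

variable {κ : Type*} [Fintype κ]

/-- The statistic. -/
def stat (e : ∀ T, ℕ → Ω T → E) (U : κ → E → ℝ) (ζ : E → ℝ) (C : κ → ∀ T, ℕ → Ω T → ℝ)
    (T t : ℕ) (ω : Ω T) : ℝ := ∑ k, C k T t ω * U k (e T t ω) + ζ (e T t ω)

/-- Its conditional variance as a function of the coefficients. -/
noncomputable def condVar (P : ∀ T, Measure (Ω T)) (e : ∀ T, ℕ → Ω T → E) (U : κ → E → ℝ)
    (ζ : E → ℝ) (T : ℕ) (c : κ → ℝ) : ℝ :=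
  ∑ k, ∑ l, c k * c l * ∫ ω, U k (e T 0 ω) * U l (e T 0 ω) ∂(P T)
    + 2 * ∑ k, c k * ∫ ω, U k (e T 0 ω) * ζ (e T 0 ω) ∂(P T) + ∫ ω, ζ (e T 0 ω) ^ 2 ∂(P T)

variable {e : ∀ T, ℕ → Ω T → E} {U : κ → E → ℝ} {ζ : E → ℝ} {C : κ → ∀ T, ℕ → Ω T → ℝ}

lemma integral_eq (h : LinStat P e U ζ C) {g : E → ℝ} (hg : Measurable g) (T t : ℕ) :
    ∫ ω, g (e T t ω) ∂(P T) = ∫ ω, g (e T 0 ω) ∂(P T) :=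
  ((h.ident T t).comp hg).integral_eq

/-- Centring of a function of the shocks. -/
lemma centred (h : LinStat P e U ζ C) {g : E → ℝ} (hg : Measurable g)
    (hm : AllMoments P fun T t ω => g (e T t ω)) :
    (AllMoments P fun T t ω => g (e T t ω) - ∫ ω, g (e T 0 ω) ∂(P T)) ∧
      ∀ T t, ∫ ω, (g (e T t ω) - ∫ ω, g (e T 0 ω) ∂(P T)) ∂(P T) = 0 := by
  obtain ⟨B, -, hB⟩ := hm.exists_integral_le
  constructor
  · have h2 : AllMoments P fun T (_ : ℕ) (_ : Ω T) => -∫ ω, g (e T 0 ω) ∂(P T) :=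
      AllMoments.const_of_bdd B fun T t => by rw [abs_neg]; exact hB T 0
    simpa only [sub_eq_add_neg] using hm.add h2
  · intro T t
    rw [integral_sub (hm.integrable T t) (integrable_const _), h.integral_eq hg]
    simp

/-- The squared statistic minus its conditional variance is a finite sum of predictable factors
times centred functions of the current shock. Each such product is a martingale difference, which
yields both a law of large numbers for the squares and the second conditional moment required by the
central limit theorem. -/
lemma sq_sub_condVar (T t : ℕ) (ω : Ω T) :
    stat e U ζ C T t ω ^ 2 - condVar P e U ζ T (fun k => C k T t ω)
      = ∑ k, ∑ l, (C k T t ω * C l T t ω) *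
          (U k (e T t ω) * U l (e T t ω) - ∫ ω, U k (e T 0 ω) * U l (e T 0 ω) ∂(P T))
        + ∑ k, (2 * C k T t ω) *
          (U k (e T t ω) * ζ (e T t ω) - ∫ ω, U k (e T 0 ω) * ζ (e T 0 ω) ∂(P T))
        + 1 * (ζ (e T t ω) ^ 2 - ∫ ω, ζ (e T 0 ω) ^ 2 ∂(P T)) := by
  have h1 : (∑ k, C k T t ω * U k (e T t ω)) ^ 2
      = ∑ k, ∑ l, (C k T t ω * C l T t ω) * (U k (e T t ω) * U l (e T t ω)) := by
    rw [sq, Finset.sum_mul_sum]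
    exact Finset.sum_congr rfl fun k _ => Finset.sum_congr rfl fun l _ => by ring
  have h2 : 2 * (∑ k, C k T t ω * U k (e T t ω)) * ζ (e T t ω)
      = ∑ k, (2 * C k T t ω) * (U k (e T t ω) * ζ (e T t ω)) := by
    rw [Finset.mul_sum, Finset.sum_mul]
    exact Finset.sum_congr rfl fun k _ => by ring
  have h3 : 2 * ∑ k, C k T t ω * ∫ ω, U k (e T 0 ω) * ζ (e T 0 ω) ∂(P T)
      = ∑ k, (2 * C k T t ω) * ∫ ω, U k (e T 0 ω) * ζ (e T 0 ω) ∂(P T) := by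
    rw [Finset.mul_sum]
    exact Finset.sum_congr rfl fun k _ => by ring
  simp only [mul_sub, Finset.sum_sub_distrib]
  rw [← h1, ← h2, ← h3, stat, condVar]
  ring

lemma terms_kl (h : LinStat P e U ζ C) (k l : κ) :
    (AllMoments P fun T t ω => U k (e T t ω) * U l (e T t ω)
      - ∫ ω, U k (e T 0 ω) * U l (e T 0 ω) ∂(P T)) ∧
    ∀ T t, ∫ ω, (U k (e T t ω) * U l (e T t ω)
      - ∫ ω, U k (e T 0 ω) * U l (e T 0 ω) ∂(P T)) ∂(P T) = 0 :=
  h.centred (g := fun x => U k x * U l x) ((h.measU k).mul (h.measU l)) ((h.momU k).mul (h.momU l))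

lemma terms_k (h : LinStat P e U ζ C) (k : κ) :
    (AllMoments P fun T t ω => U k (e T t ω) * ζ (e T t ω)
      - ∫ ω, U k (e T 0 ω) * ζ (e T 0 ω) ∂(P T)) ∧
    ∀ T t, ∫ ω, (U k (e T t ω) * ζ (e T t ω)
      - ∫ ω, U k (e T 0 ω) * ζ (e T 0 ω) ∂(P T)) ∂(P T) = 0 :=
  h.centred (g := fun x => U k x * ζ x) ((h.measU k).mul h.measζ) ((h.momU k).mul h.momζ)

lemma terms (h : LinStat P e U ζ C) :
    (AllMoments P fun T t ω => ζ (e T t ω) ^ 2 - ∫ ω, ζ (e T 0 ω) ^ 2 ∂(P T)) ∧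
    ∀ T t, ∫ ω, (ζ (e T t ω) ^ 2 - ∫ ω, ζ (e T 0 ω) ^ 2 ∂(P T)) ∂(P T) = 0 :=
  h.centred (g := fun x => ζ x ^ 2) (h.measζ.pow_const 2) (h.momζ.pow 2)

lemma tendsto_avg_sq_sub_condVar (h : LinStat P e U ζ C) :
    Tendsto (fun q : Σ T, Ω T => avg q.1 fun t => stat e U ζ C q.1 t q.2 ^ 2
      - condVar P e U ζ q.1 (fun k => C k q.1 t q.2)) (inProb P) (𝓝 0) := by
  simp only [sq_sub_condVar, avg_add, avg_sum]
  have h1 : ∀ k l, Tendsto (fun q : Σ T, Ω T => avg q.1 fun t =>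
      (C k q.1 t q.2 * C l q.1 t q.2) * (U k (e q.1 t q.2) * U l (e q.1 t q.2)
        - ∫ ω, U k (e q.1 0 ω) * U l (e q.1 0 ω) ∂(P q.1))) (inProb P) (𝓝 0) := fun k l =>
    (op_sqrt_avg_past_mul h.meas h.indep
      (c := fun T t ω => C k T t ω * C l T t ω)
      (g := fun T x => U k x * U l x - ∫ ω, U k (e T 0 ω) * U l (e T 0 ω) ∂(P T))
      (fun T t => (h.pastC k T t).mul (h.pastC l T t)) ((h.momC k).mul (h.momC l))
      (fun T => ((h.measU k).mul (h.measU l)).sub_const _) (h.terms_kl k l).1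
      (h.terms_kl k l).2).tendsto_of_sqrt_mul
  have h2 : ∀ k, Tendsto (fun q : Σ T, Ω T => avg q.1 fun t =>
      (2 * C k q.1 t q.2) * (U k (e q.1 t q.2) * ζ (e q.1 t q.2)
        - ∫ ω, U k (e q.1 0 ω) * ζ (e q.1 0 ω) ∂(P q.1))) (inProb P) (𝓝 0) := fun k =>
    (op_sqrt_avg_past_mul h.meas h.indep
      (c := fun T t ω => 2 * C k T t ω)
      (g := fun T x => U k x * ζ x - ∫ ω, U k (e T 0 ω) * ζ (e T 0 ω) ∂(P T))
      (fun T t => (h.pastC k T t).const_mul 2) ((h.momC k).const_mul 2)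
      (fun T => ((h.measU k).mul h.measζ).sub_const _) (h.terms_k k).1
      (h.terms_k k).2).tendsto_of_sqrt_mul
  have h3 : Tendsto (fun q : Σ T, Ω T => avg q.1 fun t =>
      1 * (ζ (e q.1 t q.2) ^ 2 - ∫ ω, ζ (e q.1 0 ω) ^ 2 ∂(P q.1))) (inProb P) (𝓝 0) :=
    (op_sqrt_avg_past_mul h.meas h.indep
      (c := fun T t ω => 1)
      (g := fun T x => ζ x ^ 2 - ∫ ω, ζ (e T 0 ω) ^ 2 ∂(P T))
      (fun T t => measurable_const) (AllMoments.const 1)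
      (fun T => (h.measζ.pow_const 2).sub_const _) h.terms.1
      h.terms.2).tendsto_of_sqrt_mul
  have h4 := ((tendsto_finsetSum Finset.univ fun k _ =>
    tendsto_finsetSum Finset.univ fun l _ => h1 k l).add
    (tendsto_finsetSum Finset.univ fun k _ => h2 k)).add h3
  simpa using h4

lemma integral_bdd_mul_stat (h : LinStat P e U ζ C) (T t : ℕ) {A : Ω T → ℂ}
    (hA : Measurable[past (e T) (h.meas T) t] A) (hAb : ∃ C, ∀ ω, ‖A ω‖ ≤ C) :
    ∫ ω, A ω * (stat e U ζ C T t ω : ℂ) ∂(P T) = 0 := by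
  have h1 := fun k => integral_bdd_mul_past_mul h.meas h.indep (g := fun _ => U k) (h.pastC k)
    (h.momC k) (fun _ => h.measU k) (h.momU k) (h.meanU k) T t hA hAb
  have h2 := integral_bdd_mul_past_mul h.meas h.indep (c := fun _ _ _ => 1) (g := fun _ => ζ)
    (fun _ _ => measurable_const) (AllMoments.const 1) (fun _ => h.measζ) h.momζ h.meanζ T t hA hAb
  have e1 : ∀ ω, A ω * (stat e U ζ C T t ω : ℂ)
      = ∑ k, A ω * ((C k T t ω * U k (e T t ω) : ℝ) : ℂ) + A ω * ((1 * ζ (e T t ω) : ℝ) : ℂ) := by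
    intro ω
    rw [stat, ← Finset.mul_sum]
    push_cast
    ring
  simp_rw [e1]
  rw [integral_add (integrable_finsetSum _ fun k _ => (h1 k).1) h2.1, h2.2,
    integral_finsetSum _ fun k _ => (h1 k).1, Finset.sum_eq_zero fun k _ => (h1 k).2, add_zero]

lemma integral_bdd_mul_sq_sub (h : LinStat P e U ζ C) (T t : ℕ) {A : Ω T → ℂ}
    (hA : Measurable[past (e T) (h.meas T) t] A) (hAb : ∃ C, ∀ ω, ‖A ω‖ ≤ C) :
    ∫ ω, A ω * ((stat e U ζ C T t ω ^ 2 - condVar P e U ζ T (fun k => C k T t ω) : ℝ) : ℂ) ∂(P T)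
      = 0 := by
  have h1 := fun k l => integral_bdd_mul_past_mul h.meas h.indep
      (c := fun T t ω => C k T t ω * C l T t ω)
      (g := fun T x => U k x * U l x - ∫ ω, U k (e T 0 ω) * U l (e T 0 ω) ∂(P T))
      (fun T t => (h.pastC k T t).mul (h.pastC l T t)) ((h.momC k).mul (h.momC l))
      (fun T => ((h.measU k).mul (h.measU l)).sub_const _) (h.terms_kl k l).1
      (h.terms_kl k l).2 T t hA hAb
  have h2 := fun k => integral_bdd_mul_past_mul h.meas h.indep
      (c := fun T t ω => 2 * C k T t ω)
      (g := fun T x => U k x * ζ x - ∫ ω, U k (e T 0 ω) * ζ (e T 0 ω) ∂(P T))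
      (fun T t => (h.pastC k T t).const_mul 2) ((h.momC k).const_mul 2)
      (fun T => ((h.measU k).mul h.measζ).sub_const _) (h.terms_k k).1
      (h.terms_k k).2 T t hA hAb
  have h3 := integral_bdd_mul_past_mul h.meas h.indep
      (c := fun T t ω => 1)
      (g := fun T x => ζ x ^ 2 - ∫ ω, ζ (e T 0 ω) ^ 2 ∂(P T))
      (fun T t => measurable_const) (AllMoments.const 1)
      (fun T => (h.measζ.pow_const 2).sub_const _) h.terms.1
      h.terms.2 T t hA hAb
  simp_rw [sq_sub_condVar, Complex.ofReal_add, Complex.ofReal_sum, mul_add, Finset.mul_sum]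
  have i1 := fun k => integrable_finsetSum Finset.univ fun l _ => (h1 k l).1
  have i2 := integrable_finsetSum Finset.univ fun k _ => i1 k
  have i3 := integrable_finsetSum Finset.univ fun k _ => (h2 k).1
  rw [integral_add (i2.fun_add i3) h3.1, integral_add i2 i3, h3.2,
    integral_finsetSum _ fun k _ => i1 k, integral_finsetSum _ fun k _ => (h2 k).1,
    Finset.sum_eq_zero fun k _ => (h2 k).2]
  simp only [add_zero]
  refine Finset.sum_eq_zero fun k _ => ?_
  rw [integral_finsetSum _ fun l _ => (h1 k l).1]
  exact Finset.sum_eq_zero fun l _ => (h1 k l).2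

end LinStat

end LinearStatistic


/-! ### Central limit theorem for affine statistics -/

namespace LinStat

variable {Ω : ℕ → Type*} {mΩ : ∀ T, MeasurableSpace (Ω T)} {P : ∀ T, Measure (Ω T)}
  [∀ T, IsProbabilityMeasure (P T)] {E : Type*} [MeasurableSpace E] {κ : Type*} [Fintype κ]
  {e : ∀ T, ℕ → Ω T → E} {U : κ → E → ℝ} {ζ : E → ℝ} {C : κ → ∀ T, ℕ → Ω T → ℝ}

lemma allMoments_stat (h : LinStat P e U ζ C) : AllMoments P (stat e U ζ C) :=
  (AllMoments.sum _ fun k _ => (h.momC k).mul (h.momU k)).add h.momζ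

lemma allMoments_condVar (h : LinStat P e U ζ C) :
    AllMoments P fun T t ω => condVar P e U ζ T (fun k => C k T t ω) := by
  have hb : ∀ {g : E → ℝ}, (AllMoments P fun T t ω => g (e T t ω)) →
      AllMoments P fun T (_ : ℕ) (_ : Ω T) => ∫ ω, g (e T 0 ω) ∂(P T) := fun {g} hg => by
    obtain ⟨B, -, hB⟩ := hg.exists_integral_le
    exact AllMoments.const_of_bdd B fun T t => hB T 0
  refine ((AllMoments.sum _ fun k _ => AllMoments.sum _ fun l _ => ?_).add
    ((AllMoments.sum _ fun k _ => ?_).const_mul 2)).add ?_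
  · exact ((h.momC k).mul (h.momC l)).mul (hb (g := fun x => U k x * U l x)
      ((h.momU k).mul (h.momU l)))
  · exact (h.momC k).mul (hb (g := fun x => U k x * ζ x) ((h.momU k).mul h.momζ))
  · exact hb (g := fun x => ζ x ^ 2) (h.momζ.pow 2)

lemma measurable_condVar (h : LinStat P e U ζ C) (T t : ℕ) :
    Measurable[past (e T) (h.meas T) t] fun ω => condVar P e U ζ T (fun k => C k T t ω) := by
  refine ((Finset.measurable_sum _ fun k _ => Finset.measurable_sum _ fun l _ => ?_).add
    ((Finset.measurable_sum _ fun k _ => ?_).const_mul 2)).add measurable_const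
  · exact ((h.pastC k T t).mul (h.pastC l T t)).mul_const _
  · exact (h.pastC k T t).mul_const _

lemma measurable_stat (h : LinStat P e U ζ C) (T t : ℕ) :
    Measurable[past (e T) (h.meas T) (t + 1)] (stat e U ζ C T t) := by
  have he := measurable_past (h.meas T) (Nat.lt_succ_self t)
  refine (Finset.measurable_sum _ fun k _ => ?_).add (h.measζ.comp he)
  exact ((h.pastC k T t).mono ((past (e T) (h.meas T)).mono (Nat.le_succ t)) le_rfl).mul
    ((h.measU k).comp he)

/-- With the coefficients frozen at the constants c, this number is the second moment of the
statistic. -/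
lemma condVar_nonneg (h : LinStat P e U ζ C) (T : ℕ) (c : κ → ℝ) : 0 ≤ condVar P e U ζ T c := by
  have h' : LinStat P e U ζ (fun k _ _ _ => c k) :=
    { h with
      pastC := fun _ _ _ => measurable_const
      momC := fun k => AllMoments.const (c k) }
  have h1 := h'.integral_bdd_mul_sq_sub T 0 (A := fun _ => 1) measurable_const ⟨1, by simp⟩
  simp only [one_mul] at h1
  rw [integral_complex_ofReal, Complex.ofReal_eq_zero, integral_sub
    (by simpa using (h'.allMoments_stat.pow 2).integrable T 0) (integrable_const _)] at h1
  have h2 : 0 ≤ ∫ ω, stat e U ζ (fun k _ _ _ => c k) T 0 ω ^ 2 ∂(P T) :=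
    integral_nonneg fun ω => sq_nonneg _
  simp only [integral_const, probReal_univ, smul_eq_mul, one_mul] at h1
  linarith

/-- Central limit theorem for a linear statistic, normalised by its asymptotic variance. -/
theorem tendsto_measure_abs_le (h : LinStat P e U ζ C) {V : ℕ → ℝ} {c₀ : ℝ} (hc₀ : 0 < c₀)
    (hV : ∀ᶠ T in atTop, c₀ ≤ V T)
    (hVl : Tendsto (fun q : Σ T, Ω T => avg q.1 (fun t => condVar P e U ζ q.1
      (fun k => C k q.1 t q.2)) - V q.1) (inProb P) (𝓝 0)) (c : ℝ) :
    Tendsto (fun T => (P T).real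
        {ω | |Real.sqrt T * avg T (fun t => stat e U ζ C T t ω) / Real.sqrt (V T)| ≤ c}) atTop
      (𝓝 ((gaussianReal 0 1).real (Set.Icc (-c) c))) := by
  -- Agrees with V for large T and is positive for every T, so the normalised array satisfies the
  -- hypotheses at all indices.
  set V' : ℕ → ℝ := fun T => max (V T) c₀ with hV'
  have hVV : ∀ᶠ T in atTop, V' T = V T := hV.mono fun T hT => max_eq_left hT
  have hV'c : ∀ T, c₀ ≤ V' T := fun T => le_max_right _ _
  have hV'0 : ∀ T, 0 < V' T := fun T => hc₀.trans_le (hV'c T)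
  set r : ℕ → ℝ := fun T => (Real.sqrt (T * V' T))⁻¹ with hr
  have hr0 : ∀ T, 0 ≤ r T := fun T => inv_nonneg.2 (Real.sqrt_nonneg _)
  have hr2 : ∀ T, r T ^ 2 = (T * V' T)⁻¹ := fun T => by
    rw [hr, inv_pow, Real.sq_sqrt (mul_nonneg (Nat.cast_nonneg T) (hV'0 T).le)]
  -- Two factors r absorb the T summands; the factor r (third moments) or r² (squared conditional
  -- variances) that is left over tends to 0. An inequality, as it must also hold at T = 0.
  have hTr2 : ∀ T : ℕ, (T : ℝ) * r T ^ 2 ≤ c₀⁻¹ := fun T => by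
    rw [hr2, mul_inv, ← mul_assoc]
    have h1 : (T : ℝ) * (T : ℝ)⁻¹ ≤ 1 := mul_inv_le_one
    have h2 : (V' T)⁻¹ ≤ c₀⁻¹ := inv_anti₀ hc₀ (hV'c T)
    calc _ ≤ 1 * (V' T)⁻¹ := mul_le_mul_of_nonneg_right h1 (inv_nonneg.2 (hV'0 T).le)
      _ ≤ c₀⁻¹ := by rwa [one_mul]
  have hrl : Tendsto r atTop (𝓝 0) := by
    refine tendsto_inv_atTop_zero.comp (Real.tendsto_sqrt_atTop.comp ?_)
    refine tendsto_atTop_mono (fun T => ?_) (tendsto_natCast_atTop_atTop.atTop_mul_const hc₀)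
    exact mul_le_mul_of_nonneg_left (hV'c T) (Nat.cast_nonneg T)
  obtain ⟨B3, hB30, hB3⟩ := (h.allMoments_stat.abs.pow 3).exists_integral_abs_le
  obtain ⟨B2, hB20, hB2⟩ := (h.allMoments_condVar.pow 2).exists_integral_abs_le
  have hchar : ∀ θ : ℝ, _ := fun θ => tendsto_integral_cexp_sum (P := P)
    (fun T => past (e T) (h.meas T))
    (X := fun T t ω => r T * stat e U ζ C T t ω)
    (v := fun T t ω => r T ^ 2 * condVar P e U ζ T (fun k => C k T t ω)) θ
    (fun T t => (h.measurable_stat T t).const_mul _)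
    (fun T t => (h.measurable_condVar T t).const_mul _)
    (fun T t ω => mul_nonneg (sq_nonneg _) (h.condVar_nonneg T _))
    (fun T t => by
      simp only [abs_mul, mul_pow]
      exact ((h.allMoments_stat.abs.pow 3).integrable T t).const_mul _)
    (fun T t => by
      simp only [mul_pow]
      exact ((h.allMoments_condVar.pow 2).integrable T t).const_mul _)
    (fun T t A hA hAb => by
      have h1 := h.integral_bdd_mul_stat T t hA hAb
      have e1 : ∀ ω, A ω * ((r T * stat e U ζ C T t ω : ℝ) : ℂ)
          = (r T : ℂ) * (A ω * (stat e U ζ C T t ω : ℂ)) := fun ω => by push_cast; ring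
      simp_rw [e1]
      rw [integral_const_mul, h1, mul_zero])
    (fun T t A hA hAb => by
      have h1 := h.integral_bdd_mul_sq_sub T t hA hAb
      have e1 : ∀ ω, A ω * (((r T * stat e U ζ C T t ω : ℝ) : ℂ) ^ 2
          - ((r T ^ 2 * condVar P e U ζ T (fun k => C k T t ω) : ℝ) : ℂ))
          = (r T : ℂ) ^ 2 * (A ω * ((stat e U ζ C T t ω ^ 2
            - condVar P e U ζ T (fun k => C k T t ω) : ℝ) : ℂ)) := fun ω => by push_cast; ring
      simp_rw [e1]
      rw [integral_const_mul, h1, mul_zero])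
    (by
      have hl : Tendsto (fun T => c₀⁻¹ * B3 * r T) atTop (𝓝 0) := by
        simpa using hrl.const_mul (c₀⁻¹ * B3)
      refine squeeze_zero (fun T => Finset.sum_nonneg fun t _ => integral_nonneg fun ω => by
        positivity) (fun T => ?_) hl
      have h1 : ∀ t ∈ Finset.range T, ∫ ω, |r T * stat e U ζ C T t ω| ^ 3 ∂(P T)
          ≤ r T ^ 3 * B3 := fun t _ => by
        simp only [abs_mul, mul_pow, abs_of_nonneg (hr0 T)]
        rw [integral_const_mul]
        refine mul_le_mul_of_nonneg_left ?_ (pow_nonneg (hr0 T) 3)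
        have := hB3 T t
        simpa using this
      refine (Finset.sum_le_sum h1).trans ?_
      rw [Finset.sum_const, Finset.card_range, nsmul_eq_mul]
      calc (T : ℝ) * (r T ^ 3 * B3) = ((T : ℝ) * r T ^ 2) * (B3 * r T) := by ring
        _ ≤ c₀⁻¹ * (B3 * r T) :=
          mul_le_mul_of_nonneg_right (hTr2 T) (mul_nonneg hB30 (hr0 T))
        _ = _ := by ring)
    (by
      have hl : Tendsto (fun T => c₀⁻¹ * B2 * r T ^ 2) atTop (𝓝 0) := by
        simpa using (hrl.pow 2).const_mul (c₀⁻¹ * B2)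
      refine squeeze_zero (fun T => Finset.sum_nonneg fun t _ => integral_nonneg fun ω => by
        positivity) (fun T => ?_) hl
      have h1 : ∀ t ∈ Finset.range T, ∫ ω, (r T ^ 2 * condVar P e U ζ T (fun k => C k T t ω)) ^ 2
          ∂(P T) ≤ r T ^ 4 * B2 := fun t _ => by
        simp only [mul_pow, ← pow_mul]
        rw [integral_const_mul]
        refine mul_le_mul_of_nonneg_left ?_ (pow_nonneg (hr0 T) 4)
        have := hB2 T t
        simpa using this
      refine (Finset.sum_le_sum h1).trans ?_
      rw [Finset.sum_const, Finset.card_range, nsmul_eq_mul]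
      calc (T : ℝ) * (r T ^ 4 * B2) = ((T : ℝ) * r T ^ 2) * (B2 * r T ^ 2) := by ring
        _ ≤ c₀⁻¹ * (B2 * r T ^ 2) :=
          mul_le_mul_of_nonneg_right (hTr2 T) (mul_nonneg hB20 (sq_nonneg _))
        _ = _ := by ring)
    (by
      have h1 : Tendsto (fun q : Σ T, Ω T => (avg q.1 (fun t => condVar P e U ζ q.1
          (fun k => C k q.1 t q.2)) - V q.1) * (V' q.1)⁻¹ + 1) (inProb P) (𝓝 (0 + 1)) := by
        refine Tendsto.add_const 1 (hVl.zero_mul_isBoundedUnder_le ?_)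
        refine isBoundedUnder_of ⟨c₀⁻¹, fun q => ?_⟩
        simp only [Function.comp, norm_inv, Real.norm_of_nonneg (hV'0 q.1).le]
        exact inv_anti₀ hc₀ (hV'c q.1)
      rw [zero_add] at h1
      refine h1.congr' ?_
      filter_upwards [tendsto_fst_inProb.eventually (hVV.and (eventually_gt_atTop 0))] with q hq
      rw [← Finset.mul_sum, hr2, ← hq.1, avg]
      have hT : (q.1 : ℝ) ≠ 0 := Nat.cast_ne_zero.2 hq.2.ne'
      have := (hV'0 q.1).ne'
      field_simp
      ring)
  have hfin := tendsto_measure_abs_le_of_charFun (P := P)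
    (S := fun T ω => ∑ t ∈ Finset.range T, r T * stat e U ζ C T t ω)
    (fun T => (Finset.measurable_sum _ fun t _ => ((h.measurable_stat T t).mono
      ((past (e T) (h.meas T)).le _) le_rfl).const_mul _).aemeasurable) hchar c
  refine hfin.congr' ?_
  filter_upwards [hVV] with T hT
  congr 1
  ext ω
  have : ∑ t ∈ Finset.range T, r T * stat e U ζ C T t ω
      = Real.sqrt T * avg T (fun t => stat e U ζ C T t ω) / Real.sqrt (V T) := by
    have hrT : r T = (Real.sqrt T)⁻¹ * (Real.sqrt (V' T))⁻¹ := by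
      simp only [hr]
      rw [Real.sqrt_mul (Nat.cast_nonneg T), mul_inv]
    rw [sqrt_mul_avg, ← Finset.mul_sum, ← hT, hrT]
    ring
  rw [Set.mem_ofPred_eq, this]
  rfl

/-- The mean square is asymptotic to the same sequence that normalises the central limit theorem.
This makes the variance estimator usable although V need not converge. -/
lemma tendsto_avg_sq (h : LinStat P e U ζ C) {V : ℕ → ℝ}
    (hVl : Tendsto (fun q : Σ T, Ω T => avg q.1 (fun t => condVar P e U ζ q.1
      (fun k => C k q.1 t q.2)) - V q.1) (inProb P) (𝓝 0)) :
    Tendsto (fun q : Σ T, Ω T => avg q.1 (fun t => stat e U ζ C q.1 t q.2 ^ 2) - V q.1)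
      (inProb P) (𝓝 0) := by
  have h1 := h.tendsto_avg_sq_sub_condVar.add hVl
  rw [add_zero] at h1
  refine h1.congr fun q => ?_
  rw [avg_sub]
  ring

end LinStat


/-! ### Sample moments of shocks and of the autoregression -/

section Shocks

variable {N J : ℕ} {Ω : ℕ → Type*} {mΩ : ∀ T, MeasurableSpace (Ω T)} {P : ∀ T, Measure (Ω T)}

/-- Centred instruments and disturbances of a sequence of panel models. -/
structure IsShock (P : ∀ T, Measure (Ω T)) (e : ∀ T, ℕ → Ω T → Shock N J) (b : Fin (J + 1) → ℝ)
    (varZ : ℝ) (δT : ℕ → ℝ) (ST : ℕ → Matrix (Fin N × Fin (J + 1)) (Fin N × Fin (J + 1)) ℝ) :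
    Prop where
  meas : ∀ T t, Measurable (e T t)
  indep : ∀ T, iIndepFun (e T) (P T)
  ident : ∀ T t, IdentDistrib (e T t) (e T 0) (P T) (P T)
  gaussian : ∀ T t, HasGaussianLaw (e T t) (P T)
  mom_z : ∀ i, AllMoments P fun T t ω => (e T t ω i).1
  mom_u : ∀ i a, AllMoments P fun T t ω => (e T t ω i).2 a
  mean_z : ∀ i T t, ∫ ω, (e T t ω i).1 ∂(P T) = 0
  mean_u : ∀ i a T t, ∫ ω, (e T t ω i).2 a ∂(P T) = 0
  cov_u : ∀ i a i' a' T t, ∫ ω, (e T t ω i).2 a * (e T t ω i').2 a' ∂(P T) = ST T (i, a) (i', a')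
  var_z : ∀ i T t, ∫ ω, (e T t ω i).1 ^ 2 ∂(P T) = varZ
  cov_zu : ∀ i a T t, ∫ ω, (e T t ω i).1 * (e T t ω i).2 a ∂(P T) = δT T * b a
  excl : ∀ i i' a T t, ∫ ω, (e T t ω i).1 * ((e T t ω i').2 a - b a * (e T t ω i').2 0) ∂(P T) = 0

/-- A time shift changes an average only by end terms over T. Averaging the autoregressive
recursion, or its outer product, then gives a linear equation for the average itself. -/
lemma avg_succ (T : ℕ) (f : ℕ → ℝ) :
    avg T (fun t => f (t + 1)) = avg T f + (T : ℝ)⁻¹ * (f T - f 0) := by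
  rw [avg, avg, ← Finset.sum_range_sub f T, Finset.sum_sub_distrib]
  ring

lemma OP.at_end [∀ T, IsProbabilityMeasure (P T)] {X : ∀ T, ℕ → Ω T → ℝ} (hX : AllMoments P X) :
    OP P fun q => X q.1 q.1 q.2 := by
  obtain ⟨C, -, hC⟩ := hX.exists_integral_abs_le
  exact OP.of_integral C (fun T => hX.integrable T T) (Eventually.of_forall fun T => hC T T)

lemma tendsto_inv_inProb : Tendsto (fun q : Σ T, Ω T => (q.1 : ℝ)⁻¹) (inProb P) (𝓝 0) :=
  (tendsto_inv_atTop_zero.comp tendsto_natCast_atTop_atTop).comp tendsto_fst_inProb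

namespace IsShock

variable [∀ T, IsProbabilityMeasure (P T)] {e : ∀ T, ℕ → Ω T → Shock N J} {b : Fin (J + 1) → ℝ}
  {varZ : ℝ} {δT : ℕ → ℝ} {ST : ℕ → Matrix (Fin N × Fin (J + 1)) (Fin N × Fin (J + 1)) ℝ}
  {Φ : Matrix (Fin (J + 1)) (Fin (J + 1)) ℝ}

lemma op_u (h : IsShock P e b varZ δT ST) (i : Fin N) (a : Fin (J + 1)) :
    OP P fun q => Real.sqrt q.1 * avg q.1 fun t => (e q.1 t q.2 i).2 a := by
  simpa using op_sqrt_avg_past_mul h.meas h.indep (c := fun _ _ _ => 1)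
    (g := fun _ x => (x i).2 a) (fun _ _ => measurable_const) (AllMoments.const 1)
    (fun _ => by fun_prop) (h.mom_u i a) (h.mean_u i a)

lemma op_z (h : IsShock P e b varZ δT ST) (i : Fin N) :
    OP P fun q => Real.sqrt q.1 * avg q.1 fun t => (e q.1 t q.2 i).1 := by
  simpa using op_sqrt_avg_past_mul h.meas h.indep (c := fun _ _ _ => 1)
    (g := fun _ x => (x i).1) (fun _ _ => measurable_const) (AllMoments.const 1)
    (fun _ => by fun_prop) (h.mom_z i) (h.mean_z i)

lemma op_wu (hΦ : ∀ z ∈ spectrum ℂ (Φ.map (algebraMap ℝ ℂ)), ‖z‖ < 1)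
    (h : IsShock P e b varZ δT ST) (i' : Fin N) (a' : Fin (J + 1)) (i : Fin N)
    (a : Fin (J + 1)) : OP P fun q => Real.sqrt q.1 * avg q.1 fun t =>
      linProc Φ (fun s => e q.1 s q.2) t i' a' * (e q.1 t q.2 i).2 a :=
  op_sqrt_avg_past_mul h.meas h.indep (c := fun T t ω => linProc Φ (fun s => e T s ω) t i' a')
    (g := fun _ x => (x i).2 a) (fun T t => measurable_linProc Φ (h.meas T) t i' a')
    (allMoments_linProc hΦ h.mom_u i' a')
    (fun _ => by fun_prop) (h.mom_u i a) (h.mean_u i a)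

lemma op_wz (hΦ : ∀ z ∈ spectrum ℂ (Φ.map (algebraMap ℝ ℂ)), ‖z‖ < 1)
    (h : IsShock P e b varZ δT ST) (i' : Fin N) (a' : Fin (J + 1)) (i : Fin N) :
    OP P fun q => Real.sqrt q.1 * avg q.1 fun t =>
      linProc Φ (fun s => e q.1 s q.2) t i' a' * (e q.1 t q.2 i).1 :=
  op_sqrt_avg_past_mul h.meas h.indep (c := fun T t ω => linProc Φ (fun s => e T s ω) t i' a')
    (g := fun _ x => (x i).1) (fun T t => measurable_linProc Φ (h.meas T) t i' a')
    (allMoments_linProc hΦ h.mom_u i' a')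
    (fun _ => by fun_prop) (h.mom_z i) (h.mean_z i)

lemma op_w (hΦ : ∀ z ∈ spectrum ℂ (Φ.map (algebraMap ℝ ℂ)), ‖z‖ < 1)
    (h : IsShock P e b varZ δT ST) (i : Fin N) (a : Fin (J + 1)) :
    OP P fun q => Real.sqrt q.1 * avg q.1 fun t => linProc Φ (fun s => e q.1 s q.2) t i a := by
  have hd : ∀ a, OP P fun q : Σ T, Ω T => Real.sqrt q.1 * (avg q.1 (fun t => (e q.1 t q.2 i).2 a))
      + (-1) * ((Real.sqrt q.1)⁻¹ * linProc Φ (fun s => e q.1 s q.2) q.1 i a) := fun a => by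
    refine (h.op_u i a).add (OP.const_mul ?_ (-1))
    exact (OP.of_tendsto tendsto_inv_sqrt_inProb).mul (OP.at_end (allMoments_linProc hΦ h.mom_u i a))
  have hs : OP P fun q : Σ T, Ω T => ∑ a', (1 - Φ)⁻¹ a a' *
      (Real.sqrt q.1 * (avg q.1 (fun t => (e q.1 t q.2 i).2 a'))
      + (-1) * ((Real.sqrt q.1)⁻¹ * linProc Φ (fun s => e q.1 s q.2) q.1 i a')) :=
    OP.sum _ fun a' _ => (hd a').const_mul _
  refine hs.mono fun q => le_of_eq ?_
  congr 1
  set w := linProc Φ (fun s => e q.1 s q.2) with hw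
  set v : Fin (J + 1) → ℝ := fun a => Real.sqrt q.1 * avg q.1 fun t => w t i a with hv
  -- The averaged recursion: (1 - Φ) applied to the mean of w is the mean of u minus the last value
  -- of w over T.
  have h1 : (1 - Φ).mulVec v = fun a' => Real.sqrt q.1 * (avg q.1 (fun t => (e q.1 t q.2 i).2 a'))
      + (-1) * ((Real.sqrt q.1)⁻¹ * w q.1 i a') := by
    ext a'
    have h2 := avg_succ q.1 fun t => w t i a'
    have h3 : avg q.1 (fun t => w (t + 1) i a') = (∑ c, Φ a' c * avg q.1 fun t => w t i c)
        + avg q.1 (fun t => (e q.1 t q.2 i).2 a') := by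
      have : (fun t => w (t + 1) i a') = fun t => (∑ c, Φ a' c * w t i c) + (e q.1 t q.2 i).2 a' :=
        rfl
      rw [this, avg_add, avg_sum]
      simp only [avg_const_mul]
    have hw0 : w 0 i a' = 0 := rfl
    rw [hw0, sub_zero] at h2
    have h4 : Real.sqrt q.1 * (q.1 : ℝ)⁻¹ = (Real.sqrt q.1)⁻¹ := by
      rw [← div_eq_mul_inv, Real.sqrt_div_self', one_div]
    rw [Matrix.sub_mulVec, Matrix.one_mulVec, Pi.sub_apply]
    have h5 : (Φ.mulVec v) a' = Real.sqrt q.1 * ∑ c, Φ a' c * avg q.1 fun t => w t i c := by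
      simp only [Matrix.mulVec, dotProduct, hv, Finset.mul_sum]
      exact Finset.sum_congr rfl fun c _ => by ring
    rw [h5, hv, ← h4]
    simp only
    linear_combination (Real.sqrt q.1) * h3 - (Real.sqrt q.1) * h2
  have h6 : v = (1 - Φ)⁻¹.mulVec ((1 - Φ).mulVec v) := by
    rw [Matrix.mulVec_mulVec, Matrix.nonsing_inv_mul _ (isUnit_one_sub hΦ), Matrix.one_mulVec]
  change v a = _
  rw [h6, h1]
  rfl

lemma tendsto_avg_uu (h : IsShock P e b varZ δT ST)
    {Sig : Matrix (Fin N × Fin (J + 1)) (Fin N × Fin (J + 1)) ℝ} (hST : Tendsto ST atTop (𝓝 Sig))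
    (i : Fin N) (a : Fin (J + 1)) (i' : Fin N) (a' : Fin (J + 1)) :
    Tendsto (fun q : Σ T, Ω T => avg q.1 fun t => (e q.1 t q.2 i).2 a * (e q.1 t q.2 i').2 a')
      (inProb P) (𝓝 (Sig (i, a) (i', a'))) := by
  have hS : Tendsto (fun T => ST T (i, a) (i', a')) atTop (𝓝 (Sig (i, a) (i', a'))) :=
    (tendsto_pi_nhds.1 (tendsto_pi_nhds.1 hST (i, a))) (i', a')
  have hm := (h.mom_u i a).mul (h.mom_u i' a')
  obtain ⟨B, -, hB⟩ := hm.exists_integral_le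
  have hc : AllMoments P fun T (_ : ℕ) (_ : Ω T) => -ST T (i, a) (i', a') :=
    AllMoments.const_of_bdd B fun T t => by rw [abs_neg, ← h.cov_u i a i' a' T t]; exact hB T t
  have h1 := (op_sqrt_avg_past_mul h.meas h.indep (c := fun _ _ _ => 1)
    (g := fun T x => (x i).2 a * (x i').2 a' - ST T (i, a) (i', a')) (fun _ _ => measurable_const)
    (AllMoments.const 1) (fun _ => by fun_prop)
    (by simpa only [sub_eq_add_neg] using hm.add hc)
    (fun T t => by
      rw [integral_sub (hm.integrable T t) (integrable_const _), h.cov_u]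
      simp)).tendsto_of_sqrt_mul
  have h2 := h1.add (hS.comp tendsto_fst_inProb)
  rw [zero_add] at h2
  refine h2.congr' ?_
  filter_upwards [tendsto_fst_inProb.eventually (eventually_gt_atTop 0)] with q hq
  simp only [one_mul, avg_sub, avg_const hq.ne', Function.comp]
  ring

lemma tendsto_avg_zu (h : IsShock P e b varZ δT ST) {δ : ℝ} (hδ : Tendsto δT atTop (𝓝 δ))
    (i : Fin N) (a : Fin (J + 1)) :
    Tendsto (fun q : Σ T, Ω T => avg q.1 fun t => (e q.1 t q.2 i).1 * (e q.1 t q.2 i).2 a)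
      (inProb P) (𝓝 (δ * b a)) := by
  have hm := (h.mom_z i).mul (h.mom_u i a)
  obtain ⟨B, -, hB⟩ := hm.exists_integral_le
  have hc : AllMoments P fun T (_ : ℕ) (_ : Ω T) => -(δT T * b a) :=
    AllMoments.const_of_bdd B fun T t => by rw [abs_neg, ← h.cov_zu i a T t]; exact hB T t
  have h1 := (op_sqrt_avg_past_mul h.meas h.indep (c := fun _ _ _ => 1)
    (g := fun T x => (x i).1 * (x i).2 a - δT T * b a) (fun _ _ => measurable_const)
    (AllMoments.const 1) (fun _ => by fun_prop)
    (by simpa only [sub_eq_add_neg] using hm.add hc)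
    (fun T t => by
      rw [integral_sub (hm.integrable T t) (integrable_const _), h.cov_zu]
      simp)).tendsto_of_sqrt_mul
  have h2 := h1.add ((hδ.mul_const (b a)).comp tendsto_fst_inProb)
  rw [zero_add] at h2
  refine h2.congr' ?_
  filter_upwards [tendsto_fst_inProb.eventually (eventually_gt_atTop 0)] with q hq
  simp only [one_mul, avg_sub, avg_const hq.ne', Function.comp]
  ring

/-- Second moments of the autoregressive process. -/
lemma exists_tendsto_avg_ww (hΦ : ∀ z ∈ spectrum ℂ (Φ.map (algebraMap ℝ ℂ)), ‖z‖ < 1)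
    (h : IsShock P e b varZ δT ST)
    {Sig : Matrix (Fin N × Fin (J + 1)) (Fin N × Fin (J + 1)) ℝ} (hST : Tendsto ST atTop (𝓝 Sig))
    (i i' : Fin N) : ∃ Q : Matrix (Fin (J + 1)) (Fin (J + 1)) ℝ,
      Q = Φ * Q * Φ.transpose + Matrix.of (fun a a' => Sig (i, a) (i', a')) ∧
      ∀ a a', Tendsto (fun q : Σ T, Ω T => avg q.1 fun t =>
        linProc Φ (fun s => e q.1 s q.2) t i a * linProc Φ (fun s => e q.1 s q.2) t i' a')
        (inProb P) (𝓝 (Q a a')) := by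
  obtain ⟨Q, hQ, hlim⟩ := exists_stein_solution hΦ (Matrix.of (fun a a' => Sig (i, a) (i', a')))
  refine ⟨Q, hQ, ?_⟩
  set M : (Σ T, Ω T) → Matrix (Fin (J + 1)) (Fin (J + 1)) ℝ := fun q => Matrix.of fun a a' =>
    avg q.1 fun t => linProc Φ (fun s => e q.1 s q.2) t i a
      * linProc Φ (fun s => e q.1 s q.2) t i' a' with hM
  suffices hMl : Tendsto M (inProb P) (𝓝 Q) from fun a a' =>
    (tendsto_pi_nhds.1 (tendsto_pi_nhds.1 hMl a)) a'
  -- Averaging the product of Φw + u for the two units shows that M - ΦMΦ' consists of lag-shock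
  -- cross moments, which vanish in the limit, the moments of the shocks, and an end term over T.
  refine hlim (tendsto_pi_nhds.2 fun a => tendsto_pi_nhds.2 fun a' => ?_)
  have hend : Tendsto (fun q : Σ T, Ω T => (linProc Φ (fun s => e q.1 s q.2) q.1 i a
      * linProc Φ (fun s => e q.1 s q.2) q.1 i' a') * (q.1 : ℝ)⁻¹) (inProb P) (𝓝 0) :=
    ((OP.at_end (allMoments_linProc hΦ h.mom_u i a)).mul
      (OP.at_end (allMoments_linProc hΦ h.mom_u i' a'))).mul_tendsto tendsto_inv_inProb
  have hlim2 := (((tendsto_finsetSum Finset.univ fun c _ =>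
    ((h.op_wu hΦ i c i' a').tendsto_of_sqrt_mul.const_mul (Φ a c))).add
    (tendsto_finsetSum Finset.univ fun c _ =>
    ((h.op_wu hΦ i' c i a).tendsto_of_sqrt_mul.const_mul (Φ a' c)))).add
    (h.tendsto_avg_uu hST i a i' a')).sub hend
  simp only [mul_zero, Finset.sum_const_zero, zero_add, sub_zero] at hlim2
  refine hlim2.congr fun q => ?_
  set w := linProc Φ (fun s => e q.1 s q.2) with hw
  have h2 := avg_succ q.1 fun t => w t i a * w t i' a'
  have hw0 : w 0 i a = 0 := rfl
  rw [hw0, zero_mul, sub_zero] at h2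
  have h3 : avg q.1 (fun t => w (t + 1) i a * w (t + 1) i' a')
      = (Φ * M q * Φ.transpose) a a'
        + (∑ c, Φ a c * avg q.1 fun t => w t i c * (e q.1 t q.2 i').2 a')
        + (∑ c, Φ a' c * avg q.1 fun t => w t i' c * (e q.1 t q.2 i).2 a)
        + avg q.1 (fun t => (e q.1 t q.2 i).2 a * (e q.1 t q.2 i').2 a') := by
    have e1 : (fun t => w (t + 1) i a * w (t + 1) i' a') = fun t =>
        (∑ c', ∑ c, (Φ a c * Φ a' c') * (w t i c * w t i' c'))
        + (∑ c, Φ a c * (w t i c * (e q.1 t q.2 i').2 a'))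
        + (∑ c, Φ a' c * (w t i' c * (e q.1 t q.2 i).2 a))
        + (e q.1 t q.2 i).2 a * (e q.1 t q.2 i').2 a' := by
      ext t
      have e2 : ∀ j c, w (t + 1) j c = (∑ d, Φ c d * w t j d) + (e q.1 t q.2 j).2 c :=
        fun j c => rfl
      rw [e2, e2, add_mul, mul_add, mul_add, Finset.sum_mul_sum, Finset.sum_comm, Finset.sum_mul,
        Finset.mul_sum]
      have e3 : ∀ c' c, Φ a c * w t i c * (Φ a' c' * w t i' c')
        = (Φ a c * Φ a' c') * (w t i c * w t i' c') := fun c' c => by ring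
      have e4 : ∀ c, Φ a c * w t i c * (e q.1 t q.2 i').2 a'
        = Φ a c * (w t i c * (e q.1 t q.2 i').2 a') := fun c => by ring
      have e5 : ∀ c, (e q.1 t q.2 i).2 a * (Φ a' c * w t i' c)
        = Φ a' c * (w t i' c * (e q.1 t q.2 i).2 a) := fun c => by ring
      simp only [e3, e4, e5]
      ring
    rw [e1]
    simp only [avg_add, avg_sum, avg_const_mul]
    congr 3
    rw [Matrix.mul_apply]
    refine Finset.sum_congr rfl fun c' _ => ?_
    rw [Matrix.mul_apply, Finset.sum_mul]
    refine Finset.sum_congr rfl fun c _ => ?_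
    simp only [hM, Matrix.of_apply, Matrix.transpose_apply]
    ring
  have h4 : M q a a' = avg q.1 fun t => w t i a * w t i' a' := rfl
  rw [Matrix.sub_apply, h4]
  linear_combination h2 - h3

end IsShock

end Shocks


/-- Minimise the form over the compact unit sphere and scale. The norm on functions is the supremum
norm, hence the division by the number of coordinates. -/
lemma exists_quadratic_lower_bound {κ : Type*} [Fintype κ] {M : Matrix κ κ ℝ} (hM : M.PosDef) :
    ∃ c > 0, ∀ v : κ → ℝ, c * ∑ k, v k ^ 2 ≤ ∑ k, ∑ l, v k * v l * M k l := by
  have hform : ∀ v : κ → ℝ, ∑ k, ∑ l, v k * v l * M k l = v ⬝ᵥ M.mulVec v := fun v => by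
    simp only [dotProduct, Matrix.mulVec, Finset.mul_sum]
    exact Finset.sum_congr rfl fun k _ => Finset.sum_congr rfl fun l _ => by ring
  simp only [hform]
  rcases isEmpty_or_nonempty κ with hκ | hκ
  · exact ⟨1, one_pos, fun v => by simp⟩
  have hcont : Continuous fun v : κ → ℝ => v ⬝ᵥ M.mulVec v := by
    simp only [dotProduct, Matrix.mulVec]
    fun_prop
  obtain ⟨v₀, hv₀, hmin⟩ := (isCompact_sphere (0 : κ → ℝ) 1).exists_isMinOn
    (NormedSpace.sphere_nonempty.2 zero_le_one) hcont.continuousOn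
  have hv₀0 : v₀ ≠ 0 := fun h => by simp [h] at hv₀
  have hm : 0 < v₀ ⬝ᵥ M.mulVec v₀ := by simpa using hM.dotProduct_mulVec_pos hv₀0
  set m := v₀ ⬝ᵥ M.mulVec v₀ with hmdef
  have hcard : (0 : ℝ) < Fintype.card κ := Nat.cast_pos.2 Fintype.card_pos
  refine ⟨m / Fintype.card κ, by positivity, fun v => ?_⟩
  have h1 : ∑ k, v k ^ 2 ≤ Fintype.card κ * ‖v‖ ^ 2 := by
    calc ∑ k, v k ^ 2 ≤ ∑ _k : κ, ‖v‖ ^ 2 := Finset.sum_le_sum fun k _ => by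
          rw [← sq_abs, ← Real.norm_eq_abs]
          exact pow_le_pow_left₀ (norm_nonneg _) (norm_le_pi_norm v k) 2
      _ = _ := by simp
  have h2 : m * ‖v‖ ^ 2 ≤ v ⬝ᵥ M.mulVec v := by
    by_cases hv : v = 0
    · simp [hv]
    have hvn : 0 < ‖v‖ := norm_pos_iff.2 hv
    have h3 : ‖v‖⁻¹ • v ∈ Metric.sphere (0 : κ → ℝ) 1 := by
      simp [norm_smul, hvn.ne']
    have h4 : m ≤ (‖v‖⁻¹ • v) ⬝ᵥ M.mulVec (‖v‖⁻¹ • v) := hmin h3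
    rw [Matrix.mulVec_smul, dotProduct_smul, smul_dotProduct, smul_eq_mul, smul_eq_mul] at h4
    have h5 : ‖v‖ ^ 2 * (‖v‖⁻¹ * (‖v‖⁻¹ * (v ⬝ᵥ M.mulVec v))) = v ⬝ᵥ M.mulVec v := by
      field_simp
    nlinarith [mul_le_mul_of_nonneg_left h4 (sq_nonneg ‖v‖)]
  calc m / Fintype.card κ * ∑ k, v k ^ 2 ≤ m / Fintype.card κ * (Fintype.card κ * ‖v‖ ^ 2) :=
        mul_le_mul_of_nonneg_left h1 (by positivity)
    _ = m * ‖v‖ ^ 2 := by field_simp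
    _ ≤ _ := h2

/-! ### The instrument part of the linearised statistic -/

section Shocks

variable {N J : ℕ} {Ω : ℕ → Type*} {mΩ : ∀ T, MeasurableSpace (Ω T)} {P : ∀ T, Measure (Ω T)}

/-- The contribution of the instruments to the linearised statistic. -/
noncomputable def instrTerm (N : ℕ) {J : ℕ} (d : Fin (J + 1) → ℝ) (x : Shock N J) : ℝ :=
  (N : ℝ)⁻¹ * ∑ i, (x i).1 * ∑ a, d a * (x i).2 a

/-- The coefficients of the disturbances in the linearised statistic. -/
def lagCoef (Φ A : Matrix (Fin (J + 1)) (Fin (J + 1)) ℝ) (e : ∀ T, ℕ → Ω T → Shock N J)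
    (k : Fin N × Fin (J + 1)) (T t : ℕ) (ω : Ω T) : ℝ :=
  ∑ a', A k.2 a' * linProc Φ (fun s => e T s ω) t k.1 a'

/-- The disturbances as coordinates of the shock. -/
def disturbance (k : Fin N × Fin (J + 1)) (x : Shock N J) : ℝ := (x k.1).2 k.2

lemma measurable_instrTerm (d : Fin (J + 1) → ℝ) : Measurable (instrTerm N d) := by
  unfold instrTerm
  fun_prop

namespace IsShock

variable [∀ T, IsProbabilityMeasure (P T)] {e : ∀ T, ℕ → Ω T → Shock N J} {b : Fin (J + 1) → ℝ}
  {varZ : ℝ} {δT : ℕ → ℝ} {ST : ℕ → Matrix (Fin N × Fin (J + 1)) (Fin N × Fin (J + 1)) ℝ}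
  {Φ : Matrix (Fin (J + 1)) (Fin (J + 1)) ℝ}

lemma mom_du (h : IsShock P e b varZ δT ST) (d : Fin (J + 1) → ℝ) (i : Fin N) :
    AllMoments P fun T t ω => ∑ a, d a * (e T t ω i).2 a :=
  AllMoments.sum _ fun a _ => (h.mom_u i a).const_mul (d a)

/-- Since d'b = 0, d'u equals d'(u - b u₀), a combination of second-stage errors, so exclusion
applies for any strength of the instruments. -/
lemma integral_z_mul_du (h : IsShock P e b varZ δT ST) {d : Fin (J + 1) → ℝ}
    (hd : ∑ a, d a * b a = 0) (i i' : Fin N) (T t : ℕ) :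
    ∫ ω, (e T t ω i).1 * ∑ a, d a * (e T t ω i').2 a ∂(P T) = 0 := by
  have e1 : ∀ ω, (e T t ω i).1 * ∑ a, d a * (e T t ω i').2 a
      = ∑ a, d a * ((e T t ω i).1 * ((e T t ω i').2 a - b a * (e T t ω i').2 0)) := fun ω => by
    have e2 : ∑ a, d a * (b a * (e T t ω i').2 0) = 0 := by
      simp only [← mul_assoc]
      rw [← Finset.sum_mul, hd, zero_mul]
    have e3 : ∑ a, d a * (e T t ω i').2 a
        = ∑ a, d a * ((e T t ω i').2 a - b a * (e T t ω i').2 0) := by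
      simp only [mul_sub, Finset.sum_sub_distrib, e2, sub_zero]
    rw [e3, Finset.mul_sum]
    exact Finset.sum_congr rfl fun a _ => by ring
  simp_rw [e1]
  have hm : ∀ a, AllMoments P fun T t ω =>
      (e T t ω i).1 * ((e T t ω i').2 a - b a * (e T t ω i').2 0) := fun a => by
    have := (h.mom_z i).mul ((h.mom_u i' a).add ((h.mom_u i' 0).const_mul (-b a)))
    simpa only [neg_mul, ← sub_eq_add_neg] using this
  rw [integral_finsetSum _ fun a _ => ((hm a).integrable T t).const_mul _]
  refine Finset.sum_eq_zero fun a _ => ?_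
  rw [integral_const_mul, h.excl, mul_zero]

lemma linStat (h : IsShock P e b varZ δT ST)
    (hΦ : ∀ z ∈ spectrum ℂ (Φ.map (algebraMap ℝ ℂ)), ‖z‖ < 1)
    (A : Matrix (Fin (J + 1)) (Fin (J + 1)) ℝ) {d : Fin (J + 1) → ℝ}
    (hd : ∑ a, d a * b a = 0) :
    LinStat P e disturbance (instrTerm N d) (lagCoef Φ A e) where
  meas := h.meas
  indep := h.indep
  ident := h.ident
  measU k := by unfold disturbance; fun_prop
  measζ := measurable_instrTerm d
  momU k := h.mom_u k.1 k.2
  momζ := (AllMoments.sum _ fun i _ => (h.mom_z i).mul (h.mom_du d i)).const_mul _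
  meanU k := h.mean_u k.1 k.2
  meanζ T t := by
    simp only [instrTerm]
    rw [integral_const_mul, integral_finsetSum _ fun i _ =>
      ((h.mom_z i).mul (h.mom_du d i)).integrable T t,
      Finset.sum_eq_zero fun i _ => h.integral_z_mul_du hd i i T t, mul_zero]
  pastC k T t := Finset.measurable_sum _ fun a' _ =>
    (measurable_linProc Φ (h.meas T) t k.1 a').const_mul _
  momC k := AllMoments.sum _ fun a' _ => (allMoments_linProc hΦ h.mom_u k.1 a').const_mul _

/-- Instruments are independent of the second-stage errors. -/
lemma indepFun_z_du (h : IsShock P e b varZ δT ST) {d : Fin (J + 1) → ℝ}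
    (hd : ∑ a, d a * b a = 0) (T t : ℕ) :
    IndepFun (fun ω i => (e T t ω i).1) (fun ω i => ∑ a, d a * (e T t ω i).2 a) (P T) := by
  have hL : Continuous fun x : Shock N J =>
      ((fun i => (x i).1 : Fin N → ℝ), (fun i => ∑ a, d a * (x i).2 a : Fin N → ℝ)) := by fun_prop
  let L : Shock N J →L[ℝ] (Fin N → ℝ) × (Fin N → ℝ) :=
    { toFun := fun x => (fun i => (x i).1, fun i => ∑ a, d a * (x i).2 a)
      map_add' := fun x y => by
        ext i
        · simp
        · simp [mul_add, Finset.sum_add_distrib]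
      map_smul' := fun c x => by
        ext i
        · simp
        · simp only [Pi.smul_apply, Prod.smul_snd, smul_eq_mul, RingHom.id_apply, Finset.mul_sum]
          exact Finset.sum_congr rfl fun a _ => by ring
      cont := hL }
  -- Jointly Gaussian vectors with vanishing cross covariances are independent. Exclusion is needed
  -- here across different units as well.
  refine HasGaussianLaw.indepFun_of_covariance_eval (X := fun i ω => (e T t ω i).1)
    (Y := fun i ω => ∑ a, d a * (e T t ω i).2 a) ((h.gaussian T t).map_fun L) fun i j => ?_
  rw [covariance_eq_sub (by simpa using (h.mom_z i).memLp 2 T t)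
    (by simpa using (h.mom_du d j).memLp 2 T t)]
  have h1 := h.integral_z_mul_du hd i j T t
  simp only [Pi.mul_apply]
  rw [h1, h.mean_z, zero_mul, sub_zero]

/-- Independence splits the fourth-order moment into the instrument covariance and a quadratic form
of the disturbance covariance, so dependent units are allowed. -/
lemma integral_zz_dudu (h : IsShock P e b varZ δT ST) {d : Fin (J + 1) → ℝ}
    (hd : ∑ a, d a * b a = 0) (i i' : Fin N) (T t : ℕ) :
    ∫ ω, ((e T t ω i).1 * (e T t ω i').1) *
        ((∑ a, d a * (e T t ω i).2 a) * ∑ a, d a * (e T t ω i').2 a) ∂(P T)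
      = (∫ ω, (e T t ω i).1 * (e T t ω i').1 ∂(P T)) *
        ∑ a, ∑ a', d a * d a' * ST T (i, a) (i', a') := by
  have hm1 : Measurable fun z : Fin N → ℝ => z i * z i' := by fun_prop
  have h1 := ((h.indepFun_z_du hd T t).comp hm1 hm1).integral_fun_mul_eq_mul_integral
    (((h.mom_z i).mul (h.mom_z i')).aesm T t) (((h.mom_du d i).mul (h.mom_du d i')).aesm T t)
  refine h1.trans ?_
  congr 1
  have e1 : ∀ ω, ((fun z : Fin N → ℝ => z i * z i') ∘ fun ω i => ∑ a, d a * (e T t ω i).2 a) ω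
      = ∑ a, ∑ a', d a * d a' * ((e T t ω i).2 a * (e T t ω i').2 a') := fun ω => by
    simp only [Function.comp]
    rw [Finset.sum_mul_sum]
    exact Finset.sum_congr rfl fun a _ => Finset.sum_congr rfl fun a' _ => by ring
  simp_rw [e1]
  have hi : ∀ a a', Integrable
      (fun ω => d a * d a' * ((e T t ω i).2 a * (e T t ω i').2 a')) (P T) := fun a a' =>
    (((h.mom_u i a).mul (h.mom_u i' a')).integrable T t).const_mul _
  rw [integral_finsetSum _ fun a _ => integrable_finsetSum _ fun a' _ => hi a a']
  refine Finset.sum_congr rfl fun a _ => ?_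
  rw [integral_finsetSum _ fun a' _ => hi a a']
  refine Finset.sum_congr rfl fun a' _ => ?_
  rw [integral_const_mul, h.cov_u]

/-- Without instrument relevance, the instrument contribution still has a variance that is bounded
away from `0`. -/
lemma exists_le_integral_instrTerm_sq (h : IsShock P e b varZ δT ST) (hN : 0 < N)
    (hvarZ : 0 < varZ) {Sig : Matrix (Fin N × Fin (J + 1)) (Fin N × Fin (J + 1)) ℝ}
    (hST : Tendsto ST atTop (𝓝 Sig)) (hpos : Sig.PosDef) {d : Fin (J + 1) → ℝ}
    (hd : ∑ a, d a * b a = 0) (hd0 : d ≠ 0) :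
    ∃ c > 0, ∀ᶠ T in atTop, c ≤ ∫ ω, instrTerm N d (e T 0 ω) ^ 2 ∂(P T) := by
  obtain ⟨c, hc, hquad⟩ := exists_quadratic_lower_bound hpos
  set D : ℝ := ∑ a, d a ^ 2 with hD
  have hD0 : 0 < D := by
    obtain ⟨a, ha⟩ := Function.ne_iff.1 hd0
    exact Finset.sum_pos' (fun a _ => sq_nonneg _) ⟨a, Finset.mem_univ a, by
      have : d a ≠ 0 := ha
      positivity⟩
  set g : Matrix (Fin N × Fin (J + 1)) (Fin N × Fin (J + 1)) ℝ → Fin N → Fin N → ℝ :=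
    fun S i i' => ∑ a, ∑ a', d a * d a' * S (i, a) (i', a') with hg
  set zz : ℕ → Fin N → Fin N → ℝ := fun T i i' => ∫ ω, (e T 0 ω i).1 * (e T 0 ω i').1 ∂(P T) with hzz
  have hform : ∀ T, ∫ ω, instrTerm N d (e T 0 ω) ^ 2 ∂(P T)
      = ((N : ℝ)⁻¹) ^ 2 * ∑ i, ∑ i', zz T i i' * g (ST T) i i' := fun T => by
    have e1 : ∀ ω, instrTerm N d (e T 0 ω) ^ 2 = ((N : ℝ)⁻¹) ^ 2 * ∑ i, ∑ i',
        ((e T 0 ω i).1 * (e T 0 ω i').1) *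
        ((∑ a, d a * (e T 0 ω i).2 a) * ∑ a, d a * (e T 0 ω i').2 a) := fun ω => by
      rw [instrTerm, mul_pow, sq (∑ i, _), Finset.sum_mul_sum]
      congr 1
      exact Finset.sum_congr rfl fun i _ => Finset.sum_congr rfl fun i' _ => by ring
    simp_rw [e1]
    have hi : ∀ i i', Integrable (fun ω => ((e T 0 ω i).1 * (e T 0 ω i').1) *
        ((∑ a, d a * (e T 0 ω i).2 a) * ∑ a, d a * (e T 0 ω i').2 a)) (P T) := fun i i' =>
      (((h.mom_z i).mul (h.mom_z i')).mul ((h.mom_du d i).mul (h.mom_du d i'))).integrable T 0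
    rw [integral_const_mul, integral_finsetSum _ fun i _ => integrable_finsetSum _ fun i' _ => hi i i']
    congr 1
    refine Finset.sum_congr rfl fun i _ => ?_
    rw [integral_finsetSum _ fun i' _ => hi i i']
    exact Finset.sum_congr rfl fun i' _ => h.integral_zz_dudu hd i i' T 0
  -- The bound is proved with the limit Σ in place of the covariance at T; the instrument
  -- covariances stay as they are because they are bounded but need not converge.
  have hlow : ∀ T, c * D * (N * varZ) ≤ ∑ i, ∑ i', zz T i i' * g Sig i i' := fun T => by
    have hi : ∀ i i', Integrable (fun ω => ((e T 0 ω i).1 * (e T 0 ω i').1) * g Sig i i') (P T) :=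
      fun i i' => (((h.mom_z i).mul (h.mom_z i')).integrable T 0).mul_const _
    have hi2 : ∀ i, Integrable (fun ω => (e T 0 ω i).1 ^ 2) (P T) := fun i =>
      ((h.mom_z i).pow 2).integrable T 0
    have e1 : ∑ i, ∑ i', zz T i i' * g Sig i i'
        = ∫ ω, ∑ i, ∑ i', ((e T 0 ω i).1 * (e T 0 ω i').1) * g Sig i i' ∂(P T) := by
      rw [integral_finsetSum _ fun i _ => integrable_finsetSum _ fun i' _ => hi i i']
      refine Finset.sum_congr rfl fun i _ => ?_
      rw [integral_finsetSum _ fun i' _ => hi i i']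
      exact Finset.sum_congr rfl fun i' _ => (integral_mul_const _ _).symm
    have e2 : c * D * (N * varZ) = ∫ ω, c * D * ∑ i, (e T 0 ω i).1 ^ 2 ∂(P T) := by
      rw [integral_const_mul, integral_finsetSum _ fun i _ => hi2 i]
      simp [h.var_z]
    rw [e1, e2]
    refine integral_mono ((integrable_finsetSum _ fun i _ => hi2 i).const_mul _)
      (integrable_finsetSum _ fun i _ => integrable_finsetSum _ fun i' _ => hi i i') fun ω => ?_
    -- The form Σ is evaluated at the random vector z ⊗ d, whose expected squared length is N · var
    -- Z · |d|².
    have hq := hquad fun k => (e T 0 ω k.1).1 * d k.2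
    have e3 : ∑ k : Fin N × Fin (J + 1), ((e T 0 ω k.1).1 * d k.2) ^ 2
        = D * ∑ i, (e T 0 ω i).1 ^ 2 := by
      rw [Fintype.sum_prod_type, hD, mul_comm, Finset.sum_mul_sum]
      exact Finset.sum_congr rfl fun i _ => Finset.sum_congr rfl fun a _ => by ring
    have e4 : ∑ k : Fin N × Fin (J + 1), ∑ l : Fin N × Fin (J + 1),
        (e T 0 ω k.1).1 * d k.2 * ((e T 0 ω l.1).1 * d l.2) * Sig k l
        = ∑ i, ∑ i', ((e T 0 ω i).1 * (e T 0 ω i').1) * g Sig i i' := by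
      simp only [Fintype.sum_prod_type, hg, Finset.mul_sum]
      refine Finset.sum_congr rfl fun i _ => ?_
      rw [Finset.sum_comm]
      exact Finset.sum_congr rfl fun i' _ => Finset.sum_congr rfl fun a _ =>
        Finset.sum_congr rfl fun a' _ => by ring
    rw [e3, e4] at hq
    simpa only [mul_assoc] using hq
  have hdiff : Tendsto (fun T => ∑ i, ∑ i', zz T i i' * (g (ST T) i i' - g Sig i i')) atTop
      (𝓝 0) := by
    have : Tendsto (fun T => ∑ i, ∑ i', zz T i i' * (g (ST T) i i' - g Sig i i')) atTop
        (𝓝 (∑ _i : Fin N, ∑ _i' : Fin N, 0)) := by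
      refine tendsto_finsetSum _ fun i _ => tendsto_finsetSum _ fun i' _ => ?_
      obtain ⟨B, -, hB⟩ := ((h.mom_z i).mul (h.mom_z i')).exists_integral_le
      have hgl : Tendsto (fun T => g (ST T) i i' - g Sig i i') atTop (𝓝 0) := by
        rw [tendsto_sub_nhds_zero_iff]
        refine tendsto_finsetSum _ fun a _ => tendsto_finsetSum _ fun a' _ => ?_
        exact ((tendsto_pi_nhds.1 (tendsto_pi_nhds.1 hST (i, a))) (i', a')).const_mul _
      exact isBoundedUnder_le_mul_tendsto_zero (isBoundedUnder_of ⟨B, fun T => hB T 0⟩) hgl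
    simpa using this
  have hN' : (0 : ℝ) < N := Nat.cast_pos.2 hN
  have hpos' : 0 < c * D * (N * varZ) := by positivity
  refine ⟨((N : ℝ)⁻¹) ^ 2 * (c * D * (N * varZ) / 2), by positivity, ?_⟩
  filter_upwards [hdiff.eventually_const_lt (show -(c * D * (N * varZ) / 2) < 0 by linarith)]
    with T hT
  rw [hform]
  refine mul_le_mul_of_nonneg_left ?_ (by positivity)
  have h1 := hlow T
  simp only [mul_sub, Finset.sum_sub_distrib] at hT
  linarith

end IsShock

end Shocks


/-! ### The asymptotic variance and its positivity -/

section Variance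

variable {N J : ℕ} {Ω : ℕ → Type*} {mΩ : ∀ T, MeasurableSpace (Ω T)} {P : ∀ T, Measure (Ω T)}

/-- `Q` collects the limits in probability of the sample second moments of the autoregressive
process. -/
structure IsSecondMoment (P : ∀ T, Measure (Ω T)) (e : ∀ T, ℕ → Ω T → Shock N J)
    (Φ : Matrix (Fin (J + 1)) (Fin (J + 1)) ℝ)
    (Sig : Matrix (Fin N × Fin (J + 1)) (Fin N × Fin (J + 1)) ℝ)
    (Q : Fin N → Fin N → Matrix (Fin (J + 1)) (Fin (J + 1)) ℝ) : Prop where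
  stein : ∀ i i', Q i i' = Φ * Q i i' * Φ.transpose + Matrix.of (fun a a' => Sig (i, a) (i', a'))
  tendsto : ∀ i i' a a', Tendsto (fun q : Σ T, Ω T => avg q.1 fun t =>
    linProc Φ (fun s => e q.1 s q.2) t i a * linProc Φ (fun s => e q.1 s q.2) t i' a')
    (inProb P) (𝓝 (Q i i' a a'))

/-- The part of the asymptotic variance that is due to the estimation of `Φ`. -/
noncomputable def slopeVar (A : Matrix (Fin (J + 1)) (Fin (J + 1)) ℝ)
    (Q : Fin N → Fin N → Matrix (Fin (J + 1)) (Fin (J + 1)) ℝ)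
    (Sig : Matrix (Fin N × Fin (J + 1)) (Fin N × Fin (J + 1)) ℝ) : ℝ :=
  ∑ k : Fin N × Fin (J + 1), ∑ l : Fin N × Fin (J + 1),
    (∑ a, ∑ a', (A k.2 a * A l.2 a') * Q k.1 l.1 a a') * Sig k l

variable {e : ∀ T, ℕ → Ω T → Shock N J} {b : Fin (J + 1) → ℝ}
  {varZ : ℝ} {δT : ℕ → ℝ} {ST : ℕ → Matrix (Fin N × Fin (J + 1)) (Fin N × Fin (J + 1)) ℝ}
  {Φ : Matrix (Fin (J + 1)) (Fin (J + 1)) ℝ}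
  {Sig : Matrix (Fin N × Fin (J + 1)) (Fin N × Fin (J + 1)) ℝ}
  {Q : Fin N → Fin N → Matrix (Fin (J + 1)) (Fin (J + 1)) ℝ}

namespace IsSecondMoment

lemma tendsto_lagCoef (hQ : IsSecondMoment P e Φ Sig Q)
    (A : Matrix (Fin (J + 1)) (Fin (J + 1)) ℝ) (k l : Fin N × Fin (J + 1)) :
    Tendsto (fun q : Σ T, Ω T => avg q.1 fun t =>
      lagCoef Φ A e k q.1 t q.2 * lagCoef Φ A e l q.1 t q.2) (inProb P)
      (𝓝 (∑ a, ∑ a', (A k.2 a * A l.2 a') * Q k.1 l.1 a a')) := by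
  have h := tendsto_finsetSum Finset.univ fun a _ => tendsto_finsetSum Finset.univ fun a' _ =>
    (hQ.tendsto k.1 l.1 a a').const_mul (A k.2 a * A l.2 a')
  refine h.congr fun q => ?_
  simp only [← avg_const_mul, ← avg_sum]
  congr 1
  ext t
  simp only [lagCoef]
  rw [Finset.sum_mul_sum]
  exact Finset.sum_congr rfl fun a _ => Finset.sum_congr rfl fun a' _ => by ring

/-- The form is the limit of averages of the squares (y'w_i)². A coefficient matrix all of whose
rows are y produces y'w_i as a lag coefficient. -/
lemma quadratic_nonneg [∀ T, IsProbabilityMeasure (P T)] (hQ : IsSecondMoment P e Φ Sig Q)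
    (i : Fin N) (y : Fin (J + 1) → ℝ) : 0 ≤ ∑ a, ∑ a', (y a * y a') * Q i i a a' := by
  have h := hQ.tendsto_lagCoef (Matrix.of fun _ a => y a) (i, 0) (i, 0)
  refine ge_of_tendsto' h fun q => avg_nonneg fun t => mul_self_nonneg _

/-- In the Stein equation the term ΦQΦ' is positive semidefinite, so Q dominates the disturbance
covariance of unit i. That block is bounded below by testing Σ on vectors supported on unit i. -/
lemma quadratic_ge [∀ T, IsProbabilityMeasure (P T)] (hQ : IsSecondMoment P e Φ Sig Q) {c : ℝ}
    (hc : ∀ v : Fin N × Fin (J + 1) → ℝ, c * ∑ k, v k ^ 2 ≤ ∑ k, ∑ l, v k * v l * Sig k l)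
    (i : Fin N) (y : Fin (J + 1) → ℝ) :
    c * ∑ a, y a ^ 2 ≤ ∑ a, ∑ a', (y a * y a') * Q i i a a' := by
  classical
  have hform : ∀ (x : Fin (J + 1) → ℝ) (M : Matrix (Fin (J + 1)) (Fin (J + 1)) ℝ),
      ∑ a, ∑ a', (x a * x a') * M a a' = x ⬝ᵥ M.mulVec x := fun x M => by
    simp only [dotProduct, Matrix.mulVec, Finset.mul_sum]
    exact Finset.sum_congr rfl fun k _ => Finset.sum_congr rfl fun l _ => by ring
  have h1 := hc fun k => if k.1 = i then y k.2 else 0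
  have e1 : ∑ k : Fin N × Fin (J + 1), (if k.1 = i then y k.2 else 0) ^ 2 = ∑ a, y a ^ 2 := by
    rw [Fintype.sum_prod_type, Finset.sum_eq_single i]
    · simp
    · intro j _ hj; simp [hj]
    · simp
  have e2 : ∑ k : Fin N × Fin (J + 1), ∑ l : Fin N × Fin (J + 1),
      (if k.1 = i then y k.2 else 0) * (if l.1 = i then y l.2 else 0) * Sig k l
      = ∑ a, ∑ a', (y a * y a') * Sig (i, a) (i, a') := by
    rw [Fintype.sum_prod_type, Finset.sum_eq_single i]
    · refine Finset.sum_congr rfl fun a _ => ?_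
      rw [Fintype.sum_prod_type, Finset.sum_eq_single i]
      · simp
      · intro j _ hj; simp [hj]
      · simp
    · intro j _ hj; simp [hj]
    · simp
  rw [e1, e2] at h1
  refine h1.trans ?_
  have h2 := hQ.quadratic_nonneg i (Φ.transpose.mulVec y)
  rw [hform] at h2 ⊢
  have h3 : y ⬝ᵥ (Q i i).mulVec y = (Φ.transpose.mulVec y) ⬝ᵥ (Q i i).mulVec (Φ.transpose.mulVec y)
      + ∑ a, ∑ a', (y a * y a') * Sig (i, a) (i, a') := by
    have e3 := hform y (Matrix.of (fun a a' => Sig (i, a) (i, a')))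
    simp only [Matrix.of_apply] at e3
    rw [e3]
    conv_lhs => rw [hQ.stein i i, Matrix.add_mulVec, dotProduct_add]
    congr 1
    rw [← Matrix.mulVec_mulVec, ← Matrix.mulVec_mulVec, Matrix.dotProduct_mulVec,
      ← Matrix.mulVec_transpose]
  linarith

/-- Each Q_ii dominates a fixed multiple of the identity, so no nonzero vector lies in the kernel of
their sum. This is the limiting Gram matrix. -/
lemma isUnit_det_sum [∀ T, IsProbabilityMeasure (P T)] (hQ : IsSecondMoment P e Φ Sig Q)
    (hN : 0 < N) (hpos : Sig.PosDef) : IsUnit (∑ i, Q i i).det := by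
  obtain ⟨c, hc, hquad⟩ := exists_quadratic_lower_bound hpos
  rw [isUnit_iff_ne_zero]
  intro h0
  obtain ⟨v, hv0, hv⟩ := Matrix.exists_mulVec_eq_zero_iff.2 h0
  have h1 : ∀ i, c * ∑ a, v a ^ 2 ≤ v ⬝ᵥ (Q i i).mulVec v := fun i => by
    refine (hQ.quadratic_ge hquad i v).trans (le_of_eq ?_)
    simp only [dotProduct, Matrix.mulVec, Finset.mul_sum]
    exact Finset.sum_congr rfl fun k _ => Finset.sum_congr rfl fun l _ => by ring
  have h2 : ∑ i, v ⬝ᵥ (Q i i).mulVec v = 0 := by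
    rw [← dotProduct_sum, ← Matrix.sum_mulVec, hv, dotProduct_zero]
  obtain ⟨a, ha⟩ := Function.ne_iff.1 hv0
  have ha' : v a ≠ 0 := ha
  have h3 : 0 < ∑ a, v a ^ 2 :=
    Finset.sum_pos' (fun a _ => sq_nonneg _) ⟨a, Finset.mem_univ a, by positivity⟩
  have h4 := Finset.sum_le_sum fun i (_ : i ∈ Finset.univ) => h1 i
  rw [h2, Finset.sum_const, Finset.card_univ, Fintype.card_fin, nsmul_eq_mul] at h4
  have : 0 < (N : ℝ) * (c * ∑ a, v a ^ 2) := by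
    have : (0 : ℝ) < N := Nat.cast_pos.2 hN
    positivity
  linarith

/-- `slopeVar` is the limit of time averages of the form Σ at the vector of lag coefficients. The
lower bound of Σ applies to each summand, and the lower bound of Q to the limits of the averaged
squares. -/
lemma slopeVar_ge [∀ T, IsProbabilityMeasure (P T)] (hQ : IsSecondMoment P e Φ Sig Q) {c : ℝ}
    (hc0 : 0 ≤ c)
    (hc : ∀ v : Fin N × Fin (J + 1) → ℝ, c * ∑ k, v k ^ 2 ≤ ∑ k, ∑ l, v k * v l * Sig k l)
    (A : Matrix (Fin (J + 1)) (Fin (J + 1)) ℝ) :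
    c * ∑ k : Fin N × Fin (J + 1), c * ∑ a, A k.2 a ^ 2 ≤ slopeVar A Q Sig := by
  have h1 : Tendsto (fun q : Σ T, Ω T => ∑ k, ∑ l, (avg q.1 fun t =>
      lagCoef Φ A e k q.1 t q.2 * lagCoef Φ A e l q.1 t q.2) * Sig k l) (inProb P)
      (𝓝 (slopeVar A Q Sig)) :=
    tendsto_finsetSum _ fun k _ => tendsto_finsetSum _ fun l _ =>
      (hQ.tendsto_lagCoef A k l).mul_const _
  have h2 : Tendsto (fun q : Σ T, Ω T => c * ∑ k, avg q.1 fun t =>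
      lagCoef Φ A e k q.1 t q.2 * lagCoef Φ A e k q.1 t q.2) (inProb P)
      (𝓝 (c * ∑ k : Fin N × Fin (J + 1), ∑ a, ∑ a', (A k.2 a * A k.2 a') * Q k.1 k.1 a a')) :=
    (tendsto_finsetSum _ fun k _ => hQ.tendsto_lagCoef A k k).const_mul c
  refine le_trans ?_ (le_of_tendsto_of_tendsto' h2 h1 fun q => ?_)
  · exact mul_le_mul_of_nonneg_left (Finset.sum_le_sum fun k _ => hQ.quadratic_ge hc k.1 _) hc0
  · simp only [← avg_mul_const, ← avg_sum, ← avg_const_mul]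
    refine avg_mono fun t => ?_
    have := hc fun k => lagCoef Φ A e k q.1 t q.2
    simpa only [sq] using this

/-- The limits of the conditional variances. -/
lemma tendsto_condVar [∀ T, IsProbabilityMeasure (P T)] (hQ : IsSecondMoment P e Φ Sig Q)
    (h : IsShock P e b varZ δT ST)
    (hΦ : ∀ z ∈ spectrum ℂ (Φ.map (algebraMap ℝ ℂ)), ‖z‖ < 1) (hST : Tendsto ST atTop (𝓝 Sig))
    (A : Matrix (Fin (J + 1)) (Fin (J + 1)) ℝ) {d : Fin (J + 1) → ℝ}
    (hd : ∑ a, d a * b a = 0) :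
    Tendsto (fun q : Σ T, Ω T => avg q.1 (fun t => LinStat.condVar P e disturbance (instrTerm N d) q.1
      (fun k => lagCoef Φ A e k q.1 t q.2))
      - (slopeVar A Q Sig + ∫ ω, instrTerm N d (e q.1 0 ω) ^ 2 ∂(P q.1))) (inProb P) (𝓝 0) := by
  have hl := h.linStat hΦ A hd
  have hSk : ∀ k l, Tendsto (fun q : Σ T, Ω T => ST q.1 k l) (inProb P) (𝓝 (Sig k l)) := fun k l =>
    ((tendsto_pi_nhds.1 (tendsto_pi_nhds.1 hST k)) l).comp tendsto_fst_inProb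
  have h1 : Tendsto (fun q : Σ T, Ω T => ∑ k, ∑ l, (avg q.1 fun t =>
      lagCoef Φ A e k q.1 t q.2 * lagCoef Φ A e l q.1 t q.2) * ST q.1 k l) (inProb P)
      (𝓝 (slopeVar A Q Sig)) :=
    tendsto_finsetSum _ fun k _ => tendsto_finsetSum _ fun l _ =>
      (hQ.tendsto_lagCoef A k l).mul (hSk k l)
  -- The conditional covariance of the slope and instrument parts averages out: the lag coefficients
  -- are linear in w, whose mean tends to 0, and the moments multiplying them are bounded.
  have h2 : ∀ k, Tendsto (fun q : Σ T, Ω T => (avg q.1 fun t => lagCoef Φ A e k q.1 t q.2) *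
      ∫ ω, disturbance k (e q.1 0 ω) * instrTerm N d (e q.1 0 ω) ∂(P q.1)) (inProb P) (𝓝 0) := by
    intro k
    have e1 : Tendsto (fun q : Σ T, Ω T => avg q.1 fun t => lagCoef Φ A e k q.1 t q.2)
        (inProb P) (𝓝 0) := by
      simp only [lagCoef, avg_sum, avg_const_mul]
      have := tendsto_finsetSum Finset.univ fun a' _ =>
        ((h.op_w hΦ k.1 a').tendsto_of_sqrt_mul).const_mul (A k.2 a')
      simpa using this
    obtain ⟨B, -, hB⟩ := ((hl.momU k).mul hl.momζ).exists_integral_le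
    have hbd : IsBoundedUnder (· ≤ ·) (inProb P) (norm ∘ fun q : Σ T, Ω T =>
        ∫ ω, disturbance k (e q.1 0 ω) * instrTerm N d (e q.1 0 ω) ∂(P q.1)) :=
      isBoundedUnder_of ⟨B, fun q => hB q.1 0⟩
    exact e1.zero_mul_isBoundedUnder_le hbd
  have h3 := (h1.add ((tendsto_finsetSum Finset.univ fun k _ => h2 k).const_mul 2)).sub_const
    (slopeVar A Q Sig)
  simp only [Finset.sum_const_zero, mul_zero, add_zero, sub_self] at h3
  refine h3.congr' ?_
  filter_upwards [tendsto_fst_inProb.eventually (eventually_gt_atTop 0)] with q hq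
  have hcov : ∀ k l : Fin N × Fin (J + 1),
      ∫ ω, disturbance k (e q.1 0 ω) * disturbance l (e q.1 0 ω) ∂(P q.1) = ST q.1 k l :=
    fun k l => h.cov_u k.1 k.2 l.1 l.2 q.1 0
  simp only [LinStat.condVar, hcov, avg_add, avg_sum, avg_mul_const, avg_const_mul, avg_const hq.ne']
  ring

end IsSecondMoment

lemma IsShock.exists_isSecondMoment [∀ T, IsProbabilityMeasure (P T)]
    (h : IsShock P e b varZ δT ST)
    (hΦ : ∀ z ∈ spectrum ℂ (Φ.map (algebraMap ℝ ℂ)), ‖z‖ < 1) (hST : Tendsto ST atTop (𝓝 Sig)) :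
    ∃ Q, IsSecondMoment P e Φ Sig Q := by
  choose Q hQ1 hQ2 using fun i i' => h.exists_tendsto_avg_ww hΦ hST i i'
  exact ⟨Q, hQ1, hQ2⟩

/-- The asymptotic variance is bounded away from `0` unless the linearised statistic vanishes. -/
lemma IsSecondMoment.exists_le_variance [∀ T, IsProbabilityMeasure (P T)]
    (hQ : IsSecondMoment P e Φ Sig Q) (h : IsShock P e b varZ δT ST)
    (hN : 0 < N) (hvarZ : 0 < varZ) (hST : Tendsto ST atTop (𝓝 Sig)) (hpos : Sig.PosDef)
    (A : Matrix (Fin (J + 1)) (Fin (J + 1)) ℝ) {d : Fin (J + 1) → ℝ}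
    (hd : ∑ a, d a * b a = 0) (hAd : A ≠ 0 ∨ d ≠ 0) :
    ∃ c > 0, ∀ᶠ T in atTop,
      c ≤ slopeVar A Q Sig + ∫ ω, instrTerm N d (e T 0 ω) ^ 2 ∂(P T) := by
  obtain ⟨c, hc, hquad⟩ := exists_quadratic_lower_bound hpos
  have hs := hQ.slopeVar_ge hc.le hquad A
  rcases hAd with hA | hd0
  · refine ⟨c * ∑ k : Fin N × Fin (J + 1), c * ∑ a, A k.2 a ^ 2, ?_, Eventually.of_forall fun T => ?_⟩
    · refine mul_pos hc ?_
      obtain ⟨a, ha⟩ := Function.ne_iff.1 hA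
      obtain ⟨a', ha'⟩ := Function.ne_iff.1 ha
      have ha0 : A a a' ≠ 0 := ha'
      refine Finset.sum_pos' (fun k _ => by positivity) ⟨(⟨0, hN⟩, a), Finset.mem_univ _, ?_⟩
      exact mul_pos hc (Finset.sum_pos' (fun a _ => sq_nonneg _)
        ⟨a', Finset.mem_univ _, by positivity⟩)
    · exact hs.trans (le_add_of_nonneg_right (integral_nonneg fun ω => sq_nonneg _))
  · obtain ⟨c', hc', hev⟩ := h.exists_le_integral_instrTerm_sq hN hvarZ hST hpos hd hd0
    refine ⟨c', hc', hev.mono fun T hT => hT.trans (le_add_of_nonneg_left ?_)⟩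
    exact le_trans (by positivity) hs

end Variance


/-! ### Closeness of sequences in empirical power means -/

section Approximation

variable {Ω : ℕ → Type*} {mΩ : ∀ T, MeasurableSpace (Ω T)} {P : ∀ T, Measure (Ω T)}

/-- The sequences `f` and `g` are close on average in the `p`-th power, and `g` is bounded in this
sense, in probability. -/
structure Approx (P : ∀ T, Measure (Ω T)) (p : ℕ) (f g : (Σ T, Ω T) → ℕ → ℝ) : Prop where
  close : Tendsto (fun q => avg q.1 fun t => (f q t - g q t) ^ p) (inProb P) (𝓝 0)
  bdd : OP P fun q => avg q.1 fun t => g q t ^ p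

namespace Approx

variable {p : ℕ} {f g f' g' : (Σ T, Ω T) → ℕ → ℝ}

lemma avg_add_pow_le (hp : Even p) (T : ℕ) (f g : ℕ → ℝ) :
    avg T (fun t => (f t + g t) ^ p)
      ≤ 2 ^ (p - 1) * (avg T (fun t => f t ^ p) + avg T (fun t => g t ^ p)) := by
  rw [← avg_add, ← avg_const_mul]
  exact avg_mono fun _ => hp.add_pow_le

lemma avg_pow_nonneg (hp : Even p) (T : ℕ) (f : ℕ → ℝ) : 0 ≤ avg T (fun t => f t ^ p) :=
  avg_nonneg fun _ => hp.pow_nonneg _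

lemma add (hp : Even p) (h : Approx P p f g) (h' : Approx P p f' g') :
    Approx P p (fun q t => f q t + f' q t) (fun q t => g q t + g' q t) where
  close := by
    have hl := (h.close.add h'.close).const_mul (2 ^ (p - 1))
    simp only [add_zero, mul_zero] at hl
    refine squeeze_zero (fun q => avg_pow_nonneg hp _ _) (fun q => ?_) hl
    have := avg_add_pow_le hp q.1 (fun t => f q t - g q t) (fun t => f' q t - g' q t)
    refine le_trans (le_of_eq ?_) this
    congr 1
    ext t
    ring
  bdd := by
    refine ((h.bdd.add h'.bdd).const_mul (2 ^ (p - 1))).mono fun q => ?_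
    rw [abs_of_nonneg (avg_pow_nonneg hp _ _)]
    exact (avg_add_pow_le hp q.1 (g q) (g' q)).trans (le_abs_self _)

lemma smul (hp : Even p) (h : Approx P p f g) {c : (Σ T, Ω T) → ℝ} {c₀ : ℝ}
    (hc : Tendsto c (inProb P) (𝓝 c₀)) :
    Approx P p (fun q t => c q * f q t) (fun q t => c₀ * g q t) where
  close := by
    have h1 : Tendsto (fun q => c q ^ p * avg q.1 fun t => (f q t - g q t) ^ p) (inProb P)
        (𝓝 (c₀ ^ p * 0)) := (hc.pow p).mul h.close
    have h2 : Tendsto (fun q => (avg q.1 fun t => g q t ^ p) * (c q - c₀) ^ p) (inProb P) (𝓝 0) := by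
      -- For p = 0 the power of c - c₀ is 1 and does not vanish; the claim then coincides with the
      -- assumed closeness.
      rcases Nat.eq_zero_or_pos p with rfl | hp0
      · refine squeeze_zero' (Eventually.of_forall fun q => mul_nonneg (avg_pow_nonneg hp _ _)
          (hp.pow_nonneg _)) (Eventually.of_forall fun q => ?_) h.close
        simp
      · refine h.bdd.mul_tendsto ?_
        have := (hc.sub_const c₀).pow p
        simpa [hp0.ne'] using this
    have hl := (h1.add h2).const_mul (2 ^ (p - 1))
    simp only [add_zero, mul_zero] at hl
    refine squeeze_zero (fun q => avg_pow_nonneg hp _ _) (fun q => ?_) hl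
    have := avg_add_pow_le hp q.1 (fun t => c q * (f q t - g q t)) (fun t => g q t * (c q - c₀))
    simp only [mul_pow, avg_const_mul, avg_mul_const] at this
    refine le_trans (le_of_eq ?_) this
    congr 1
    ext t
    congr 1
    ring
  bdd := by
    simp only [mul_pow, avg_const_mul]
    exact h.bdd.const_mul _

lemma sum (hp : Even p) (hp0 : p ≠ 0) {κ : Type*} (s : Finset κ) {f g : κ → (Σ T, Ω T) → ℕ → ℝ}
    (h : ∀ i ∈ s, Approx P p (f i) (g i)) :
    Approx P p (fun q t => ∑ i ∈ s, f i q t) (fun q t => ∑ i ∈ s, g i q t) := by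
  classical
  induction s using Finset.induction_on with
  | empty =>
    constructor
    · simpa [avg, hp0] using tendsto_const_nhds
    · simpa [avg, hp0] using OP.const 0
  | insert i s hi ih =>
    simp only [Finset.sum_insert hi]
    exact (h i (by simp)).add hp (ih fun j hj => h j (by simp [hj]))

lemma const {c : (Σ T, Ω T) → ℝ} (hp0 : p ≠ 0) (hc : Tendsto c (inProb P) (𝓝 0)) :
    Approx P p (fun q _ => c q) (fun _ _ => 0) where
  close := by
    have h1 := hc.pow p
    rw [zero_pow hp0] at h1
    refine h1.congr' ?_
    filter_upwards [tendsto_fst_inProb.eventually (eventually_gt_atTop 0)] with q hq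
    rw [sub_zero, avg_const hq.ne']
  bdd := by simpa [avg, hp0] using OP.const 0

lemma refl (hp0 : p ≠ 0) (h : OP P fun q => avg q.1 fun t => g q t ^ p) : Approx P p g g where
  close := by simpa [avg, hp0] using tendsto_const_nhds
  bdd := h

lemma op_left (hp : Even p) (h : Approx P p f g) : OP P fun q => avg q.1 fun t => f q t ^ p := by
  refine (((OP.of_tendsto h.close).add h.bdd).const_mul (2 ^ (p - 1))).mono fun q => ?_
  rw [abs_of_nonneg (avg_pow_nonneg hp _ _)]
  have := avg_add_pow_le hp q.1 (fun t => f q t - g q t) (g q)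
  simp only [sub_add_cancel] at this
  exact this.trans (le_abs_self _)

lemma avg_mul_sq_le_half (T : ℕ) (f g : ℕ → ℝ) :
    avg T (fun t => (f t * g t) ^ 2) ^ 2 ≤ avg T (fun t => f t ^ 4) * avg T (fun t => g t ^ 4) := by
  have := avg_mul_sq_le T (fun t => f t ^ 2) (fun t => g t ^ 2)
  simpa only [mul_pow, ← pow_mul] using this

lemma tendsto_of_sq {X : (Σ T, Ω T) → ℝ} (h : Tendsto (fun q => X q ^ 2) (inProb P) (𝓝 0)) :
    Tendsto X (inProb P) (𝓝 0) := by
  have h1 := h.sqrt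
  simp only [Real.sqrt_sq_eq_abs, Real.sqrt_zero] at h1
  exact (tendsto_zero_iff_abs_tendsto_zero _).2 h1

/-- Write ff' - gg' = (f - g)f' + g(f' - g') and apply Cauchy–Schwarz to each product. Scores are
built from products of two estimated sequences, hence fourth powers for the factors and squares for
the scores. -/
lemma mul (h : Approx P 4 f g) (h' : Approx P 4 f' g') :
    Approx P 2 (fun q t => f q t * f' q t) (fun q t => g q t * g' q t) where
  close := by
    have h4 : Even 4 := ⟨2, rfl⟩
    have h1 : Tendsto (fun q => avg q.1 fun t => ((f q t - g q t) * f' q t) ^ 2) (inProb P)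
        (𝓝 0) := by
      refine tendsto_of_sq (squeeze_zero (fun q => sq_nonneg _)
        (fun q => avg_mul_sq_le_half q.1 _ _) ?_)
      simp only [mul_comm (avg _ fun t => (f _ t - g _ t) ^ 4)]
      exact (h'.op_left h4).mul_tendsto h.close
    have h2 : Tendsto (fun q => avg q.1 fun t => (g q t * (f' q t - g' q t)) ^ 2) (inProb P)
        (𝓝 0) := by
      refine tendsto_of_sq (squeeze_zero (fun q => sq_nonneg _)
        (fun q => avg_mul_sq_le_half q.1 _ _) ?_)
      exact h.bdd.mul_tendsto h'.close
    have hl := (h1.add h2).const_mul (2 ^ (2 - 1))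
    simp only [add_zero, mul_zero] at hl
    refine squeeze_zero (fun q => avg_pow_nonneg even_two _ _) (fun q => ?_) hl
    have := avg_add_pow_le even_two q.1 (fun t => (f q t - g q t) * f' q t)
      (fun t => g q t * (f' q t - g' q t))
    refine le_trans (le_of_eq ?_) this
    congr 1
    ext t
    ring
  bdd := by
    refine OP.of_sq ((h.bdd.mul h'.bdd).mono fun q => ?_)
    rw [abs_of_nonneg (sq_nonneg _)]
    exact (avg_mul_sq_le_half q.1 (g q) (g' q)).trans (le_abs_self _)

/-- Average squares of close sequences have the same limits. -/
lemma tendsto_avg_sq_sub (h : Approx P 2 f g) :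
    Tendsto (fun q => avg q.1 (fun t => f q t ^ 2) - avg q.1 (fun t => g q t ^ 2)) (inProb P)
      (𝓝 0) := by
  have h1 : Tendsto (fun q => avg q.1 fun t => (f q t - g q t) * g q t) (inProb P) (𝓝 0) := by
    refine tendsto_of_sq (squeeze_zero (fun q => sq_nonneg _) (fun q => avg_mul_sq_le q.1 _ _) ?_)
    simp only [mul_comm (avg _ fun t => (f _ t - g _ t) ^ 2)]
    exact h.bdd.mul_tendsto h.close
  have hl := h.close.add (h1.const_mul 2)
  simp only [add_zero, mul_zero] at hl
  refine hl.congr fun q => ?_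
  rw [← avg_const_mul, ← avg_add, ← avg_sub]
  congr 1
  ext t
  ring

end Approx

end Approximation


/-! ### Exact linearisation of the gap -/

section Linearisation

variable {J : ℕ} {k : ℕ} {s : Fin (J + 1)} {l : ℝ}

/-- The Frobenius inner product. -/
def frob {m n : Type*} [Fintype m] [Fintype n] (A B : Matrix m n ℝ) : ℝ :=
  ∑ a, ∑ b, A a b * B a b

/-- Moves the inverse Gram matrix from the estimation error of Φ onto the gradient, leaving a
pairing with the cross moment alone. -/
lemma frob_mul {n : Type*} [Fintype n] (A M B : Matrix n n ℝ) :
    frob A (M * B) = frob (A * B.transpose) M := by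
  simp only [frob, Matrix.mul_apply, Matrix.transpose_apply, Finset.mul_sum, Finset.sum_mul]
  refine Finset.sum_congr rfl fun a _ => ?_
  rw [Finset.sum_comm]
  exact Finset.sum_congr rfl fun b _ => Finset.sum_congr rfl fun c _ => by ring

/-- The gradient of `gap k s l F Γ` in `F` if `F = G`; in general the corresponding difference
quotient. -/
def sens (k : ℕ) (s : Fin (J + 1)) (F G : Matrix (Fin (J + 1)) (Fin (J + 1)) ℝ)
    (Γ : Fin (J + 1) → ℝ) : Matrix (Fin (J + 1)) (Fin (J + 1)) ℝ :=
  fun a b => ∑ j ∈ Finset.range k, (F ^ j) s a * ((G ^ (k - 1 - j)).mulVec Γ) b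

/-- The gradient of `gap k s l F Γ` in `Γ`. -/
def dvec (k : ℕ) (s : Fin (J + 1)) (l : ℝ) (F : Matrix (Fin (J + 1)) (Fin (J + 1)) ℝ)
    (a : Fin (J + 1)) : ℝ :=
  (F ^ k) s a - if a = 0 then l else 0

lemma gap_eq (F : Matrix (Fin (J + 1)) (Fin (J + 1)) ℝ) (Γ : Fin (J + 1) → ℝ) :
    gap k s l F Γ = ∑ a, dvec k s l F a * Γ a := by
  simp [gap, dvec, Matrix.mulVec, dotProduct, sub_mul, Finset.sum_sub_distrib]

lemma sum_mulVec_eq_frob (F G H : Matrix (Fin (J + 1)) (Fin (J + 1)) ℝ) (Γ : Fin (J + 1) → ℝ) :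
    ((∑ j ∈ Finset.range k, F ^ j * H * G ^ (k - 1 - j)).mulVec Γ) s = frob (sens k s F G Γ) H := by
  rw [Matrix.sum_mulVec, Finset.sum_apply]
  simp only [frob, sens, Finset.sum_mul]
  have h : ∀ j, ((F ^ j * H * G ^ (k - 1 - j)).mulVec Γ) s
      = ∑ a, ∑ b, (F ^ j) s a * ((G ^ (k - 1 - j)).mulVec Γ) b * H a b := fun j => by
    rw [← Matrix.mulVec_mulVec, ← Matrix.mulVec_mulVec]
    conv_lhs => rw [Matrix.mulVec, dotProduct]
    refine Finset.sum_congr rfl fun a _ => ?_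
    conv_lhs => rw [Matrix.mulVec, dotProduct, Finset.mul_sum]
    exact Finset.sum_congr rfl fun b _ => by ring
  simp only [h]
  rw [Finset.sum_comm]
  exact Finset.sum_congr rfl fun a _ => Finset.sum_comm

lemma gapDeriv_eq (F H : Matrix (Fin (J + 1)) (Fin (J + 1)) ℝ) (Γ h : Fin (J + 1) → ℝ) :
    gapDeriv k s l F Γ H h = frob (sens k s F F Γ) H + ∑ a, dvec k s l F a * h a := by
  rw [gapDeriv, sum_mulVec_eq_frob, gap_eq]

/-- Noncommutative telescoping. In every summand j < k, so the natural subtraction in the exponent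
is exact. -/
lemma pow_sub_pow_eq_sum (F G : Matrix (Fin (J + 1)) (Fin (J + 1)) ℝ) (k : ℕ) :
    F ^ k - G ^ k = ∑ j ∈ Finset.range k, F ^ j * (F - G) * G ^ (k - 1 - j) := by
  induction k with
  | zero => simp
  | succ k ih =>
    rw [Finset.sum_range_succ]
    have h : ∑ j ∈ Finset.range k, F ^ j * (F - G) * G ^ (k + 1 - 1 - j)
        = (F ^ k - G ^ k) * G := by
      rw [ih, Finset.sum_mul]
      refine Finset.sum_congr rfl fun j hj => ?_
      have hj := Finset.mem_range.1 hj
      rw [mul_assoc (F ^ j * (F - G)), ← pow_succ]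
      congr 2
      omega
    rw [h, add_tsub_cancel_right, tsub_self, pow_zero, mul_one, pow_succ, pow_succ, sub_mul, mul_sub]
    abel

/-- Exact, so the delta method needs no Taylor remainder, only continuity of the difference
quotient. -/
lemma gap_eq_frob_add (F G : Matrix (Fin (J + 1)) (Fin (J + 1)) ℝ) (Γ : Fin (J + 1) → ℝ) :
    gap k s l F Γ = frob (sens k s F G Γ) (F - G) + gap k s l G Γ := by
  rw [← sum_mulVec_eq_frob, ← pow_sub_pow_eq_sum, Matrix.sub_mulVec]
  simp only [gap, Pi.sub_apply]
  ring

end Linearisation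

/-! ### Algebra of the within estimator on a sample path -/

section Sample

variable {N J T : ℕ} {Φ : Matrix (Fin (J + 1)) (Fin (J + 1)) ℝ} {μ : Fin N → Fin (J + 1) → ℝ}
  {μZ : ℝ} {x : Fin N → ℕ → Fin (J + 1) → ℝ} {Z : Fin N → ℕ → ℝ} {e : ℕ → Shock N J}

lemma demean_apply (f : ℕ → Fin (J + 1) → ℝ) (t : ℕ) (a : Fin (J + 1)) :
    demean T f t a = f t a - avg T fun r => f r a := by
  simp [demean, avg]

lemma avg_demean_mul (hT : T ≠ 0) (f g : ℕ → ℝ) :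
    avg T (fun t => (f t - avg T f) * (g t - avg T g)) = avg T (fun t => f t * g t)
      - avg T f * avg T g := by
  have : (fun t => (f t - avg T f) * (g t - avg T g))
      = fun t => f t * g t - f t * avg T g - avg T f * g t + avg T f * avg T g := by
    ext t; ring
  rw [this, avg_add, avg_sub, avg_sub, avg_mul_const, avg_const_mul, avg_const hT]
  ring

/-- The contribution of the presample values. -/
def transient (Φ : Matrix (Fin (J + 1)) (Fin (J + 1)) ℝ) (y : Fin N → Fin (J + 1) → ℝ) (t : ℕ)
    (i : Fin N) : Fin (J + 1) → ℝ := (Φ ^ t).mulVec (y i)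

/-- The deviation of the process from its mean. -/
def state (Φ : Matrix (Fin (J + 1)) (Fin (J + 1)) ℝ) (e : ℕ → Shock N J)
    (y : Fin N → Fin (J + 1) → ℝ) (t : ℕ) (i : Fin N) (a : Fin (J + 1)) : ℝ :=
  linProc Φ e t i a + transient Φ y t i a

/-- Sample paths of the panel model. -/
structure IsPath (Φ : Matrix (Fin (J + 1)) (Fin (J + 1)) ℝ) (μ : Fin N → Fin (J + 1) → ℝ) (μZ : ℝ)
    (x : Fin N → ℕ → Fin (J + 1) → ℝ) (Z : Fin N → ℕ → ℝ) (e : ℕ → Shock N J) : Prop where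
  pvar : ∀ i t, x i (t + 1) = (1 - Φ).mulVec (μ i) + Φ.mulVec (x i t) + (e t i).2
  instr : ∀ i t, Z i (t + 1) = μZ + (e t i).1

/-- The average of `x_i x_i'` over the sample. -/
noncomputable def meanGram (T : ℕ) (x : Fin N → ℕ → Fin (J + 1) → ℝ) :
    Matrix (Fin (J + 1)) (Fin (J + 1)) ℝ := (T : ℝ)⁻¹ • gram T x

lemma meanGram_apply (T : ℕ) (x : Fin N → ℕ → Fin (J + 1) → ℝ) (a b : Fin (J + 1)) :
    meanGram T x a b = ∑ i, avg T fun t => regressor T x i t a * regressor T x i t b := by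
  simp [meanGram, gram, avg, Matrix.sum_apply, Matrix.vecMulVec_apply, Finset.mul_sum]

/-- The average of the products of disturbances and regressors. -/
noncomputable def crossMoment (T : ℕ) (x : Fin N → ℕ → Fin (J + 1) → ℝ) (e : ℕ → Shock N J) :
    Matrix (Fin (J + 1)) (Fin (J + 1)) ℝ :=
  fun a b => ∑ i, avg T fun t => demean T (fun r => (e r i).2 a) t * regressor T x i t b

namespace IsPath

/-- The deviation from the unit mean obeys the autoregression without intercept; by linearity it is
the zero-started process plus the decaying effect of the presample value. -/
lemma sub_eq_state (h : IsPath Φ μ μZ x Z e) (i : Fin N) (t : ℕ) (a : Fin (J + 1)) :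
    x i t a = μ i a + state Φ e (fun i => x i 0 - μ i) t i a := by
  have hv : ∀ t, x i t = μ i + (linProc Φ e t i + (Φ ^ t).mulVec (x i 0 - μ i)) := fun t => by
    induction t with
    | zero => simp [linProc]
    | succ t ih =>
      rw [h.pvar, ih, linProc, pow_succ', ← Matrix.mulVec_mulVec]
      simp only [Matrix.mulVec_add, Matrix.sub_mulVec, Matrix.one_mulVec]
      abel
  rw [hv t]
  simp [state, transient]

lemma regressor_eq (h : IsPath Φ μ μZ x Z e) (hT : T ≠ 0) (i : Fin N) (t : ℕ) (a : Fin (J + 1)) :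
    regressor T x i t a = state Φ e (fun i => x i 0 - μ i) t i a
      - avg T fun r => state Φ e (fun i => x i 0 - μ i) r i a := by
  rw [regressor, demean_apply]
  simp only [h.sub_eq_state]
  rw [avg_add, avg_const hT]
  ring

lemma instrument_eq (h : IsPath Φ μ μZ x Z e) (hT : T ≠ 0) (i : Fin N) (t : ℕ) :
    instrument T Z i t = (e t i).1 - avg T fun r => (e r i).1 := by
  have : instrument T Z i t = Z i (t + 1) - avg T fun r => Z i (r + 1) := by
    simp [instrument, demean, avg]
  rw [this]
  simp only [h.instr]
  rw [avg_add, avg_const hT]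
  ring

lemma regressand_eq (h : IsPath Φ μ μZ x Z e) (hT : T ≠ 0) (i : Fin N) (t : ℕ) :
    regressand T x i t = Φ.mulVec (regressor T x i t) + fun a => demean T (fun r => (e r i).2 a) t := by
  ext a
  obtain ⟨c, hc⟩ : ∃ c, c = ((1 - Φ).mulVec (μ i)) a := ⟨_, rfl⟩
  have h1 : ∀ r, x i (r + 1) a = c + (∑ b, Φ a b * x i r b) + (e r i).2 a := fun r => by
    rw [h.pvar, hc]
    rfl
  have h2 : demean T (fun r => (e r i).2 a) t = (e t i).2 a - avg T fun r => (e r i).2 a := by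
    simp [demean, avg]
  have h3 : (Φ.mulVec (regressor T x i t)) a = ∑ b, Φ a b * regressor T x i t b := rfl
  rw [Pi.add_apply, h3, h2, regressand, demean_apply]
  simp only [h1, regressor, demean_apply, mul_sub, Finset.sum_sub_distrib]
  rw [avg_add, avg_add, avg_const hT, avg_sum]
  simp only [avg_const_mul]
  ring

/-- Demeaning removes the unit effects, so the regressand is Φ times the regressor plus the demeaned
disturbance, and the normal equations leave only the disturbance-regressor moment as error. -/
lemma phiHat_eq (h : IsPath Φ μ μZ x Z e) (hT : T ≠ 0) (hS : IsUnit (meanGram T x).det) :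
    phiHat T x = Φ + crossMoment T x e * (meanGram T x)⁻¹ := by
  have hT' : (T : ℝ) ≠ 0 := Nat.cast_ne_zero.2 hT
  have hinv : (gram T x)⁻¹ = (T : ℝ)⁻¹ • (meanGram T x)⁻¹ := by
    have hg : gram T x = (T : ℝ) • meanGram T x := by
      rw [meanGram, smul_smul, mul_inv_cancel₀ hT', one_smul]
    refine Matrix.inv_eq_right_inv ?_
    rw [hg, Matrix.smul_mul, Matrix.mul_smul, smul_smul, mul_inv_cancel₀ hT', one_smul,
      Matrix.mul_nonsing_inv _ hS]
  have hnum : ∑ i, ∑ t ∈ Finset.range T, Matrix.vecMulVec (regressand T x i t) (regressor T x i t)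
      = (T : ℝ) • (Φ * meanGram T x + crossMoment T x e) := by
    have hc : (T : ℝ) • crossMoment T x e = ∑ i, ∑ t ∈ Finset.range T,
        Matrix.vecMulVec (fun a => demean T (fun r => (e r i).2 a) t) (regressor T x i t) := by
      ext a b
      simp only [crossMoment, avg, Matrix.smul_apply, Matrix.sum_apply, Matrix.vecMulVec_apply,
        smul_eq_mul, ← Finset.mul_sum]
      rw [← mul_assoc, mul_inv_cancel₀ hT', one_mul]
    rw [smul_add, hc, meanGram, Matrix.mul_smul, smul_smul, mul_inv_cancel₀ hT', one_smul, gram,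
      Finset.mul_sum, ← Finset.sum_add_distrib]
    refine Finset.sum_congr rfl fun i _ => ?_
    rw [Finset.mul_sum, ← Finset.sum_add_distrib]
    refine Finset.sum_congr rfl fun t _ => ?_
    rw [h.regressand_eq hT, Matrix.add_vecMulVec, Matrix.mul_vecMulVec]
  rw [phiHat, hnum, hinv, Matrix.smul_mul, Matrix.mul_smul, smul_smul, mul_inv_cancel₀ hT', one_smul,
    add_mul, mul_assoc, Matrix.mul_nonsing_inv _ hS, mul_one]

lemma residual_eq (h : IsPath Φ μ μZ x Z e) (hT : T ≠ 0) (i : Fin N) (t : ℕ) (a : Fin (J + 1)) :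
    residual T x i t a = ((e t i).2 a - avg T fun r => (e r i).2 a)
      - ∑ b, (phiHat T x - Φ) a b * regressor T x i t b := by
  have h2 : demean T (fun r => (e r i).2 a) t = (e t i).2 a - avg T fun r => (e r i).2 a := by
    simp [demean, avg]
  rw [residual, h.regressand_eq hT, Pi.sub_apply, Pi.add_apply, h2]
  simp only [Matrix.mulVec, dotProduct, Matrix.sub_apply, sub_mul, Finset.sum_sub_distrib]
  ring

lemma gammaHat_eq (h : IsPath Φ μ μZ x Z e) (hT : T ≠ 0) (a : Fin (J + 1)) :
    gammaHat T x Z a = (N : ℝ)⁻¹ * ∑ i,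
      ((avg T (fun t => (e t i).1 * (e t i).2 a)
          - avg T (fun t => (e t i).1) * avg T (fun t => (e t i).2 a))
        - ∑ b, (phiHat T x - Φ) a b *
          (avg T (fun t => (e t i).1 * state Φ e (fun i => x i 0 - μ i) t i b)
            - avg T (fun t => (e t i).1)
              * avg T (fun t => state Φ e (fun i => x i 0 - μ i) t i b))) := by
  have h1 : gammaHat T x Z a = (N : ℝ)⁻¹ * ∑ i, avg T fun t =>
      instrument T Z i t * residual T x i t a := by
    simp only [gammaHat, avg, Pi.smul_apply, Finset.sum_apply, smul_eq_mul, mul_inv,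
      ← Finset.mul_sum, mul_assoc]
  rw [h1]
  congr 1
  refine Finset.sum_congr rfl fun i _ => ?_
  have h2 : ∀ t, instrument T Z i t * residual T x i t a
      = ((e t i).1 - avg T fun t => (e t i).1) * ((e t i).2 a - avg T fun t => (e t i).2 a)
        - ∑ b, (phiHat T x - Φ) a b * (((e t i).1 - avg T fun t => (e t i).1)
          * (state Φ e (fun i => x i 0 - μ i) t i b
            - avg T fun t => state Φ e (fun i => x i 0 - μ i) t i b)) := fun t => by
    rw [h.residual_eq hT, h.instrument_eq hT, mul_sub, Finset.mul_sum]
    congr 1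
    refine Finset.sum_congr rfl fun b _ => ?_
    rw [h.regressor_eq hT]
    ring
  simp only [h2]
  rw [avg_sub, avg_sum, avg_demean_mul hT]
  congr 1
  refine Finset.sum_congr rfl fun b _ => ?_
  rw [avg_const_mul, avg_demean_mul hT]

lemma crossMoment_eq (h : IsPath Φ μ μZ x Z e) (hT : T ≠ 0) (a b : Fin (J + 1)) :
    crossMoment T x e a b = ∑ i,
      (avg T (fun t => (e t i).2 a * state Φ e (fun i => x i 0 - μ i) t i b)
        - avg T (fun t => (e t i).2 a) * avg T (fun t => state Φ e (fun i => x i 0 - μ i) t i b)) := by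
  refine Finset.sum_congr rfl fun i _ => ?_
  rw [← avg_demean_mul hT]
  congr 1
  ext t
  rw [h.regressor_eq hT]
  simp [demean, avg]

lemma meanGram_eq (h : IsPath Φ μ μZ x Z e) (hT : T ≠ 0) (a b : Fin (J + 1)) :
    meanGram T x a b = ∑ i,
      (avg T (fun t => state Φ e (fun i => x i 0 - μ i) t i a
          * state Φ e (fun i => x i 0 - μ i) t i b)
        - avg T (fun t => state Φ e (fun i => x i 0 - μ i) t i a)
          * avg T (fun t => state Φ e (fun i => x i 0 - μ i) t i b)) := by
  rw [meanGram_apply]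
  refine Finset.sum_congr rfl fun i _ => ?_
  rw [← avg_demean_mul hT]
  simp only [h.regressor_eq hT]

end IsPath

variable {k : ℕ} {s : Fin (J + 1)} {l : ℝ}

lemma score_eq (T : ℕ) (x : Fin N → ℕ → Fin (J + 1) → ℝ) (Z : Fin N → ℕ → ℝ) (t : ℕ) :
    score T x Z k s l t = (∑ a, ∑ b, (sens k s (phiHat T x) (phiHat T x) (gammaHat T x Z)
          * ((meanGram T x)⁻¹).transpose) a b * ∑ i, residual T x i t a * regressor T x i t b)
      + (∑ a, dvec k s l (phiHat T x) a * ((N : ℝ)⁻¹ * ∑ i, instrument T Z i t * residual T x i t a))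
      + -gap k s l (phiHat T x) (gammaHat T x Z) := by
  rw [score, gapDeriv_eq, frob_mul, ← meanGram, gap_eq _ (gammaHat T x Z), frob, add_assoc]
  congr 1
  · simp [Matrix.sum_apply, Matrix.vecMulVec_apply]
  · rw [← Finset.sum_neg_distrib, ← Finset.sum_add_distrib]
    refine Finset.sum_congr rfl fun a _ => ?_
    simp [Finset.sum_apply]
    ring

end Sample


/-! ### Negligibility of the presample values -/

section Transient

variable {N J : ℕ} {Ω : ℕ → Type*} {mΩ : ∀ T, MeasurableSpace (Ω T)} {P : ∀ T, Measure (Ω T)}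
  [∀ T, IsProbabilityMeasure (P T)] {Φ : Matrix (Fin (J + 1)) (Fin (J + 1)) ℝ}

/-- The geometrically weighted sum of |f| has bounded expectation, so dividing by √T makes it
vanish. The random factor V, of which only tightness is known, is kept outside the expectation. -/
lemma tendsto_sqrt_avg_of_geometric {f : ∀ T, ℕ → Ω T → ℝ} (hf : AllMoments P f)
    {V : (Σ T, Ω T) → ℝ} (hV : OP P V) {ρ : ℝ} (h0 : 0 < ρ) (h1 : ρ < 1)
    {g : (Σ T, Ω T) → ℕ → ℝ} (hg : ∀ q t, |g q t| ≤ V q * (ρ ^ t * |f q.1 t q.2|)) :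
    Tendsto (fun q => Real.sqrt q.1 * avg q.1 (g q)) (inProb P) (𝓝 0) := by
  obtain ⟨C, hC0, hC⟩ := hf.exists_integral_abs_le
  have key : Tendsto (fun q : Σ T, Ω T =>
      Real.sqrt q.1 * avg q.1 fun t => ρ ^ t * |f q.1 t q.2|) (inProb P) (𝓝 0) := by
    have hint : ∀ T, Integrable (fun ω => ∑ t ∈ Finset.range T, ρ ^ t * |f T t ω|) (P T) := fun T =>
      integrable_finsetSum _ fun t _ => (hf.integrable T t).abs.const_mul _
    have hlim : Tendsto (fun T : ℕ => (Real.sqrt T)⁻¹ * ((1 - ρ)⁻¹ * C)) atTop (𝓝 0) := by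
      have := (tendsto_inv_atTop_zero.comp (Real.tendsto_sqrt_atTop.comp
        (tendsto_natCast_atTop_atTop (R := ℝ)))).mul_const ((1 - ρ)⁻¹ * C)
      simpa using this
    simp only [sqrt_mul_avg]
    refine tendsto_zero_of_integral (fun T => (hint T).const_mul (Real.sqrt T)⁻¹)
      (Eventually.of_forall fun T => ?_) hlim
    have habs : ∀ ω, abs ((Real.sqrt T)⁻¹ * ∑ t ∈ Finset.range T, ρ ^ t * |f T t ω|)
        = (Real.sqrt T)⁻¹ * ∑ t ∈ Finset.range T, ρ ^ t * |f T t ω| := fun ω =>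
      abs_of_nonneg (by positivity)
    simp only [habs]
    rw [integral_const_mul, integral_finsetSum _ fun t _ => (hf.integrable T t).abs.const_mul _]
    refine mul_le_mul_of_nonneg_left ?_ (by positivity)
    calc ∑ t ∈ Finset.range T, ∫ ω, ρ ^ t * |f T t ω| ∂(P T)
        ≤ ∑ t ∈ Finset.range T, ρ ^ t * C := Finset.sum_le_sum fun t _ => by
          rw [integral_const_mul]
          exact mul_le_mul_of_nonneg_left (hC T t) (by positivity)
      _ ≤ (1 - ρ)⁻¹ * C := by
          rw [← Finset.sum_mul, ← tsum_geometric_of_lt_one h0.le h1]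
          exact mul_le_mul_of_nonneg_right ((summable_geometric_of_lt_one h0.le h1).sum_le_tsum _
            fun j _ => by positivity) hC0
  refine squeeze_zero_norm (fun q => ?_) (hV.mul_tendsto key)
  rw [Real.norm_eq_abs, abs_mul, abs_of_nonneg (Real.sqrt_nonneg _), mul_left_comm]
  refine mul_le_mul_of_nonneg_left ?_ (Real.sqrt_nonneg _)
  rw [← avg_const_mul]
  rw [abs_le]
  constructor
  · have : -avg q.1 (fun t => V q * (ρ ^ t * |f q.1 t q.2|))
        = avg q.1 fun t => -1 * (V q * (ρ ^ t * |f q.1 t q.2|)) := by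
      rw [avg_const_mul _ (-1 : ℝ), neg_one_mul]
    rw [this]
    exact avg_mono fun t => by linarith [(abs_le.1 (hg q t)).1]
  · exact avg_mono fun t => (abs_le.1 (hg q t)).2

lemma exists_abs_transient_le (hΦ : ∀ z ∈ spectrum ℂ (Φ.map (algebraMap ℝ ℂ)), ‖z‖ < 1)
    {y : (Σ T, Ω T) → Fin N → Fin (J + 1) → ℝ} (hy : ∀ i a, OP P fun q => y q i a) :
    ∃ (V : (Σ T, Ω T) → ℝ) (ρ : ℝ), OP P V ∧ 0 < ρ ∧ ρ < 1 ∧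
      ∀ q t i a, |transient Φ (y q) t i a| ≤ V q * ρ ^ t := by
  obtain ⟨K, ρ, hK, h0, h1, h⟩ := exists_abs_pow_apply_le hΦ
  refine ⟨fun q => ∑ i, ∑ a, K * |y q i a|, ρ, ?_, h0, h1, fun q t i a => ?_⟩
  · refine OP.sum _ fun i _ => OP.sum _ fun a _ => OP.const_mul ?_ K
    exact (hy i a).mono fun q => (abs_abs _).le
  · have hle : ∑ b, K * |y q i b| ≤ ∑ i, ∑ b, K * |y q i b| :=
      Finset.single_le_sum (f := fun i => ∑ b, K * |y q i b|)
        (fun j _ => Finset.sum_nonneg fun b _ => by positivity) (Finset.mem_univ i)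
    refine le_trans ?_ (mul_le_mul_of_nonneg_right hle (by positivity))
    rw [transient, Matrix.mulVec, dotProduct, Finset.sum_mul]
    refine (Finset.abs_sum_le_sum_abs _ _).trans (Finset.sum_le_sum fun b _ => ?_)
    rw [abs_mul]
    calc _ ≤ (K * ρ ^ t) * |y q i b| := mul_le_mul_of_nonneg_right (h t a b) (abs_nonneg _)
      _ = _ := by ring

lemma tendsto_sqrt_avg_mul_transient
    (hΦ : ∀ z ∈ spectrum ℂ (Φ.map (algebraMap ℝ ℂ)), ‖z‖ < 1)
    {y : (Σ T, Ω T) → Fin N → Fin (J + 1) → ℝ} (hy : ∀ i a, OP P fun q => y q i a)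
    {f : ∀ T, ℕ → Ω T → ℝ} (hf : AllMoments P f) (i : Fin N) (a : Fin (J + 1)) :
    Tendsto (fun q => Real.sqrt q.1 * avg q.1 fun t => f q.1 t q.2 * transient Φ (y q) t i a)
      (inProb P) (𝓝 0) := by
  obtain ⟨V, ρ, hV, h0, h1, h⟩ := exists_abs_transient_le hΦ hy
  refine tendsto_sqrt_avg_of_geometric hf hV h0 h1 fun q t => ?_
  rw [abs_mul, mul_comm, ← mul_assoc]
  exact mul_le_mul_of_nonneg_right (h q t i a) (abs_nonneg _)

lemma tendsto_avg_transient_mul (hΦ : ∀ z ∈ spectrum ℂ (Φ.map (algebraMap ℝ ℂ)), ‖z‖ < 1)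
    {y : (Σ T, Ω T) → Fin N → Fin (J + 1) → ℝ} (hy : ∀ i a, OP P fun q => y q i a)
    (i i' : Fin N) (a a' : Fin (J + 1)) :
    Tendsto (fun q => avg q.1 fun t => transient Φ (y q) t i a * transient Φ (y q) t i' a')
      (inProb P) (𝓝 0) := by
  obtain ⟨V, ρ, hV, h0, h1, h⟩ := exists_abs_transient_le hΦ hy
  refine (OP.of_tendsto (tendsto_sqrt_avg_of_geometric (AllMoments.const 1) (hV.mul hV) h0 h1
    fun q t => ?_)).tendsto_of_sqrt_mul
  have hV0 : 0 ≤ V q := by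
    have := (abs_nonneg _).trans (h q 0 i a)
    simpa using this
  rw [abs_mul]
  calc _ ≤ (V q * ρ ^ t) * (V q * ρ ^ t) := by gcongr <;> exact h q t _ _
    _ ≤ (V q * ρ ^ t) * (V q * 1) := by gcongr; exact pow_le_one₀ h0.le h1.le
    _ = _ := by rw [abs_one]; ring

lemma tendsto_avg_transient_pow_four (hΦ : ∀ z ∈ spectrum ℂ (Φ.map (algebraMap ℝ ℂ)), ‖z‖ < 1)
    {y : (Σ T, Ω T) → Fin N → Fin (J + 1) → ℝ} (hy : ∀ i a, OP P fun q => y q i a)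
    (i : Fin N) (a : Fin (J + 1)) :
    Tendsto (fun q => avg q.1 fun t => transient Φ (y q) t i a ^ 4) (inProb P) (𝓝 0) := by
  obtain ⟨V, ρ, hV, h0, h1, h⟩ := exists_abs_transient_le hΦ hy
  refine (OP.of_tendsto (tendsto_sqrt_avg_of_geometric (g := fun q t => transient Φ (y q) t i a ^ 4)
    (AllMoments.const 1) (hV.pow 4) h0 h1 fun q t => ?_)).tendsto_of_sqrt_mul
  rw [abs_pow]
  calc _ ≤ (V q * ρ ^ t) ^ 4 := pow_le_pow_left₀ (abs_nonneg _) (h q t i a) 4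
    _ = V q ^ 4 * (ρ ^ t) ^ 4 := mul_pow _ _ _
    _ ≤ V q ^ 4 * (ρ ^ t) ^ 1 :=
      mul_le_mul_of_nonneg_left (pow_le_pow_of_le_one (pow_nonneg h0.le t)
        (pow_le_one₀ h0.le h1.le) (by norm_num)) (by positivity)
    _ = _ := by rw [abs_one]; ring

end Transient


/-- Adjugate and determinant are continuous, and the limiting determinant is not 0. -/
lemma tendsto_matrix_inv {n ι : Type*} [Fintype n] [DecidableEq n] {f : Filter ι}
    {M : ι → Matrix n n ℝ} {A : Matrix n n ℝ} (h : Tendsto M f (𝓝 A)) (hA : IsUnit A.det) :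
    Tendsto (fun i => (M i)⁻¹) f (𝓝 A⁻¹) := by
  simp only [Matrix.inv_def, Ring.inverse_eq_inv']
  have hdet : Tendsto (fun i => (M i).det) f (𝓝 A.det) :=
    (continuous_id.matrix_det.tendsto A).comp h
  have hadj : Tendsto (fun i => (M i).adjugate) f (𝓝 A.adjugate) :=
    (continuous_id.matrix_adjugate.tendsto A).comp h
  exact (hdet.inv₀ hA.ne_zero).smul hadj

/-! ### Consistency and rates of the estimators -/

section Estimators

variable {N J : ℕ} {Ω : ℕ → Type*} {mΩ : ∀ T, MeasurableSpace (Ω T)} {P : ∀ T, Measure (Ω T)}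

/-- A sequence of samples from panel models, with the limits of the parameters and of the second
moments. -/
structure IsSample (P : ∀ T, Measure (Ω T)) (e : ∀ T, ℕ → Ω T → Shock N J)
    (Φ : Matrix (Fin (J + 1)) (Fin (J + 1)) ℝ) (μ : Fin N → Fin (J + 1) → ℝ)
    (b : Fin (J + 1) → ℝ) (μZ varZ : ℝ) (δT : ℕ → ℝ) (δ : ℝ)
    (ST : ℕ → Matrix (Fin N × Fin (J + 1)) (Fin N × Fin (J + 1)) ℝ)
    (Sig : Matrix (Fin N × Fin (J + 1)) (Fin N × Fin (J + 1)) ℝ)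
    (Q : Fin N → Fin N → Matrix (Fin (J + 1)) (Fin (J + 1)) ℝ)
    (x : (Σ T, Ω T) → Fin N → ℕ → Fin (J + 1) → ℝ) (Z : (Σ T, Ω T) → Fin N → ℕ → ℝ) : Prop where
  shock : IsShock P e b varZ δT ST
  stable : ∀ z ∈ spectrum ℂ (Φ.map (algebraMap ℝ ℂ)), ‖z‖ < 1
  path : ∀ᶠ q in inProb P, IsPath Φ μ μZ (x q) (Z q) fun t => e q.1 t q.2
  init : ∀ i a, OP P fun q => (x q i 0 - μ i) a
  units : 0 < N
  lim_δ : Tendsto δT atTop (𝓝 δ)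
  lim_S : Tendsto ST atTop (𝓝 Sig)
  pos : Sig.PosDef
  moment : IsSecondMoment P e Φ Sig Q

namespace IsSample

variable {e : ∀ T, ℕ → Ω T → Shock N J}
  {Φ : Matrix (Fin (J + 1)) (Fin (J + 1)) ℝ} {μ : Fin N → Fin (J + 1) → ℝ}
  {b : Fin (J + 1) → ℝ} {μZ varZ : ℝ} {δT : ℕ → ℝ} {δ : ℝ}
  {ST : ℕ → Matrix (Fin N × Fin (J + 1)) (Fin N × Fin (J + 1)) ℝ}
  {Sig : Matrix (Fin N × Fin (J + 1)) (Fin N × Fin (J + 1)) ℝ}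
  {Q : Fin N → Fin N → Matrix (Fin (J + 1)) (Fin (J + 1)) ℝ}
  {x : (Σ T, Ω T) → Fin N → ℕ → Fin (J + 1) → ℝ} {Z : (Σ T, Ω T) → Fin N → ℕ → ℝ}

lemma eventually_path (h : IsSample P e Φ μ b μZ varZ δT δ ST Sig Q x Z) :
    ∀ᶠ q in inProb P, IsPath Φ μ μZ (x q) (Z q) (fun t => e q.1 t q.2) ∧ q.1 ≠ 0 := by
  filter_upwards [h.path, tendsto_fst_inProb.eventually (eventually_gt_atTop 0)] with q h1 h2
  exact ⟨h1, h2.ne'⟩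

variable [∀ T, IsProbabilityMeasure (P T)]

lemma mom_w (h : IsSample P e Φ μ b μZ varZ δT δ ST Sig Q x Z) (i : Fin N) (a : Fin (J + 1)) :
    AllMoments P fun T t ω => linProc Φ (fun s => e T s ω) t i a :=
  allMoments_linProc h.stable h.shock.mom_u i a

lemma tendsto_sqrt_avg_mul_state_sub (h : IsSample P e Φ μ b μZ varZ δT δ ST Sig Q x Z)
    {f : ∀ T, ℕ → Ω T → ℝ} (hf : AllMoments P f) (i : Fin N) (a : Fin (J + 1)) :
    Tendsto (fun q => Real.sqrt q.1 * avg q.1 (fun t => f q.1 t q.2 *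
        state Φ (fun t => e q.1 t q.2) (fun i => x q i 0 - μ i) t i a)
      - Real.sqrt q.1 * avg q.1 (fun t => f q.1 t q.2 * linProc Φ (fun t => e q.1 t q.2) t i a))
      (inProb P) (𝓝 0) := by
  refine (tendsto_sqrt_avg_mul_transient h.stable h.init hf i a).congr fun q => ?_
  rw [← mul_sub, ← avg_sub]
  congr 2
  ext t
  rw [state]
  ring

lemma op_sqrt_avg_state (h : IsSample P e Φ μ b μZ varZ δT δ ST Sig Q x Z) (i : Fin N)
    (a : Fin (J + 1)) : OP P fun q => Real.sqrt q.1 * avg q.1 fun t =>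
      state Φ (fun t => e q.1 t q.2) (fun i => x q i 0 - μ i) t i a := by
  have h1 := (OP.of_tendsto (h.tendsto_sqrt_avg_mul_state_sub (AllMoments.const 1) i a)).add
    (h.shock.op_w h.stable i a)
  simpa using h1

lemma tendsto_avg_state (h : IsSample P e Φ μ b μZ varZ δT δ ST Sig Q x Z) (i : Fin N)
    (a : Fin (J + 1)) : Tendsto (fun q => avg q.1 fun t =>
      state Φ (fun t => e q.1 t q.2) (fun i => x q i 0 - μ i) t i a) (inProb P) (𝓝 0) :=
  (h.op_sqrt_avg_state i a).tendsto_of_sqrt_mul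

lemma tendsto_avg_state_mul (h : IsSample P e Φ μ b μZ varZ δT δ ST Sig Q x Z) (i i' : Fin N)
    (a a' : Fin (J + 1)) : Tendsto (fun q => avg q.1 fun t =>
      state Φ (fun t => e q.1 t q.2) (fun i => x q i 0 - μ i) t i a
        * state Φ (fun t => e q.1 t q.2) (fun i => x q i 0 - μ i) t i' a')
      (inProb P) (𝓝 (Q i i' a a')) := by
  have hwr : ∀ (i i' : Fin N) (a a' : Fin (J + 1)), Tendsto (fun q => avg q.1 fun t =>
      linProc Φ (fun t => e q.1 t q.2) t i a * transient Φ (fun i => x q i 0 - μ i) t i' a')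
      (inProb P) (𝓝 0) := fun i i' a a' =>
    (OP.of_tendsto (tendsto_sqrt_avg_mul_transient h.stable h.init (h.mom_w i a) i'
      a')).tendsto_of_sqrt_mul
  have h1 := ((h.moment.tendsto i i' a a').add ((hwr i i' a a').add (hwr i' i a' a))).add
    (tendsto_avg_transient_mul h.stable h.init i i' a a')
  simp only [add_zero] at h1
  refine h1.congr fun q => ?_
  simp only [← avg_add]
  congr 1
  ext t
  simp only [state]
  ring

lemma tendsto_meanGram (h : IsSample P e Φ μ b μZ varZ δT δ ST Sig Q x Z) :
    Tendsto (fun q => meanGram q.1 (x q)) (inProb P) (𝓝 (∑ i, Q i i)) := by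
  refine tendsto_pi_nhds.2 fun a => tendsto_pi_nhds.2 fun c => ?_
  have h1 := tendsto_finsetSum Finset.univ fun i _ => (h.tendsto_avg_state_mul i i a c).sub
    ((h.tendsto_avg_state i a).mul (h.tendsto_avg_state i c))
  simp only [mul_zero, sub_zero] at h1
  rw [Matrix.sum_apply]
  refine h1.congr' ?_
  filter_upwards [h.eventually_path] with q hq
  rw [hq.1.meanGram_eq hq.2]

lemma isUnit_det (h : IsSample P e Φ μ b μZ varZ δT δ ST Sig Q x Z) : IsUnit (∑ i, Q i i).det :=
  h.moment.isUnit_det_sum h.units h.pos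

lemma tendsto_inv_meanGram (h : IsSample P e Φ μ b μZ varZ δT δ ST Sig Q x Z) :
    Tendsto (fun q => (meanGram q.1 (x q))⁻¹) (inProb P) (𝓝 (∑ i, Q i i)⁻¹) :=
  tendsto_matrix_inv h.tendsto_meanGram h.isUnit_det

lemma eventually_isUnit (h : IsSample P e Φ μ b μZ varZ δT δ ST Sig Q x Z) :
    ∀ᶠ q in inProb P, IsUnit (meanGram q.1 (x q)).det := by
  have h1 : Tendsto (fun q => (meanGram q.1 (x q)).det) (inProb P) (𝓝 (∑ i, Q i i).det) :=
    (continuous_id.matrix_det.tendsto _).comp h.tendsto_meanGram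
  filter_upwards [h1.eventually_ne h.isUnit_det.ne_zero] with q hq
  exact isUnit_iff_ne_zero.2 hq

/-- Demeaning costs √T times the product of two means, the first of order T^(-1/2) and the second
vanishing in probability; presample values cost a geometric tail. -/
lemma tendsto_sqrt_crossMoment_sub (h : IsSample P e Φ μ b μZ varZ δT δ ST Sig Q x Z)
    (a c : Fin (J + 1)) : Tendsto (fun q => Real.sqrt q.1 *
        crossMoment q.1 (x q) (fun t => e q.1 t q.2) a c
      - Real.sqrt q.1 * ∑ i, avg q.1 fun t =>
        (e q.1 t q.2 i).2 a * linProc Φ (fun t => e q.1 t q.2) t i c) (inProb P) (𝓝 0) := by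
  have h1 := tendsto_finsetSum Finset.univ fun i _ =>
    (h.tendsto_sqrt_avg_mul_state_sub (h.shock.mom_u i a) i c).sub
      ((h.shock.op_u i a).mul_tendsto (h.tendsto_avg_state i c))
  simp only [sub_zero, Finset.sum_const_zero] at h1
  refine h1.congr' ?_
  filter_upwards [h.eventually_path] with q hq
  rw [hq.1.crossMoment_eq hq.2, Finset.mul_sum, Finset.mul_sum, ← Finset.sum_sub_distrib]
  exact Finset.sum_congr rfl fun i _ => by ring

lemma op_sqrt_crossMoment (h : IsSample P e Φ μ b μZ varZ δT δ ST Sig Q x Z)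
    (a c : Fin (J + 1)) : OP P fun q => Real.sqrt q.1 *
        crossMoment q.1 (x q) (fun t => e q.1 t q.2) a c := by
  have h1 := (OP.of_tendsto (h.tendsto_sqrt_crossMoment_sub a c)).add
    (OP.sum Finset.univ fun i _ => h.shock.op_wu h.stable i c i a)
  refine h1.mono fun q => le_of_eq ?_
  congr 1
  rw [← Finset.mul_sum]
  simp only [mul_comm ((e q.1 _ q.2 _).2 a), sub_add_cancel]

lemma eventually_phiHat (h : IsSample P e Φ μ b μZ varZ δT δ ST Sig Q x Z) :
    ∀ᶠ q in inProb P, phiHat q.1 (x q) - Φ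
      = crossMoment q.1 (x q) (fun t => e q.1 t q.2) * (meanGram q.1 (x q))⁻¹ := by
  filter_upwards [h.eventually_path, h.eventually_isUnit] with q hq hu
  rw [hq.1.phiHat_eq hq.2 hu, add_sub_cancel_left]

lemma op_sqrt_phiHat (h : IsSample P e Φ μ b μZ varZ δT δ ST Sig Q x Z) (a c : Fin (J + 1)) :
    OP P fun q => Real.sqrt q.1 * (phiHat q.1 (x q) - Φ) a c := by
  have h1 : OP P fun q => ∑ b, (Real.sqrt q.1 *
      crossMoment q.1 (x q) (fun t => e q.1 t q.2) a b) * (meanGram q.1 (x q))⁻¹ b c :=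
    OP.sum _ fun b _ => (h.op_sqrt_crossMoment a b).mul (OP.of_tendsto
      (tendsto_pi_nhds.1 (tendsto_pi_nhds.1 h.tendsto_inv_meanGram b) c))
  refine h1.mono_of_eventually ?_
  filter_upwards [h.eventually_phiHat] with q hq
  rw [hq, Matrix.mul_apply, Finset.mul_sum]
  simp only [mul_assoc, le_refl]

lemma tendsto_phiHat_sub (h : IsSample P e Φ μ b μZ varZ δT δ ST Sig Q x Z) (a c : Fin (J + 1)) :
    Tendsto (fun q => (phiHat q.1 (x q) - Φ) a c) (inProb P) (𝓝 0) :=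
  (h.op_sqrt_phiHat a c).tendsto_of_sqrt_mul

lemma tendsto_phiHat (h : IsSample P e Φ μ b μZ varZ δT δ ST Sig Q x Z) :
    Tendsto (fun q => phiHat q.1 (x q)) (inProb P) (𝓝 Φ) := by
  refine tendsto_pi_nhds.2 fun a => tendsto_pi_nhds.2 fun c => ?_
  have := (h.tendsto_phiHat_sub a c).add_const (Φ a c)
  simpa using this

/-- Residuals may be replaced by disturbances: the correction is √T(Φ̂ - Φ), bounded in probability,
times the sample covariance of the instrument with the lagged regressors, which tends to 0 because
the centred instrument is independent of past shocks. Estimating Φ thus enters the limit only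
through the gradient in Φ. -/
lemma tendsto_sqrt_gammaHat_sub (h : IsSample P e Φ μ b μZ varZ δT δ ST Sig Q x Z)
    (a : Fin (J + 1)) : Tendsto (fun q => Real.sqrt q.1 * gammaHat q.1 (x q) (Z q) a
      - Real.sqrt q.1 * ((N : ℝ)⁻¹ * ∑ i, avg q.1 fun t => (e q.1 t q.2 i).1 * (e q.1 t q.2 i).2 a))
      (inProb P) (𝓝 0) := by
  have hz := fun i => (h.shock.op_z i).tendsto_of_sqrt_mul
  have hzs : ∀ i c, Tendsto (fun q => avg q.1 fun t => (e q.1 t q.2 i).1 *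
      state Φ (fun t => e q.1 t q.2) (fun i => x q i 0 - μ i) t i c) (inProb P) (𝓝 0) := fun i c => by
    have h1 := (OP.of_tendsto (h.tendsto_sqrt_avg_mul_state_sub (h.shock.mom_z i) i c)).add
      (h.shock.op_wz h.stable i c i)
    refine OP.tendsto_of_sqrt_mul (h1.mono fun q => le_of_eq ?_)
    congr 1
    simp only [mul_comm (e q.1 _ q.2 i).1, sub_add_cancel]
  have h1 := (tendsto_finsetSum Finset.univ fun i _ =>
    (((h.shock.op_u i a).mul_tendsto (hz i)).add (tendsto_finsetSum Finset.univ fun c _ =>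
      (h.op_sqrt_phiHat a c).mul_tendsto ((hzs i c).sub
        ((hz i).mul (h.tendsto_avg_state i c)) |>.trans (by simp))))).const_mul (-(N : ℝ)⁻¹)
  simp only [add_zero, Finset.sum_const_zero, mul_zero] at h1
  refine h1.congr' ?_
  filter_upwards [h.eventually_path] with q hq
  rw [hq.1.gammaHat_eq hq.2, ← mul_assoc, ← mul_assoc, Finset.mul_sum, Finset.mul_sum,
    Finset.mul_sum, ← Finset.sum_sub_distrib]
  refine Finset.sum_congr rfl fun i _ => ?_
  rw [← sub_eq_zero]
  simp only [mul_assoc (Real.sqrt q.1), ← Finset.mul_sum]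
  ring

lemma tendsto_gammaHat (h : IsSample P e Φ μ b μZ varZ δT δ ST Sig Q x Z) :
    Tendsto (fun q => gammaHat q.1 (x q) (Z q)) (inProb P) (𝓝 (δ • b)) := by
  refine tendsto_pi_nhds.2 fun a => ?_
  have h1 := (OP.of_tendsto ((h.tendsto_sqrt_gammaHat_sub a).congr fun q =>
    (mul_sub _ _ _).symm)).tendsto_of_sqrt_mul
  have h2 := (tendsto_finsetSum Finset.univ fun i _ =>
    h.shock.tendsto_avg_zu h.lim_δ i a).const_mul (N : ℝ)⁻¹
  have h3 := h1.add h2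
  have hN : (N : ℝ) ≠ 0 := Nat.cast_ne_zero.2 h.units.ne'
  simp only [sub_add_cancel, zero_add, Finset.sum_const, Finset.card_univ, Fintype.card_fin,
    nsmul_eq_mul] at h3
  rw [← mul_assoc, inv_mul_cancel₀ hN, one_mul] at h3
  simpa using h3

end IsSample

end Estimators


/-! ### Continuity of the gap and its gradients -/

section Continuity

variable {J : ℕ} {k : ℕ} {s : Fin (J + 1)} {l : ℝ} {ι : Type*} {f : Filter ι}
  {F G : ι → Matrix (Fin (J + 1)) (Fin (J + 1)) ℝ} {F₀ G₀ : Matrix (Fin (J + 1)) (Fin (J + 1)) ℝ}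
  {Γ : ι → Fin (J + 1) → ℝ} {Γ₀ : Fin (J + 1) → ℝ}

lemma tendsto_sens (hF : Tendsto F f (𝓝 F₀)) (hG : Tendsto G f (𝓝 G₀)) (hΓ : Tendsto Γ f (𝓝 Γ₀)) :
    Tendsto (fun i => sens k s (F i) (G i) (Γ i)) f (𝓝 (sens k s F₀ G₀ Γ₀)) := by
  refine tendsto_pi_nhds.2 fun a => tendsto_pi_nhds.2 fun b => ?_
  refine tendsto_finsetSum _ fun j _ => Tendsto.mul ?_ ?_
  · exact tendsto_pi_nhds.1 (tendsto_pi_nhds.1 (hF.pow j) s) a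
  · have hc : Continuous fun p : Matrix (Fin (J + 1)) (Fin (J + 1)) ℝ × (Fin (J + 1) → ℝ) =>
        p.1.mulVec p.2 := continuous_fst.matrix_mulVec continuous_snd
    exact tendsto_pi_nhds.1 ((hc.tendsto (G₀ ^ (k - 1 - j), Γ₀)).comp
      ((hG.pow (k - 1 - j)).prodMk_nhds hΓ)) b

lemma tendsto_dvec (hF : Tendsto F f (𝓝 F₀)) (a : Fin (J + 1)) :
    Tendsto (fun i => dvec k s l (F i) a) f (𝓝 (dvec k s l F₀ a)) :=
  (tendsto_pi_nhds.1 (tendsto_pi_nhds.1 (hF.pow k) s) a).sub_const _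

lemma tendsto_gap (hF : Tendsto F f (𝓝 F₀)) (hΓ : Tendsto Γ f (𝓝 Γ₀)) :
    Tendsto (fun i => gap k s l (F i) (Γ i)) f (𝓝 (gap k s l F₀ Γ₀)) := by
  simp only [gap_eq]
  exact tendsto_finsetSum _ fun a _ => (tendsto_dvec hF a).mul (tendsto_pi_nhds.1 hΓ a)

end Continuity

/-! ### Asymptotic linearity and approximation of the scores -/

section Linearisation

variable {N J : ℕ} {Ω : ℕ → Type*} {mΩ : ∀ T, MeasurableSpace (Ω T)} {P : ∀ T, Measure (Ω T)}

lemma Approx.congr' {p : ℕ} {f f' g : (Σ T, Ω T) → ℕ → ℝ} (h : Approx P p f g)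
    (hf : ∀ᶠ q in inProb P, f q = f' q) : Approx P p f' g where
  close := h.close.congr' <| by filter_upwards [hf] with q hq; simp only [hq]
  bdd := h.bdd

/-- Brings the statistic into the shape of `score_eq`, so that the two can be compared factor by
factor. -/
lemma stat_eq (Φ A : Matrix (Fin (J + 1)) (Fin (J + 1)) ℝ) (d : Fin (J + 1) → ℝ)
    (e : ∀ T, ℕ → Ω T → Shock N J) (T t : ℕ) (ω : Ω T) :
    LinStat.stat e disturbance (instrTerm N d) (lagCoef Φ A e) T t ω
      = (∑ a, ∑ c, A a c * ∑ i, (e T t ω i).2 a * linProc Φ (fun t => e T t ω) t i c)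
        + ∑ a, d a * ((N : ℝ)⁻¹ * ∑ i, (e T t ω i).1 * (e T t ω i).2 a) := by
  rw [LinStat.stat]
  congr 1
  · rw [Fintype.sum_prod_type, Finset.sum_comm]
    refine Finset.sum_congr rfl fun a _ => ?_
    simp only [lagCoef, disturbance, Finset.sum_mul, Finset.mul_sum]
    rw [Finset.sum_comm]
    exact Finset.sum_congr rfl fun c _ => Finset.sum_congr rfl fun i _ => by ring
  · simp only [instrTerm, Finset.mul_sum]
    rw [Finset.sum_comm]
    exact Finset.sum_congr rfl fun c _ => Finset.sum_congr rfl fun i _ => by ring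

namespace IsSample

variable {e : ∀ T, ℕ → Ω T → Shock N J}
  {Φ : Matrix (Fin (J + 1)) (Fin (J + 1)) ℝ} {μ : Fin N → Fin (J + 1) → ℝ}
  {b : Fin (J + 1) → ℝ} {μZ varZ : ℝ} {δT : ℕ → ℝ} {δ : ℝ}
  {ST : ℕ → Matrix (Fin N × Fin (J + 1)) (Fin N × Fin (J + 1)) ℝ}
  {Sig : Matrix (Fin N × Fin (J + 1)) (Fin N × Fin (J + 1)) ℝ}
  {Q : Fin N → Fin N → Matrix (Fin (J + 1)) (Fin (J + 1)) ℝ}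
  {x : (Σ T, Ω T) → Fin N → ℕ → Fin (J + 1) → ℝ} {Z : (Σ T, Ω T) → Fin N → ℕ → ℝ}
  [∀ T, IsProbabilityMeasure (P T)] {k : ℕ} {s : Fin (J + 1)} {l : ℝ}

lemma tendsto_sens_mul (h : IsSample P e Φ μ b μZ varZ δT δ ST Sig Q x Z)
    {F G : (Σ T, Ω T) → Matrix (Fin (J + 1)) (Fin (J + 1)) ℝ}
    (hF : Tendsto F (inProb P) (𝓝 Φ)) (hG : Tendsto G (inProb P) (𝓝 Φ)) (a c : Fin (J + 1)) :
    Tendsto (fun q => (sens k s (F q) (G q) (gammaHat q.1 (x q) (Z q))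
        * ((meanGram q.1 (x q))⁻¹).transpose) a c) (inProb P)
      (𝓝 ((sens k s Φ Φ (δ • b) * ((∑ i, Q i i)⁻¹).transpose) a c)) := by
  have hi := ((Continuous.matrix_transpose continuous_id).tendsto (∑ i, Q i i)⁻¹).comp
    h.tendsto_inv_meanGram
  exact tendsto_pi_nhds.1 (tendsto_pi_nhds.1
    ((tendsto_sens hF hG h.tendsto_gammaHat).mul hi) a) c

/-- The statistic is asymptotically linear. -/
lemma tendsto_statistic_sub (h : IsSample P e Φ μ b μZ varZ δT δ ST Sig Q x Z) :
    Tendsto (fun q => G q.1 (x q) (Z q) k s l - Real.sqrt q.1 * avg q.1 fun t =>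
      LinStat.stat e disturbance (instrTerm N (dvec k s l Φ))
        (lagCoef Φ (sens k s Φ Φ (δ • b) * ((∑ i, Q i i)⁻¹).transpose) e) q.1 t q.2)
      (inProb P) (𝓝 0) := by
  set A := sens k s Φ Φ (δ • b) * ((∑ i, Q i i)⁻¹).transpose with hA
  -- The coefficients form the exact difference quotient between Φ̂ and Φ times the inverse Gram
  -- matrix. Their error tends to 0 and multiplies the √T-scaled cross moment, which is bounded in
  -- probability.
  have hA' := fun a c => (h.tendsto_sens_mul (k := k) (s := s) h.tendsto_phiHat
    (tendsto_const_nhds (x := Φ)) a c).sub_const (A a c)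
  simp only [← hA, sub_self] at hA'
  have h1 := (tendsto_finsetSum Finset.univ fun a _ => tendsto_finsetSum Finset.univ fun c _ =>
      ((h.op_sqrt_crossMoment a c).mul_tendsto (hA' a c)).add
        ((h.tendsto_sqrt_crossMoment_sub a c).const_mul (A a c))).add
    (tendsto_finsetSum Finset.univ fun a _ =>
      (h.tendsto_sqrt_gammaHat_sub a).const_mul (dvec k s l Φ a))
  simp only [mul_zero, add_zero, Finset.sum_const_zero] at h1
  refine h1.congr' ?_
  filter_upwards [h.eventually_phiHat] with q hq
  have h2 : avg q.1 (fun t => LinStat.stat e disturbance (instrTerm N (dvec k s l Φ))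
      (lagCoef Φ A e) q.1 t q.2)
      = (∑ a, ∑ c, A a c * ∑ i, avg q.1 fun t =>
          (e q.1 t q.2 i).2 a * linProc Φ (fun t => e q.1 t q.2) t i c)
        + ∑ a, dvec k s l Φ a * ((N : ℝ)⁻¹ * ∑ i, avg q.1 fun t =>
          (e q.1 t q.2 i).1 * (e q.1 t q.2 i).2 a) := by
    simp only [stat_eq, avg_add, avg_sum, avg_const_mul]
  rw [G, h2, gap_eq_frob_add _ Φ, hq, frob_mul, gap_eq, frob]
  rw [mul_add, mul_add, add_sub_add_comm]
  simp only [Finset.mul_sum (Finset.univ : Finset (Fin (J + 1))), ← Finset.sum_sub_distrib]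
  congr 1
  · exact Finset.sum_congr rfl fun a _ => Finset.sum_congr rfl fun c _ => by ring
  · exact Finset.sum_congr rfl fun a _ => by ring

lemma approx_transient (h : IsSample P e Φ μ b μZ varZ δT δ ST Sig Q x Z) (i : Fin N)
    (a : Fin (J + 1)) :
    Approx P 4 (fun q t => transient Φ (fun i => x q i 0 - μ i) t i a) fun _ _ => 0 where
  close := by
    simp only [sub_zero]
    exact tendsto_avg_transient_pow_four h.stable h.init i a
  bdd := by simpa [avg] using OP.const (P := P) 0

lemma approx_regressor (h : IsSample P e Φ μ b μZ varZ δT δ ST Sig Q x Z) (i : Fin N)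
    (a : Fin (J + 1)) : Approx P 4 (fun q t => regressor q.1 (x q) i t a)
      fun q t => linProc Φ (fun t => e q.1 t q.2) t i a := by
  have hc := (h.tendsto_avg_state i a).neg
  rw [neg_zero] at hc
  have h1 := (Approx.refl (by norm_num) ((h.mom_w i a).pow 4).op_average).add ⟨2, rfl⟩
    ((h.approx_transient i a).add ⟨2, rfl⟩ (Approx.const (by norm_num) hc))
  simp only [add_zero] at h1
  refine h1.congr' ?_
  filter_upwards [h.eventually_path] with q hq
  ext t
  rw [hq.1.regressor_eq hq.2, state]
  ring

lemma approx_instrument (h : IsSample P e Φ μ b μZ varZ δT δ ST Sig Q x Z) (i : Fin N) :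
    Approx P 4 (fun q t => instrument q.1 (Z q) i t) fun q t => (e q.1 t q.2 i).1 := by
  have hc := (h.shock.op_z i).tendsto_of_sqrt_mul.neg
  rw [neg_zero] at hc
  have h1 := (Approx.refl (by norm_num) ((h.shock.mom_z i).pow 4).op_average).add ⟨2, rfl⟩
    (Approx.const (by norm_num) hc)
  simp only [add_zero] at h1
  refine h1.congr' ?_
  filter_upwards [h.eventually_path] with q hq
  ext t
  rw [hq.1.instrument_eq hq.2]
  ring

/-- The residual differs from the disturbance by a vanishing mean and by regressors with
coefficients Φ - Φ̂, which tend to 0. -/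
lemma approx_residual (h : IsSample P e Φ μ b μZ varZ δT δ ST Sig Q x Z) (i : Fin N)
    (a : Fin (J + 1)) : Approx P 4 (fun q t => residual q.1 (x q) i t a)
      fun q t => (e q.1 t q.2 i).2 a := by
  have hc := (h.shock.op_u i a).tendsto_of_sqrt_mul.neg
  rw [neg_zero] at hc
  have hH := fun c => (h.tendsto_phiHat_sub a c).neg
  rw [neg_zero] at hH
  have h1 := (Approx.refl (by norm_num) ((h.shock.mom_u i a).pow 4).op_average).add ⟨2, rfl⟩
    ((Approx.const (by norm_num) hc).add ⟨2, rfl⟩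
      (Approx.sum ⟨2, rfl⟩ (by norm_num) Finset.univ fun c _ =>
        (h.approx_regressor i c).smul ⟨2, rfl⟩ (hH c)))
  simp only [add_zero, zero_mul, Finset.sum_const_zero] at h1
  refine h1.congr' ?_
  filter_upwards [h.eventually_path] with q hq
  ext t
  rw [hq.1.residual_eq hq.2]
  simp only [neg_mul, Finset.sum_neg_distrib]
  ring

lemma approx_score (h : IsSample P e Φ μ b μZ varZ δT δ ST Sig Q x Z)
    (hd : ∑ a, dvec k s l Φ a * b a = 0) :
    Approx P 2 (fun q t => score q.1 (x q) (Z q) k s l t) fun q t =>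
      LinStat.stat e disturbance (instrTerm N (dvec k s l Φ))
        (lagCoef Φ (sens k s Φ Φ (δ • b) * ((∑ i, Q i i)⁻¹).transpose) e) q.1 t q.2 := by
  have hg := (tendsto_gap (k := k) (s := s) (l := l) h.tendsto_phiHat h.tendsto_gammaHat).neg
  -- The centring of the instrument contribution at Γ̂ becomes the gap at the estimates, whose limit
  -- is δ d'b = 0.
  have h0 : gap k s l Φ (δ • b) = 0 := by
    rw [gap_eq]
    simp only [Pi.smul_apply, smul_eq_mul, mul_left_comm _ δ, ← Finset.mul_sum, hd, mul_zero]
  rw [h0, neg_zero] at hg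
  have h1 := ((Approx.sum even_two (by norm_num) Finset.univ fun a _ =>
      Approx.sum even_two (by norm_num) Finset.univ fun c _ =>
        (Approx.sum even_two (by norm_num) Finset.univ fun i _ =>
          (h.approx_residual i a).mul (h.approx_regressor i c)).smul even_two
            (h.tendsto_sens_mul (k := k) (s := s) h.tendsto_phiHat h.tendsto_phiHat a c)).add
      even_two (Approx.sum even_two (by norm_num) Finset.univ fun a _ =>
        ((Approx.sum even_two (by norm_num) Finset.univ fun i _ =>
          (h.approx_instrument i).mul (h.approx_residual i a)).smul even_two
            (tendsto_const_nhds (x := (N : ℝ)⁻¹))).smul even_two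
              (tendsto_dvec (k := k) (s := s) (l := l) h.tendsto_phiHat a))).add even_two
    (Approx.const (by norm_num) hg)
  simp only [add_zero, ← stat_eq, ← score_eq] at h1
  exact h1

end IsSample

end Linearisation



/-! ### Coverage of the Anderson–Rubin set -/

namespace IsSample

variable {N J : ℕ} {Ω : ℕ → Type*} {mΩ : ∀ T, MeasurableSpace (Ω T)} {P : ∀ T, Measure (Ω T)}
  {e : ∀ T, ℕ → Ω T → Shock N J}
  {Φ : Matrix (Fin (J + 1)) (Fin (J + 1)) ℝ} {μ : Fin N → Fin (J + 1) → ℝ}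
  {b : Fin (J + 1) → ℝ} {μZ varZ : ℝ} {δT : ℕ → ℝ} {δ : ℝ}
  {ST : ℕ → Matrix (Fin N × Fin (J + 1)) (Fin N × Fin (J + 1)) ℝ}
  {Sig : Matrix (Fin N × Fin (J + 1)) (Fin N × Fin (J + 1)) ℝ}
  {Q : Fin N → Fin N → Matrix (Fin (J + 1)) (Fin (J + 1)) ℝ}
  {x : (Σ T, Ω T) → Fin N → ℕ → Fin (J + 1) → ℝ} {Z : (Σ T, Ω T) → Fin N → ℕ → ℝ}
  [∀ T, IsProbabilityMeasure (P T)] {k : ℕ} {s : Fin (J + 1)} {l : ℝ}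

/-- Asymptotic validity of the Anderson–Rubin set. -/
lemma tendsto_coverage (h : IsSample P e Φ μ b μZ varZ δT δ ST Sig Q x Z) (hvarZ : 0 < varZ)
    (hd : ∑ a, dvec k s l Φ a * b a = 0)
    (hAd : sens k s Φ Φ (δ • b) * ((∑ i, Q i i)⁻¹).transpose ≠ 0 ∨ dvec k s l Φ ≠ 0)
    {α : ℝ} (hα0 : 0 < α) (hα1 : α < 1) :
    Tendsto (fun T => (P T).real {ω | l ∈ arSet T (x ⟨T, ω⟩) (Z ⟨T, ω⟩) k s α}) atTop
      (𝓝 (1 - α)) := by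
  set A := sens k s Φ Φ (δ • b) * ((∑ i, Q i i)⁻¹).transpose with hA
  set d := dvec k s l Φ with hdd
  obtain ⟨c, hc, hcV⟩ := h.moment.exists_le_variance h.shock h.units hvarZ h.lim_S h.pos A hd hAd
  -- The second term may keep moving with T through the covariances of the instruments of different
  -- units, so V is carried as a sequence bounded away from 0.
  set V : ℕ → ℝ := fun T => slopeVar A Q Sig + ∫ ω, instrTerm N d (e T 0 ω) ^ 2 ∂(P T) with hV
  have hlin := h.shock.linStat h.stable A hd
  have hcond := h.moment.tendsto_condVar h.shock h.stable h.lim_S A hd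
  set L : (Σ T, Ω T) → ℝ := fun q => Real.sqrt q.1 * avg q.1 fun t =>
    LinStat.stat e disturbance (instrTerm N d) (lagCoef Φ A e) q.1 t q.2 with hL
  set z := normalQuantile (1 - α / 2) with hz
  have hz0 : 0 < z := normalQuantile_pos (by linarith) (by linarith)
  have hcVq : ∀ᶠ q in inProb P, c ≤ V q.1 := tendsto_fst_inProb.eventually hcV
  have hG : Tendsto (fun q => PSVARIV.G q.1 (x q) (Z q) k s l - L q) (inProb P) (𝓝 0) := by
    simp only [hL, hA, hdd]
    exact h.tendsto_statistic_sub
  have hvar : Tendsto (fun q => varHat q.1 (x q) (Z q) k s l - V q.1) (inProb P) (𝓝 0) := by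
    have h1 := ((h.approx_score hd).tendsto_avg_sq_sub).add (hlin.tendsto_avg_sq (V := V) hcond)
    simp only [add_zero] at h1
    refine h1.congr fun q => ?_
    rw [sub_add_sub_cancel]
    rfl
  have hinv : OP P fun q => (V q.1)⁻¹ := by
    refine (OP.const c⁻¹).mono_of_eventually ?_
    filter_upwards [hcVq] with q hq
    rw [abs_of_pos (inv_pos.2 (hc.trans_le hq)), abs_of_pos (inv_pos.2 hc)]
    exact inv_anti₀ hc hq
  have hratio : Tendsto (fun q => Real.sqrt (varHat q.1 (x q) (Z q) k s l / V q.1)) (inProb P)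
      (𝓝 1) := by
    have h1 := ((hinv.mul_tendsto hvar).add_const 1).sqrt
    rw [zero_add, Real.sqrt_one] at h1
    refine h1.congr' ?_
    filter_upwards [hcVq] with q hq
    have : V q.1 ≠ 0 := (hc.trans_le hq).ne'
    congr 1
    field_simp
    ring
  have hstat : Tendsto (fun q => |G q.1 (x q) (Z q) k s l / Real.sqrt (V q.1)|
      - |L q / Real.sqrt (V q.1)|) (inProb P) (𝓝 0) := by
    have hinv' : OP P fun q => (Real.sqrt (V q.1))⁻¹ := by
      refine OP.of_sq (hinv.mono_of_eventually ?_)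
      filter_upwards [hcVq] with q hq
      rw [inv_pow, Real.sq_sqrt (hc.le.trans hq)]
    have h1 := (hinv'.mul_tendsto hG).abs
    rw [abs_zero] at h1
    refine squeeze_zero_norm (fun q => ?_) h1
    refine (abs_abs_sub_abs_le _ _).trans (le_of_eq ?_)
    rw [← sub_div, div_eq_inv_mul]
  set F : ℝ → ℝ := fun c => (gaussianReal 0 1).real (Set.Icc (-c) c) with hF
  have hFc : ∀ c, 0 ≤ c → F c = 2 * cdf (gaussianReal 0 1) c - 1 := fun c hc =>
    gaussianReal_real_Icc hc
  have hFz : F z = 1 - α := by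
    rw [hFc z hz0.le, hz, cdf_normalQuantile (by linarith) (by linarith)]
    ring
  have hFcont : ContinuousAt F z := by
    have h1 : Continuous fun c => 2 * cdf (gaussianReal 0 1) c - 1 :=
      (continuous_cdf_gaussianReal.const_mul 2).sub continuous_const
    refine h1.continuousAt.congr ?_
    filter_upwards [lt_mem_nhds hz0] with c hc
    exact (hFc c hc.le).symm
  rw [← hFz]
  -- Coverage means |G|/√V ≤ z √(v̂/V). The linearisation error and the error in the ratio of
  -- variances are both collected in R, leaving the fixed threshold z.
  refine tendsto_measureReal_of_add (S := fun q => |L q / Real.sqrt (V q.1)|)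
    (R := fun q => (|G q.1 (x q) (Z q) k s l / Real.sqrt (V q.1)| - |L q / Real.sqrt (V q.1)|)
      + z * (1 - Real.sqrt (varHat q.1 (x q) (Z q) k s l / V q.1)))
    (A := {q | l ∈ arSet q.1 (x q) (Z q) k s α}) hFcont
    (fun c' => hlin.tendsto_measure_abs_le (V := V) hc hcV hcond c') ?_ ?_
  · have h1 := hstat.add ((hratio.const_sub 1).const_mul z)
    simpa using h1
  · filter_upwards [hcVq] with q hq
    have hV0 : 0 < V q.1 := hc.trans_le hq
    have hsV : 0 < Real.sqrt (V q.1) := Real.sqrt_pos.2 hV0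
    have hv0 : 0 ≤ varHat q.1 (x q) (Z q) k s l := avg_nonneg fun t => sq_nonneg _
    have h1 : z ^ 2 * varHat q.1 (x q) (Z q) k s l
        = (z * Real.sqrt (varHat q.1 (x q) (Z q) k s l)) ^ 2 := by
      rw [mul_pow, Real.sq_sqrt hv0]
    have h2 : l ∈ arSet q.1 (x q) (Z q) k s α
        ↔ |G q.1 (x q) (Z q) k s l| ≤ z * Real.sqrt (varHat q.1 (x q) (Z q) k s l) := by
      change G q.1 (x q) (Z q) k s l ^ 2 ≤ z ^ 2 * varHat q.1 (x q) (Z q) k s l ↔ _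
      rw [h1, sq_le_sq, abs_of_nonneg (mul_nonneg hz0.le (Real.sqrt_nonneg _))]
    have h3 : |G q.1 (x q) (Z q) k s l / Real.sqrt (V q.1)|
        = |G q.1 (x q) (Z q) k s l| / Real.sqrt (V q.1) := by rw [abs_div, abs_of_pos hsV]
    rw [h2, h3, Real.sqrt_div hv0, ← div_le_div_iff_of_pos_right hsV,
      ← sub_nonneg, ← sub_nonneg (b := _ + (_ + _))]
    refine iff_of_eq ?_
    congr 1
    ring

end IsSample


/-! ### Moments of centred Gaussian variables -/

section GaussianMoments

lemma _root_.ProbabilityTheory.HasGaussianLaw.sub_const {E Ω : Type*} [NormedAddCommGroup E]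
    [NormedSpace ℝ E] [MeasurableSpace E] [BorelSpace E] [SecondCountableTopology E]
    {mΩ : MeasurableSpace Ω} {P : Measure Ω} {X : Ω → E} (hX : HasGaussianLaw X P) (c : E) :
    HasGaussianLaw (fun ω => X ω - c) P where
  isGaussian_map := by
    have h1 := hX.isGaussian_map
    have h2 : P.map (fun ω => X ω - c) = (P.map X).map (fun x => x - c) :=
      (AEMeasurable.map_map_of_aemeasurable (g := fun x => x - c) (by fun_prop) hX.aemeasurable).symm
    rw [h2]
    infer_instance

variable {Ω : ℕ → Type*} {mΩ : ∀ T, MeasurableSpace (Ω T)} {P : ∀ T, Measure (Ω T)}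

/-- A centred Gaussian variable has the law of its standard deviation times a standard normal one,
so a bound on variances bounds every moment. -/
lemma allMoments_of_hasGaussianLaw {X : ∀ T, ℕ → Ω T → ℝ}
    (hX : ∀ T t, HasGaussianLaw (X T t) (P T)) (h0 : ∀ T t, ∫ ω, X T t ω ∂(P T) = 0) {B : ℝ}
    (hB : ∀ T t, Var[X T t; P T] ≤ B) : AllMoments P X := by
  refine ⟨fun T t => (hX T t).aemeasurable.aestronglyMeasurable, fun p => ?_⟩
  have hmem := memLp_id_gaussianReal (μ := 0) (v := 1) (p : NNReal)
  refine ⟨Real.toNNReal (Real.sqrt B)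
    * (eLpNorm id ((p : NNReal) : ENNReal) (gaussianReal 0 1)).toNNReal, fun T t => ?_⟩
  have h1 : eLpNorm (X T t) p (P T)
      = eLpNorm id p (gaussianReal 0 (Var[X T t; P T]).toNNReal) := by
    have := (hX T t).map_eq_gaussianReal
    rw [h0] at this
    rw [← this, eLpNorm_map_measure (by fun_prop) (hX T t).aemeasurable, Function.id_comp]
  have h2 : gaussianReal 0 (Var[X T t; P T]).toNNReal
      = (gaussianReal 0 1).map (fun x => Real.sqrt (Var[X T t; P T]) * x) := by
    rw [gaussianReal_map_const_mul, mul_zero, mul_one]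
    congr 1
    ext
    simp [Real.sq_sqrt (variance_nonneg _ _), variance_nonneg]
  rw [h1, h2, eLpNorm_map_measure (by fun_prop) (by fun_prop)]
  have h3 := eLpNorm_const_smul_le (c := Real.sqrt (Var[X T t; P T])) (f := (id : ℝ → ℝ))
    (p := (p : ENNReal)) (μ := gaussianReal 0 1)
  refine h3.trans ?_
  rw [ENNReal.coe_mul, ENNReal.coe_toNNReal (by exact hmem.2.ne)]
  refine mul_le_mul' ?_ (le_of_eq (by simp))
  rw [← ofReal_norm, Real.norm_of_nonneg (Real.sqrt_nonneg _)]
  exact ENNReal.ofReal_le_ofReal (Real.sqrt_le_sqrt (hB T t))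

end GaussianMoments

/-! ### Centred measurable shocks of the model -/

section Model

variable {N J : ℕ} {Ω : Type*} {mΩ : MeasurableSpace Ω} {P : Measure Ω}
  [IsProbabilityMeasure P] {Φ : Matrix (Fin (J + 1)) (Fin (J + 1)) ℝ}
  {μ : Fin N → Fin (J + 1) → ℝ} {β : Fin J → ℝ} {μZ varZ δ : ℝ}
  {S : Matrix (Fin N × Fin (J + 1)) (Fin N × Fin (J + 1)) ℝ}
  {x u : Fin N → ℕ → Ω → Fin (J + 1) → ℝ} {Z : Fin N → ℕ → Ω → ℝ}

namespace IsModel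

/-- The shocks of the model, with centred instruments, as measurable functions. -/
noncomputable def centredShock (h : IsModel P Φ μ β μZ varZ δ S x u Z) (t : ℕ) (ω : Ω) :
    Shock N J :=
  (h.gaussian t).aemeasurable.mk _ ω - fun _ => (μZ, 0)

lemma measurable_centredShock (h : IsModel P Φ μ β μZ varZ δ S x u Z) (t : ℕ) :
    Measurable (h.centredShock t) :=
  (h.gaussian t).aemeasurable.measurable_mk.sub_const _

/-- A Gaussian law gives only almost everywhere measurability, whereas the filtration `past` is
generated by measurable shocks. All properties of the model are transferred along this equality. -/
lemma centredShock_ae (h : IsModel P Φ μ β μZ varZ δ S x u Z) (t : ℕ) :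
    (fun ω => (fun i => (Z i (t + 1) ω, u i (t + 1) ω)) - fun _ : Fin N => (μZ, (0 : Fin (J + 1) → ℝ)))
      =ᵐ[P] h.centredShock t := by
  filter_upwards [(h.gaussian t).aemeasurable.ae_eq_mk] with ω hω
  rw [centredShock, ← hω]

lemma centredShock_fst (h : IsModel P Φ μ β μZ varZ δ S x u Z) (t : ℕ) :
    ∀ᵐ ω ∂P, ∀ i, (h.centredShock t ω i).1 = Z i (t + 1) ω - μZ := by
  filter_upwards [h.centredShock_ae t] with ω hω i
  rw [← hω]
  rfl

lemma centredShock_snd (h : IsModel P Φ μ β μZ varZ δ S x u Z) (t : ℕ) :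
    ∀ᵐ ω ∂P, ∀ i, (h.centredShock t ω i).2 = u i (t + 1) ω := by
  filter_upwards [h.centredShock_ae t] with ω hω i
  rw [← hω]
  simp

lemma hasGaussianLaw_centredShock (h : IsModel P Φ μ β μZ varZ δ S x u Z) (t : ℕ) :
    HasGaussianLaw (h.centredShock t) P :=
  ((h.gaussian t).sub_const _).congr (h.centredShock_ae t)

lemma iIndepFun_centredShock (h : IsModel P Φ μ β μZ varZ δ S x u Z) :
    iIndepFun h.centredShock P :=
  (h.indep.comp (fun _ y => y - fun _ => (μZ, 0)) fun _ => measurable_id.sub_const _).congr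
    h.centredShock_ae

lemma identDistrib_centredShock (h : IsModel P Φ μ β μZ varZ δ S x u Z) (t : ℕ) :
    IdentDistrib (h.centredShock t) (h.centredShock 0) P P := by
  have h1 := (h.stationary t).comp (u := fun y => y - fun _ => (μZ, 0)) (measurable_id.sub_const _)
  have h2 : ∀ s, IdentDistrib (h.centredShock s) _ P P := fun s =>
    (IdentDistrib.of_ae_eq (((h.gaussian s).sub_const (fun _ => (μZ, 0))).aemeasurable)
      (h.centredShock_ae s)).symm
  exact (h2 t).trans (h1.trans (h2 0).symm)

lemma hasGaussianLaw_fst (h : IsModel P Φ μ β μZ varZ δ S x u Z) (t : ℕ) (i : Fin N) :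
    HasGaussianLaw (fun ω => (h.centredShock t ω i).1) P :=
  (h.hasGaussianLaw_centredShock t).map
    ((ContinuousLinearMap.fst ℝ ℝ (Fin (J + 1) → ℝ)).comp (ContinuousLinearMap.proj i))

lemma hasGaussianLaw_snd (h : IsModel P Φ μ β μZ varZ δ S x u Z) (t : ℕ) (i : Fin N)
    (a : Fin (J + 1)) : HasGaussianLaw (fun ω => (h.centredShock t ω i).2 a) P :=
  (h.hasGaussianLaw_centredShock t).map ((ContinuousLinearMap.proj (R := ℝ) (φ := fun _ : Fin (J + 1) => ℝ) a).comp
    ((ContinuousLinearMap.snd ℝ ℝ (Fin (J + 1) → ℝ)).comp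
    (ContinuousLinearMap.proj (R := ℝ) (φ := fun _ : Fin N => ℝ × (Fin (J + 1) → ℝ)) i)))

lemma integral_snd (h : IsModel P Φ μ β μZ varZ δ S x u Z) (t : ℕ) (i : Fin N)
    (a : Fin (J + 1)) : ∫ ω, (h.centredShock t ω i).2 a ∂P = 0 := by
  rw [← h.mean_u i t a]
  refine integral_congr_ae ?_
  filter_upwards [h.centredShock_snd t] with ω hω
  rw [hω]

lemma integrable_Z (h : IsModel P Φ μ β μZ varZ δ S x u Z) (t : ℕ) (i : Fin N) :
    Integrable (Z i (t + 1)) P := by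
  have h1 := (h.hasGaussianLaw_fst t i).integrable.add (integrable_const μZ)
  refine h1.congr ?_
  filter_upwards [h.centredShock_fst t] with ω hω
  simp [hω]

lemma integral_fst (h : IsModel P Φ μ β μZ varZ δ S x u Z) (t : ℕ) (i : Fin N) :
    ∫ ω, (h.centredShock t ω i).1 ∂P = 0 := by
  have h1 : ∫ ω, (h.centredShock t ω i).1 ∂P = ∫ ω, (Z i (t + 1) ω - μZ) ∂P := by
    refine integral_congr_ae ?_
    filter_upwards [h.centredShock_fst t] with ω hω
    rw [hω]
  rw [h1, integral_sub (h.integrable_Z t i) (integrable_const _), h.mean_Z]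
  simp

lemma integral_snd_mul_snd (h : IsModel P Φ μ β μZ varZ δ S x u Z) (t : ℕ) (i i' : Fin N)
    (a a' : Fin (J + 1)) :
    ∫ ω, (h.centredShock t ω i).2 a * (h.centredShock t ω i').2 a' ∂P = S (i, a) (i', a') := by
  rw [← h.cov_u i i' t a a', covariance, h.mean_u, h.mean_u]
  refine integral_congr_ae ?_
  filter_upwards [h.centredShock_snd t] with ω hω
  rw [hω, hω, sub_zero, sub_zero]

lemma integral_fst_sq (h : IsModel P Φ μ β μZ varZ δ S x u Z) (t : ℕ) (i : Fin N) :
    ∫ ω, (h.centredShock t ω i).1 ^ 2 ∂P = varZ := by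
  refine Eq.trans ?_ (h.var_Z i t)
  rw [variance_eq_integral (h.integrable_Z t i).aemeasurable, h.mean_Z]
  refine integral_congr_ae ?_
  filter_upwards [h.centredShock_fst t] with ω hω
  rw [hω]

lemma integrable_fst_mul_snd (h : IsModel P Φ μ β μZ varZ δ S x u Z) (t : ℕ) (i i' : Fin N)
    (a : Fin (J + 1)) :
    Integrable (fun ω => (h.centredShock t ω i).1 * (h.centredShock t ω i').2 a) P :=
  (h.hasGaussianLaw_fst t i).memLp_two.integrable_mul (h.hasGaussianLaw_snd t i' a).memLp_two

/-- The second-stage errors have mean 0, so centring the instrument does not affect the exclusion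
moment. For the policy variable the error is identically 0. -/
lemma integral_exclusion (h : IsModel P Φ μ β μZ varZ δ S x u Z) (t : ℕ) (i i' : Fin N)
    (a : Fin (J + 1)) : ∫ ω, (h.centredShock t ω i).1 * ((h.centredShock t ω i').2 a
      - impact β a * (h.centredShock t ω i').2 0) ∂P = 0 := by
  refine Fin.cases ?_ (fun j => ?_) a
  · simp [impact]
  · set v : Ω → ℝ := fun ω => (h.centredShock t ω i').2 j.succ
      - impact β j.succ * (h.centredShock t ω i').2 0 with hv
    have hvi : Integrable v P := (h.hasGaussianLaw_snd t i' _).integrable.sub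
      ((h.hasGaussianLaw_snd t i' 0).integrable.const_mul _)
    have hv0 : ∫ ω, v ω ∂P = 0 := by
      rw [hv, integral_sub (h.hasGaussianLaw_snd t i' _).integrable
        ((h.hasGaussianLaw_snd t i' 0).integrable.const_mul _), integral_const_mul,
        h.integral_snd, h.integral_snd]
      simp
    have hzv : Integrable (fun ω => (h.centredShock t ω i).1 * v ω) P := by
      refine ((h.integrable_fst_mul_snd t i i' j.succ).sub
        ((h.integrable_fst_mul_snd t i i' 0).const_mul (impact β j.succ))).congr
        (Eventually.of_forall fun ω => ?_)
      simp only [hv, Pi.sub_apply]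
      ring
    have h1 : ∫ ω, ((h.centredShock t ω i).1 * v ω + μZ * v ω) ∂P = 0 := by
      rw [← h.exclusion i i' t j]
      refine integral_congr_ae ?_
      filter_upwards [h.centredShock_fst t, h.centredShock_snd t] with ω h1 h2
      simp only [hv, h1, h2, impact, Fin.cons_succ]
      ring
    rw [integral_add hzv (hvi.const_mul _), integral_const_mul, hv0, mul_zero, add_zero] at h1
    exact h1

/-- Exclusion within a unit makes every covariance with the instrument proportional to the policy
covariance, with factors b. -/
lemma integral_fst_mul_snd (h : IsModel P Φ μ β μZ varZ δ S x u Z) (t : ℕ) (i : Fin N)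
    (a : Fin (J + 1)) :
    ∫ ω, (h.centredShock t ω i).1 * (h.centredShock t ω i).2 a ∂P = δ * impact β a := by
  have h0 : ∫ ω, (h.centredShock t ω i).1 * (h.centredShock t ω i).2 0 ∂P = δ := by
    refine Eq.trans ?_ (h.cov_policy i t)
    rw [covariance, h.mean_Z, h.mean_u]
    refine integral_congr_ae ?_
    filter_upwards [h.centredShock_fst t, h.centredShock_snd t] with ω h1 h2
    rw [h1, h2, sub_zero]
  have h1 := h.integral_exclusion t i i a
  have h2 : ∀ ω, (h.centredShock t ω i).1 * ((h.centredShock t ω i).2 a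
      - impact β a * (h.centredShock t ω i).2 0) = (h.centredShock t ω i).1 * (h.centredShock t ω i).2 a
        - impact β a * ((h.centredShock t ω i).1 * (h.centredShock t ω i).2 0) := fun ω => by ring
  simp only [h2] at h1
  rw [integral_sub (h.integrable_fst_mul_snd t i i a)
    ((h.integrable_fst_mul_snd t i i 0).const_mul _), integral_const_mul, h0] at h1
  linarith

lemma isPath_ae (h : IsModel P Φ μ β μZ varZ δ S x u Z) :
    ∀ᵐ ω ∂P, IsPath Φ μ μZ (fun i t => x i t ω) (fun i t => Z i t ω)
      fun t => h.centredShock t ω := by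
  filter_upwards [ae_all_iff.2 h.centredShock_fst, ae_all_iff.2 h.centredShock_snd] with ω h1 h2
  refine ⟨fun i t => ?_, fun i t => ?_⟩
  · rw [h2]
    exact h.pvar i t ω
  · rw [h1]
    ring

end IsModel

end Model

/-! ### From the sequence of models to the theorem -/

section ModelSequence

variable {N J : ℕ} {Ω : ℕ → Type*} [∀ T, MeasurableSpace (Ω T)] {P : ∀ T, Measure (Ω T)}
  [∀ T, IsProbabilityMeasure (P T)] {Φ : Matrix (Fin (J + 1)) (Fin (J + 1)) ℝ}
  {μ : Fin N → Fin (J + 1) → ℝ} {β : Fin J → ℝ} {μZ varZ : ℝ} {δT : ℕ → ℝ}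
  {ST : ℕ → Matrix (Fin N × Fin (J + 1)) (Fin N × Fin (J + 1)) ℝ}
  {Sig : Matrix (Fin N × Fin (J + 1)) (Fin N × Fin (J + 1)) ℝ}
  {x u : ∀ T, Fin N → ℕ → Ω T → Fin (J + 1) → ℝ} {Z : ∀ T, Fin N → ℕ → Ω T → ℝ}

lemma isShock_centredShock
    (h : ∀ T, IsModel (P T) Φ μ β μZ varZ (δT T) (ST T) (x T) (u T) (Z T))
    (hST : Tendsto ST atTop (𝓝 Sig)) :
    IsShock P (fun T => (h T).centredShock) (impact β) varZ δT ST where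
  meas T := (h T).measurable_centredShock
  indep T := (h T).iIndepFun_centredShock
  ident T := (h T).identDistrib_centredShock
  gaussian T := (h T).hasGaussianLaw_centredShock
  mom_z i := by
    refine allMoments_of_hasGaussianLaw (B := varZ) (fun T t => (h T).hasGaussianLaw_fst t i)
      (fun T t => (h T).integral_fst t i) fun T t => ?_
    rw [variance_of_integral_eq_zero ((h T).hasGaussianLaw_fst t i).aemeasurable
      ((h T).integral_fst t i), (h T).integral_fst_sq]
  mom_u i a := by
    have hS : Tendsto (fun T => ST T (i, a) (i, a)) atTop (𝓝 (Sig (i, a) (i, a))) :=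
      tendsto_pi_nhds.1 (tendsto_pi_nhds.1 hST (i, a)) (i, a)
    obtain ⟨B, hB⟩ := hS.bddAbove_range
    refine allMoments_of_hasGaussianLaw (B := B) (fun T t => (h T).hasGaussianLaw_snd t i a)
      (fun T t => (h T).integral_snd t i a) fun T t => ?_
    rw [variance_of_integral_eq_zero ((h T).hasGaussianLaw_snd t i a).aemeasurable
      ((h T).integral_snd t i a)]
    simp only [pow_two]
    rw [(h T).integral_snd_mul_snd]
    exact hB ⟨T, rfl⟩
  mean_z i T t := (h T).integral_fst t i
  mean_u i a T t := (h T).integral_snd t i a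
  cov_u i a i' a' T t := (h T).integral_snd_mul_snd t i i' a a'
  var_z i T t := (h T).integral_fst_sq t i
  cov_zu i a T t := (h T).integral_fst_mul_snd t i a
  excl i i' a T t := (h T).integral_exclusion t i i' a

lemma op_init {C : ℝ} (hinit : ∀ T i a, MemLp (fun ω => x T i 0 ω a) 2 (P T) ∧
      ∫ ω, x T i 0 ω a ^ 2 ∂(P T) ≤ C) (i : Fin N) (a : Fin (J + 1)) :
    OP P fun q : Σ T, Ω T => (x q.1 i 0 q.2 - μ i) a := by
  have h1 : OP P fun q : Σ T, Ω T => x q.1 i 0 q.2 a := by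
    refine OP.of_sq (OP.of_integral C (fun T => (hinit T i a).1.integrable_sq)
      (Eventually.of_forall fun T => ?_))
    simp only [abs_pow, sq_abs]
    exact (hinit T i a).2
  simpa only [Pi.sub_apply, sub_eq_add_neg] using h1.add (OP.const (-μ i a))

/-- At the true response the gap vanishes at b itself, because b has policy entry 1. Being a
statement about b and not about δb, it survives δ = 0. -/
lemma sum_dvec_irf_mul_impact (Φ : Matrix (Fin (J + 1)) (Fin (J + 1)) ℝ) (β : Fin J → ℝ) (k : ℕ)
    (s : Fin (J + 1)) : ∑ a, dvec k s (irf Φ β k s) Φ a * impact β a = 0 := by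
  rw [← gap_eq, gap, irf]
  simp [impact]

/-- The derivative pairs its two directions with the gradients in Φ and in Γ, and the factor from
the inverse Gram matrix is invertible. If both quantities vanished, the derivative would be the zero
map. -/
lemma sens_ne_zero_or_dvec_ne_zero {k : ℕ} {s : Fin (J + 1)} {l : ℝ} {Γ : Fin (J + 1) → ℝ}
    {R : Matrix (Fin (J + 1)) (Fin (J + 1)) ℝ} (hR : IsUnit R.det)
    (h : ∃ H h, gapDeriv k s l Φ Γ H h ≠ 0) :
    sens k s Φ Φ Γ * (R⁻¹).transpose ≠ 0 ∨ dvec k s l Φ ≠ 0 := by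
  by_contra! hc
  obtain ⟨H, g, hg⟩ := h
  have h1 : sens k s Φ Φ Γ = 0 := by
    have h2 : (R⁻¹).transpose * R.transpose = 1 := by
      rw [← Matrix.transpose_mul, Matrix.mul_nonsing_inv _ hR, Matrix.transpose_one]
    rw [← mul_one (sens k s Φ Φ Γ), ← h2, ← mul_assoc, hc.1, zero_mul]
  refine hg ?_
  rw [gapDeriv_eq, h1, hc.2]
  simp [frob]

end ModelSequence

end PSVARIV

theorem mainTheorem3 {J N : ℕ} (hN : 0 < N)
    -- the parameters that do not change with the sample size
    (Φ : Matrix (Fin (J + 1)) (Fin (J + 1)) ℝ)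
    (hΦ : ∀ z ∈ spectrum ℂ (Φ.map (algebraMap ℝ ℂ)), ‖z‖ < 1)
    (μ : Fin N → Fin (J + 1) → ℝ) (β : Fin J → ℝ) (μZ varZ : ℝ) (hvarZ : 0 < varZ)
    -- the drifting parameters
    (δT : ℕ → ℝ) (δ : ℝ) (hδ : Tendsto δT atTop (𝓝 δ))
    (ST : ℕ → Matrix (Fin N × Fin (J + 1)) (Fin N × Fin (J + 1)) ℝ)
    (Sig : Matrix (Fin N × Fin (J + 1)) (Fin N × Fin (J + 1)) ℝ)
    (hST : Tendsto ST atTop (𝓝 Sig)) (hpos : Sig.PosDef)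
    -- the sequence of data-generating processes
    {Ω : ℕ → Type*} [∀ T, MeasurableSpace (Ω T)]
    (P : ∀ T, Measure (Ω T)) [∀ T, IsProbabilityMeasure (P T)]
    (x u : ∀ T, Fin N → ℕ → Ω T → Fin (J + 1) → ℝ) (Z : ∀ T, Fin N → ℕ → Ω T → ℝ)
    (hmodel : ∀ T, PSVARIV.IsModel (P T) Φ μ β μZ varZ (δT T) (ST T) (x T) (u T) (Z T))
    -- presample values have bounded second moments
    (C : ℝ) (hinit : ∀ T i a, MemLp (fun ω => x T i 0 ω a) 2 (P T) ∧
      ∫ ω, x T i 0 ω a ^ 2 ∂(P T) ≤ C)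
    (k : ℕ) (s : Fin (J + 1))
    -- the estimated function of `(Φ, Γ)` is not degenerate at the limit
    (hgrad : ∃ H h, PSVARIV.gapDeriv k s (PSVARIV.irf Φ β k s) Φ
      (δ • PSVARIV.impact β) H h ≠ 0)
    (α : ℝ) (hα0 : 0 < α) (hα1 : α < 1) :
    Tendsto (fun T => (P T).real
      {ω | PSVARIV.irf Φ β k s ∈ PSVARIV.arSet T (fun i t => x T i t ω)
        (fun i t => Z T i t ω) k s α}) atTop (𝓝 (1 - α)) := by
  have hshock := PSVARIV.isShock_centredShock hmodel hST
  obtain ⟨Q, hQ⟩ := hshock.exists_isSecondMoment hΦ hST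
  have hsample : PSVARIV.IsSample P (fun T => (hmodel T).centredShock) Φ μ (PSVARIV.impact β) μZ varZ
      δT δ ST Sig Q (fun q i t => x q.1 i t q.2) (fun q i t => Z q.1 i t q.2) :=
    { shock := hshock
      stable := hΦ
      path := PSVARIV.eventually_inProb_of_ae fun T => (hmodel T).isPath_ae
      init := PSVARIV.op_init hinit
      units := hN
      lim_δ := hδ
      lim_S := hST
      pos := hpos
      moment := hQ }
  exact hsample.tendsto_coverage hvarZ (PSVARIV.sum_dvec_irf_mul_impact Φ β k s)
    (PSVARIV.sens_ne_zero_or_dvec_ne_zero hsample.isUnit_det hgrad) hα0 hα1
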